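/- **Setting.** A natural join query $\mathcal Q=(\mathcal V,\mathcal E)$ consists of finitely many relations $e\in\mathcal E$, each with a set of attributes $e\subseteq\mathcal V$, such that every attribute lies in some relation. It is *acyclic* if it has a join tree: a tree $\mathcal T$ whose nodes are the relations, such that for every attribute the relations containing it are connected in $\mathcal T$. A stream $D$ of $N$ tuples inserts, one at a time and without duplicates, tuples $t$ (defined exactly on the attributes of $e$) into relations $R_e$ of an initially empty database; $\mathcal R^i$ is the database after the first $i$ insertions, and $\mathcal Q(\mathcal R^i)$ is the set of tuples on $\mathcal V$ whose projection onto each $e$ lies in $R_e$. The domains of the attributes are arbitrary sets. **Algorithm ReservoirJoin** (for a join tree $\mathcal T$ and a sample size $k\ge 1$). For every root $r$ the tree $\mathcal T$ is considered as rooted at $r$; let $\mathrm{key}(e)$ be the common attributes of a non-root node $e$ and its parent $p_e$, and $\mathcal C_e$ the children of $e$. For a tuple $t$ over $\mathrm{key}(e)$ the index keeps the list $R_{p_e}\ltimes t$, the counter $\mathrm{cnt}[r,e,t]=\sum_{t'\in R_e\ltimes t}\prod_{c\in\mathcal C_e}\mathrm{wcnt}[r,c,\pi_{\mathrm{key}(c)}t']$,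 where $\mathrm{wcnt}$ is $\mathrm{cnt}$ rounded up to a power of two ($0$ stays $0$), and, for each $j$, a bucket with those $t'\in R_e\ltimes t$ whose product in this sum is $2^j$. When a tuple is inserted, the index is updated from its node upwards, propagating to the tuples $t'\in R_{p_e}\ltimes t$ whenever $\mathrm{wcnt}[r,e,t]$ changes and $p_e\neq r$. The tuple $t$ inserted into $R_e$ then defines (in the tree rooted at $e$) a batch of $\prod_{c\in\mathcal C_e}\mathrm{wcnt}[e,c,\pi_{\mathrm{key}(c)}t]$ positions, each of which holds a new join result or a dummy, and which is not materialised: the item at a position is retrieved by decomposing the position into one position for each child, locating the latter by a scan of the buckets of the child's key (dummy if it is not less than $\mathrm{cnt}$), and recursing. On the stream of these batches the algorithm runs reservoir sampling: it fills the reservoir $S$ with the first $k$ non-dummy items; then it sets $w=u^{1/k}$ and repeatedly skips $q=\lfloor\ln u'/\ln(1-w)\rfloor$ items (across batches if necessary) and retrieves the next item; if this is not a dummy, it replaces a uniformly random element of $S$ by it and multiplies $w$ by $u''^{1/k}$; here $u,u',u'',\dots$ are fresh independent uniform random numbers in $[0,1]$. Time is the number of elementary steps on a real RAM with hash tables and arrays;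 integer and real arithmetic including $\ln$, powers and rounding, accesses to table and array entries, operations on single tuples, and drawing a random number take unit time up to constants. **Statement.** For every acyclic join $\mathcal Q$ there is a constant $C>0$, depending only on $\mathcal Q$, such that for every join tree of $\mathcal Q$, all domains, every $k\ge1$ and every stream of $N$ tuples, ReservoirJoin has the following properties. 1. For every $0\le i\le N$, after the first $i$ tuples the reservoir is a uniform sample of size $k$ without replacement from the (finite) set $\mathcal Q(\mathcal R^i)$, that is, it has no repetitions and is uniformly distributed on the subsets of $\mathcal Q(\mathcal R^i)$ with $\min(k,|\mathcal Q(\mathcal R^i)|)$ elements. 2. If $N\ge2$, the expected total time is at most $$C\Big(N\log N+k\,\log N\,\log\Big(1+\frac{|\mathcal Q(\mathcal R^N)|}{k}\Big)\Big).$$ 3. If $N\ge 2$, $k\le N$, $\kappa\ge1$ and $k\log N\le\kappa N$, the expected total time is at most $$C\kappa\Big(N\log N+k\,\log N\,\log\frac Nk\Big).$$ (In particular, for every fixed $\varepsilon>0$ it is $O\big(N\log N+k\log N\log\frac Nk\big)$ for all $1\le k\le N^{1-\varepsilon}$.) -/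

import Mathlib

open MeasureTheory

/-! ### Natural joins, join trees, streams -/

/-- A natural join query on the attributes `V`: finitely many relations `e : ι`, each with a finite
attribute set `sch e`, every attribute occurring in some relation. A set of hyperedges
`ℰ ⊆ 2^V` is the special case in which `sch` is injective. -/
structure JoinQuery (V ι : Type) where
  sch : ι → Finset V
  cover : ∀ x, ∃ e, x ∈ sch e

/-- A (partial) tuple: `t x = some a` if `t` has value `a` on `x`, and `t x = none` if `t` is not
defined on the attribute `x`. -/
abbrev Tup {V : Type} (dom : V → Type) : Type := (x : V) → Option (dom x)

namespace Tup

variable {V : Type} {dom : V → Type}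

/-- The set of attributes on which `t` is defined. -/
def supp (t : Tup dom) : Set V := {x | t x ≠ none}

/-- The projection `π_s t`. -/
def proj [DecidableEq V] (s : Finset V) (t : Tup dom) : Tup dom :=
  fun x => if x ∈ s then t x else none

/-- The combination of two tuples (which agree on their common attributes when we use it). -/
def merge (s t : Tup dom) : Tup dom := fun x => (s x).or (t x)

end Tup

namespace JoinQuery

variable {V ι : Type} {dom : V → Type}

/-- `T` is a join tree of `Q`: a tree on the relations in which, for every attribute, the relations
containing it are connected. -/
def IsJoinTree (Q : JoinQuery V ι) (T : SimpleGraph ι) : Prop :=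
  T.IsTree ∧ ∀ x : V, (T.induce {e | x ∈ Q.sch e}).Connected

/-- (Alpha-)acyclic joins. -/
def IsAcyclic (Q : JoinQuery V ι) : Prop := ∃ T : SimpleGraph ι, Q.IsJoinTree T

/-- The join results of `Q` over the instance `R`: the tuples on all attributes whose projection
onto each relation's attributes belongs to that relation. -/
def results [DecidableEq V] (Q : JoinQuery V ι) (R : ι → Set (Tup dom)) : Set (Tup dom) :=
  {t | t.supp = Set.univ ∧ ∀ e, Tup.proj (Q.sch e) t ∈ R e}

/-- A finite insertion stream without duplicates; the entry `(e, t)` inserts the tuple `t`, which is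
defined exactly on the attributes of `e`, into the relation `e`. -/
def IsStream (Q : JoinQuery V ι) (D : List (ι × Tup dom)) : Prop :=
  D.Nodup ∧ ∀ p ∈ D, p.2.supp = (Q.sch p.1 : Set V)

end JoinQuery

/-- The database that consists of all the tuples inserted by `D`. -/
def database {V ι : Type} {dom : V → Type} (D : List (ι × Tup dom)) : ι → Set (Tup dom) :=
  fun e => {t | (e, t) ∈ D}

/-! ### Timed and randomized computations

A timed computation is a value together with the number of elementary steps spent on it. The
elementary steps (cost one each) are those of a RAM with hash tables: a read or a write of one
entry of a hash table or of an array (arrays know their length and may grow and shrink at the end),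
one operation on integers (`+`, `-`, `*`, `/`, `%`, powers and logarithms with base 2, comparison)
or on reals (also powers, `ln` and `⌊·⌋`), an operation on single tuples (whose number of
attributes is a constant), and a call of the random number generator. -/

structure Timed (α : Type) where
  val : α
  cost : ℕ

instance : Monad Timed where
  pure a := ⟨a, 0⟩
  bind x f := ⟨(f x.val).val, x.cost + (f x.val).cost⟩

/-- Spend `n` elementary steps. -/
def spend (n : ℕ) : Timed Unit := ⟨(), n⟩

/-- The infinite supply of random numbers in `[0,1]`. -/
abbrev Tape : Type := ℕ → unitInterval

/-- The numbers on the tape are independent and uniformly distributed on `[0,1]`. -/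
noncomputable def tapeMeasure : Measure Tape :=
  Measure.infinitePi fun _ : ℕ => (volume : Measure unitInterval)

/-- Randomized timed computations: they use up the tape from its beginning. -/
abbrev RTimed (α : Type) : Type := StateT Tape Timed α

/-- The next random number; one step. -/
def rand : RTimed ℝ := fun ω => ⟨((ω 0 : ℝ), fun n => ω (n + 1)), 1⟩

/-! ### The dynamic index -/

section Rooted

variable {ι : Type} [Fintype ι]

open Classical in
/-- The children of `e` in the tree `T` rooted at `r`. -/
noncomputable def children (T : SimpleGraph ι) (r e : ι) : List ι :=
  (Finset.univ.filter fun c => T.Adj e c ∧ T.dist r c = T.dist r e + 1).toList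

open Classical in
/-- The parent of `e` in the tree `T` rooted at `r`; `none` for the root. -/
noncomputable def parent (T : SimpleGraph ι) (r e : ι) : Option ι :=
  if h : ∃ p, T.Adj e p ∧ T.dist r p + 1 = T.dist r e then some h.choose else none

end Rooted

/-- The index. All the functions are hash tables whose entries are numbers or arrays.
* `rel e f t`: the tuples of `R_e` with projection `t` onto the attributes common to `e` and `f`;
* `cnt r e t`: the counter of the key `t` at the node `e` of the tree rooted at `r`;
* `bucket r e t i`: the `i`-th bucket of the key `t` at the node `e` of the tree rooted at `r`;
  it is stored as an array together with a hash table of the positions of its elements. -/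
structure Index {V : Type} (ι : Type) (dom : V → Type) where
  rel : ι → ι → Tup dom → List (Tup dom)
  cnt : ι → ι → Tup dom → ℕ
  bucket : ι → ι → Tup dom → ℕ → List (Tup dom)

/-- `n` rounded up to a power of two (`0` stays `0`). -/
def roundUp (n : ℕ) : ℕ := if n = 0 then 0 else 2 ^ Nat.clog 2 n

open Classical in
/-- Remove `a` from an array: move the last element to the position of `a`, drop the last cell. -/
noncomputable def swapRemove {α : Type} (l : List α) (a : α) : List α :=
  match l.getLast? with
  | none => l
  | some b => (l.set (l.idxOf a) b).dropLast

open Classical in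
/-- The table `f` with the entry at `(a, b, c)` replaced by `v`. -/
noncomputable def update3 {α β γ δ : Type} (f : α → β → γ → δ) (a : α) (b : β) (c : γ) (v : δ) :
    α → β → γ → δ :=
  fun a' b' c' => if a' = a ∧ b' = b ∧ c' = c then v else f a' b' c'

namespace Index

variable {V ι : Type} {dom : V → Type}

def empty : Index ι dom := ⟨fun _ _ _ => [], fun _ _ _ => 0, fun _ _ _ _ => []⟩

/-- Write one entry of the table `cnt`; one step. -/
noncomputable def setCnt (L : Index ι dom) (r e : ι) (t : Tup dom) (n : ℕ) : Timed (Index ι dom) := do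
  spend 1
  return ⟨L.rel, update3 L.cnt r e t n, L.bucket⟩

/-- Append `a` to a list of `rel`; three steps (find the list, write the new cell and the length). -/
noncomputable def appendRel (L : Index ι dom) (e f : ι) (t a : Tup dom) : Timed (Index ι dom) := do
  spend 3
  return ⟨update3 L.rel e f t (L.rel e f t ++ [a]), L.cnt, L.bucket⟩

open Classical in
/-- Append `a` to a bucket; four steps (as above, and record the position of `a`). -/
noncomputable def appendBucket (L : Index ι dom) (r e : ι) (t : Tup dom) (i : ℕ) (a : Tup dom) :
    Timed (Index ι dom) := do
  spend 4
  return ⟨L.rel, L.cnt, update3 L.bucket r e t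
    (Function.update (L.bucket r e t) i (L.bucket r e t i ++ [a]))⟩

open Classical in
/-- Remove `a` from a bucket; seven steps (find the bucket and the position of `a`, read the last
cell, write it to that position, update two recorded positions, and the length). -/
noncomputable def removeBucket (L : Index ι dom) (r e : ι) (t : Tup dom) (i : ℕ) (a : Tup dom) :
    Timed (Index ι dom) := do
  spend 7
  return ⟨L.rel, L.cnt, update3 L.bucket r e t
    (Function.update (L.bucket r e t) i (swapRemove (L.bucket r e t i) a))⟩

/-- The approximate counter: read `cnt` and round up to a power of two; two steps. -/
def wcnt (L : Index ι dom) (r e : ι) (t : Tup dom) : Timed ℕ := do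
  spend 2
  return roundUp (L.cnt r e t)

end Index

section Algorithm

variable {V ι : Type} [DecidableEq V] [Fintype ι] {dom : V → Type}

/-- The attributes common to two relations. -/
def JoinQuery.common (Q : JoinQuery V ι) (e f : ι) : Finset V := Q.sch e ∩ Q.sch f

/-- The product of the approximate counters of the projections of `t` at the nodes in the given list
(which consists of children of `e` in the tree rooted at `r`). -/
def wprod (Q : JoinQuery V ι) (L : Index ι dom) (r e : ι) (t : Tup dom) : List ι → Timed ℕ
  | [] => do
    spend 1
    return 1
  | c :: cs => do
    spend 2
    let a ← L.wcnt r c (Tup.proj (Q.common c e) t)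
    let b ← wprod Q L r e t cs
    return a * b

open Classical in
/-- `IndexUpdate` for the tree `T` rooted at `r`: the approximate degree of the tuple `t` of the
relation `e` was `old` and has to be updated. Nothing is stored for the root. The first argument
bounds the depth of the recursion, which climbs towards the root. -/
noncomputable def indexUpdate (Q : JoinQuery V ι) (T : SimpleGraph ι) (r : ι) :
    ℕ → ι → Tup dom → ℕ → Index ι dom → Timed (Index ι dom)
  | 0, _, _, _, L => pure L
  | depth + 1, e, t, old, L => do
    spend 1
    match parent T r e with
    | none => return L
    | some p =>
      spend 1
      let te := Tup.proj (Q.common e p) t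
      let new ← wprod Q L r e t (children T r e)
      spend 4
      let L ← if 0 < old then L.removeBucket r e te (Nat.log 2 old) t else pure L
      let L ← if 0 < new then L.appendBucket r e te (Nat.log 2 new) t else pure L
      let j ← L.wcnt r e te
      spend 3
      let L ← L.setCnt r e te (L.cnt r e te + new - old)
      let j' ← L.wcnt r e te
      spend 2
      if j' ≠ j ∧ p ≠ r then
        (L.rel p e te).foldlM (fun L t' => do
          spend 2
          let b ← wprod Q L r p t' ((children T r p).filter (· ≠ e))
          indexUpdate Q T r depth p t' (j * b) L) L
      else return L

/-- Insert the tuple `t` into the relation `e`: store it, then update all the rooted trees. -/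
noncomputable def indexInsert (Q : JoinQuery V ι) (T : SimpleGraph ι) (L : Index ι dom)
    (e : ι) (t : Tup dom) : Timed (Index ι dom) := do
  let L ← (Finset.univ : Finset ι).toList.foldlM (fun L f => do
    spend 1
    L.appendRel e f (Tup.proj (Q.common e f) t) t) L
  (Finset.univ : Finset ι).toList.foldlM (fun L r => do
    spend 1
    indexUpdate Q T r (Fintype.card ι) e t 0 L) L

/-- Scan the buckets `i, i + 1, …` of the key `t`, at most as many as the first argument says, for
the position `z`, counted from the beginning of the bucket `i`. The answer is the number of the
bucket with this position and the position relative to its beginning. -/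
def findBucket (L : Index ι dom) (r e : ι) (t : Tup dom) : ℕ → ℕ → ℕ → Timed (Option (ℕ × ℕ))
  | 0, _, _ => do
    spend 1
    return none
  | n + 1, i, z => do
    spend 5
    let φ := 2 ^ i * (L.bucket r e t i).length
    if z < φ then return some (i, z) else findBucket L r e t n (i + 1) (z - φ)

/-- The position `z` in the batch of the key `t` at the node `e`: the tuple `t'` of `R_e` to whose
batch the position belongs, and the position in the batch of `t'`; `none` (dummy) if `z` is at least
the counter of `t`. Buckets with numbers above the logarithm of the counter are empty. -/
def locate (L : Index ι dom) (r e : ι) (t : Tup dom) (z : ℕ) :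
    Timed (Option (Tup dom × ℕ)) := do
  spend 3
  if L.cnt r e t ≤ z then return none
  else
    match ← findBucket L r e t (Nat.log 2 (L.cnt r e t) + 1) 0 z with
    | none => return none
    | some (i, z') =>
      spend 5
      return ((L.bucket r e t i)[z' / 2 ^ i]?).map fun t' => (t', z' % 2 ^ i)

/-- `Retrieve`: the join result at the position `z` of the batch of the tuple `t` of the relation
`e`, in the tree `T` rooted at `r`; `none` is a dummy. The position is decomposed into one position
for each child (mixed radix, the last child being the least significant), these are retrieved
recursively, and the results are combined with `t`. The first argument bounds the depth of the
recursion, which descends to the leaves. -/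
noncomputable def retrieve (Q : JoinQuery V ι) (T : SimpleGraph ι) (L : Index ι dom) (r : ι) :
    ℕ → ι → Tup dom → ℕ → Timed (Option (Tup dom))
  | 0, _, _, _ => pure none
  | depth + 1, e, t, z => do
    spend 1
    let out ← (children T r e).foldrM (fun c (acc : Option (Tup dom) × ℕ) => do
      spend 4
      let key := Tup.proj (Q.common c e) t
      let w ← L.wcnt r c key
      let y ← match ← locate L r c key (acc.2 % w) with
        | none => pure none
        | some (t', l) => retrieve Q T L r depth c t' l
      let res : Option (Tup dom) := match acc.1, y with
        | some a, some b => some (Tup.merge a b)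
        | _, _ => none
      return (res, acc.2 / w)) (some t, z)
    return out.1

/-! ### Reservoir sampling -/

/-- A batch is given implicitly by its size and by access to its items by position (`0`-based);
`none` is a dummy item, `some t` a real one. -/
structure Batch (dom : V → Type) where
  size : ℕ
  get : ℕ → Timed (Option (Tup dom))

/-- `BatchGenerate` for the tuple `t` just inserted into `e`: use the tree rooted at `e`. -/
noncomputable def batchGenerate (Q : JoinQuery V ι) (T : SimpleGraph ι) (L : Index ι dom)
    (e : ι) (t : Tup dom) : Timed (Batch dom) := do
  let n ← wprod Q L e e t (children T e e)
  return ⟨n, retrieve Q T L e (Fintype.card ι) e t⟩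

/-- The first loop of `BatchUpdate`. The first numerical argument is the number of remaining
items of the batch, so the position of the next item is `B.size` minus it. -/
def fillLoop (k : ℕ) (B : Batch dom) : ℕ → List (Tup dom) → Timed (List (Tup dom) × ℕ)
  | 0, S => do
    spend 2
    return (S, 0)
  | rem + 1, S => do
    spend 3
    if S.length < k then
      spend 3
      match ← B.get (B.size - (rem + 1)) with
      | some y =>
        spend 2
        fillLoop k B rem (S ++ [y])
      | none => fillLoop k B rem S
    else return (S, rem + 1)

/-- A random number with the geometric distribution with success probability `w`. -/
noncomputable def geo (w : ℝ) : RTimed ℕ := do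
  let u ← rand
  spend 5
  return ⌊Real.log u / Real.log (1 - w)⌋₊

/-- The second loop of `BatchUpdate`: `rem` items of the batch remain, of which the next `q` have to
be skipped. The reservoir is the array `S`; a random element of it is replaced. -/
noncomputable def sampleLoop (k : ℕ) (B : Batch dom) (S : List (Tup dom)) (w : ℝ) (rem q : ℕ) :
    RTimed (List (Tup dom) × ℝ × ℕ) :=
  if _h : q < rem then do
    spend 6
    match ← B.get (B.size - rem + q) with
    | some x =>
      let u ← rand
      spend 3
      let S' := S.set ⌊(k : ℝ) * u⌋₊ x
      let v ← rand
      spend 3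
      let w' := w * v ^ (1 / (k : ℝ))
      let q' ← geo w'
      sampleLoop k B S' w' (rem - (q + 1)) q'
    | none =>
      let q' ← geo w
      sampleLoop k B S w (rem - (q + 1)) q'
  else do
    spend 3
    return (S, w, q - rem)
termination_by rem
decreasing_by all_goals omega

/-- `BatchUpdate`. The initial value `+∞` of the parameter `w` is `none`. -/
noncomputable def batchUpdate (k : ℕ) (S : List (Tup dom)) (w : Option ℝ) (q : ℕ) (B : Batch dom) :
    RTimed (List (Tup dom) × Option ℝ × ℕ) := do
  let (S, rem) ← fillLoop k B B.size S
  spend 2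
  if S.length < k then return (S, w, q)
  else
    let (w, q) ← match w with
      | some w => pure (w, q)
      | none => do
        let u ← rand
        spend 2
        let w := u ^ (1 / (k : ℝ))
        let q ← geo w
        pure (w, q)
    let (S, w, q) ← sampleLoop k B S w rem q
    return (S, some w, q)

/-- The state of `ReservoirJoin`: the index, the reservoir and the parameters `w`, `q`. -/
structure RJState {V : Type} (ι : Type) (dom : V → Type) where
  index : Index ι dom
  S : List (Tup dom)
  w : Option ℝ
  q : ℕ

/-- One iteration of `ReservoirJoin`. -/
noncomputable def reservoirStep (Q : JoinQuery V ι) (T : SimpleGraph ι) (k : ℕ)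
    (s : RJState ι dom) (p : ι × Tup dom) : RTimed (RJState ι dom) := do
  spend 2
  let L ← indexInsert Q T s.index p.1 p.2
  let B ← batchGenerate Q T L p.1 p.2
  let (S, w, q) ← batchUpdate k s.S s.w s.q B
  return ⟨L, S, w, q⟩

/-- `ReservoirJoin`, using the join tree `T`, on the stream `D` with sample size `k`. -/
noncomputable def reservoirJoin (Q : JoinQuery V ι) (T : SimpleGraph ι) (k : ℕ)
    (D : List (ι × Tup dom)) : RTimed (RJState ι dom) := do
  spend 4
  D.foldlM (reservoirStep Q T k) ⟨Index.empty, [], none, 0⟩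

/-- The reservoir after the stream `D` has been processed, for given random numbers. (After only the
first `i` tuples of a longer stream, it is `reservoirSample Q T k (D.take i) ω`.) -/
noncomputable def reservoirSample (Q : JoinQuery V ι) (T : SimpleGraph ι) (k : ℕ)
    (D : List (ι × Tup dom)) (ω : Tape) : List (Tup dom) :=
  (reservoirJoin Q T k D ω).val.1.S

/-- The number of steps spent on the whole stream `D`, for given random numbers. -/
noncomputable def reservoirTime (Q : JoinQuery V ι) (T : SimpleGraph ι) (k : ℕ)
    (D : List (ι × Tup dom)) (ω : Tape) : ℕ :=
  (reservoirJoin Q T k D ω).cost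

end Algorithm

/-- The random list `S` is a uniform sample of size `k` without replacement from the finite set `J`
(all of `J` if it has fewer than `k` elements): it has no repetitions, and its set of elements is
uniformly distributed on the subsets of `J` with `min k |J|` elements. -/
def IsUniformSample {Ω α : Type} [MeasurableSpace Ω] (μ : Measure Ω) (S : Ω → List α) (k : ℕ)
    (J : Set α) : Prop :=
  J.Finite ∧ ∀ A : Finset α, (A : Set α) ⊆ J → A.card = min k J.ncard →
    MeasurableSet {ω | (S ω : Multiset α) = A.val} ∧
    μ {ω | (S ω : Multiset α) = A.val} = ((J.ncard.choose (min k J.ncard) : ℕ) : ENNReal)⁻¹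

/-- The expectation of a running time. -/
noncomputable def expectedTime (time : Tape → ℕ) : ENNReal :=
  ∫⁻ ω, (time ω : ENNReal) ∂tapeMeasure

/-! Concatenating the batches of all insertions gives one list of real items and dummies, and the
algorithm is skip-based reservoir sampling on that list. The proof separates the law of this
sampling, the deterministic correctness of the index, the density of real items, and the amortised
cost.

Sampling. Attach an independent uniform number to each real item. In distribution, the reservoir
consists of the `k` items with the smallest numbers, `w` is the `k`-th smallest number, and a new
item is accepted when its number is below `w`. Hence the number of items to skip is geometric given
`w`, and after an acceptance the new threshold is the maximum of `k` uniform numbers on `(0, w)`,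
that is `w * u ^ (1 / k)`. `SampleLaw` records that the reservoir is uniform and independent of `w`,
with the law of `w` and `q` just described. `SampleLaw.step_none` holds by memorylessness, and
`SampleLaw.step_some` by two identities for order statistics and a double count of subsets.
`foldlM_reservoirStep_eq` carries this over to the algorithm.

Index. `updateCorrect` shows that one recursive update restores all counters and buckets of a rooted
tree. Positions of a batch are mixed-radix numbers, so its items are products of the children's
items (`map_childItem`, `keyItems_eq`). The join tree ensures that attributes shared by different
subtrees pass through keys, so these products are exactly the join results of the subtree
(`childItems_spec`). A result is new precisely when it uses the inserted tuple
(`JoinQuery.mem_results_concat`), hence the batches enumerate the join without repetition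
(`streamItems_spec`).

Cost. A propagation happens only when a rounded counter changes, so each parent tuple is visited
only logarithmically often per child; `potential` counts these visits and all counters are
polynomial in `N`, which gives `O(N log N)`. Rounding at most doubles a counter and puts its dummies
last, so a constant fraction of every prefix of the stream is real
(`IndexCorrect.prefixDense_tupleItems`). After `r ≥ k` real items the next item is touched with
probability `k / (r + 1)`; a harmonic sum bounds the expected number of retrievals by `O(k log (1 +
|Q| / k))`, each costing `O(log N)`. For the last bound, `|Q|` is polynomial in `N`, so the
hypothesis on `k` makes the sampling term `O(κ N log N)`. -/

/-! ### The tape -/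

/-- The tape after the first number has been used. -/
def Tape.tail (ω : Tape) : Tape := fun n => ω (n + 1)

lemma Tape.measurable_tail : Measurable Tape.tail :=
  measurable_pi_lambda _ fun _ => measurable_pi_apply _

@[fun_prop]
lemma Measurable.tapeTail {β : Type*} [MeasurableSpace β] {f : β → Tape} (hf : Measurable f) :
    Measurable fun b => (f b).tail := Tape.measurable_tail.comp hf

@[fun_prop]
lemma Measurable.tapeApply {β : Type*} [MeasurableSpace β] {f : β → Tape} (hf : Measurable f)
    (n : ℕ) : Measurable fun b => ((f b n : unitInterval) : ℝ) :=
  measurable_subtype_coe.comp ((measurable_pi_apply n).comp hf)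

instance : IsProbabilityMeasure tapeMeasure := by unfold tapeMeasure; infer_instance

/-- Reading a number leaves a fresh tape independent of it. The converse direction is easier to
check: prepending a uniform number to a fresh tape gives the product measure, which is determined by
its values on boxes; prepending is then inverted. -/
lemma map_head_tail_tapeMeasure :
    tapeMeasure.map (fun ω => (ω 0, ω.tail)) = (volume : Measure unitInterval).prod tapeMeasure := by
  have hcons : Measurable fun p : unitInterval × Tape =>
      ((fun n => Nat.casesOn n p.1 p.2) : Tape) := by
    refine measurable_pi_lambda _ fun n => ?_
    cases n with
    | zero => exact measurable_fst
    | succ n => exact (measurable_pi_apply n).comp measurable_snd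
  have key : ((volume : Measure unitInterval).prod tapeMeasure).map
      (fun p => ((fun n => Nat.casesOn n p.1 p.2) : Tape)) = tapeMeasure := by
    refine Measure.eq_infinitePi _ fun s t ht => ?_
    classical
    rw [Measure.map_apply hcons (MeasurableSet.pi s.countable_toSet fun i _ => ht i)]
    set s' : Finset ℕ := s.preimage Nat.succ (Nat.succ_injective.injOn) with hs'
    set t0 : Set unitInterval := if 0 ∈ s then t 0 else Set.univ with ht0
    have : (fun p : unitInterval × Tape => ((fun n => Nat.casesOn n p.1 p.2) : Tape)) ⁻¹'
        ((s : Set ℕ).pi t) = t0 ×ˢ ((s' : Set ℕ).pi fun n => t (n + 1)) := by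
      ext ⟨u, ω⟩
      simp only [Set.mem_preimage, Set.mem_pi, Finset.mem_coe, Set.mem_prod, hs',
        Finset.mem_preimage, ht0]
      constructor
      · intro h
        refine ⟨?_, fun n hn => h (n + 1) hn⟩
        split_ifs with h0
        · exact h 0 h0
        · trivial
      · rintro ⟨h1, h2⟩ n hn
        cases n with
        | zero => simpa [hn] using h1
        | succ n => exact h2 n hn
    rw [this, Measure.prod_prod, tapeMeasure, Measure.infinitePi_pi _ (fun i _ => ht _)]
    by_cases h0 : 0 ∈ s
    · have : s = insert 0 (s'.image Nat.succ) := by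
        ext n; cases n <;> simp [hs', h0]
      rw [this, Finset.prod_insert (by simp), Finset.prod_image (by simp)]
      simp [ht0, h0]
    · have : s = s'.image Nat.succ := by
        ext n; cases n <;> simp [hs', h0]
      rw [this, Finset.prod_image (by simp)]
      simp [ht0, h0]
  have hm : Measurable fun ω : Tape => (ω 0, ω.tail) :=
    (measurable_pi_apply 0).prodMk Tape.measurable_tail
  conv_lhs => rw [← key]
  rw [Measure.map_map hm hcons]
  exact Measure.map_id

/-- The endpoints are null, and discarding them avoids the degenerate values of logarithms and
powers. -/
lemma lintegral_unitInterval (f : ℝ → ENNReal) :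
    ∫⁻ u : unitInterval, f u = ∫⁻ u in Set.Ioo (0 : ℝ) 1, f u := by
  rw [show (∫⁻ u : unitInterval, f u) = ∫⁻ u in Set.Icc (0 : ℝ) 1, f u from
    lintegral_subtype_comap measurableSet_Icc f]
  exact setLIntegral_congr Ioo_ae_eq_Icc.symm

lemma lintegral_tape {f : ℝ → Tape → ENNReal} (hf : Measurable (Function.uncurry f)) :
    ∫⁻ ω, f (ω 0) ω.tail ∂tapeMeasure =
      ∫⁻ u in Set.Ioo (0 : ℝ) 1, ∫⁻ ω, f u ω ∂tapeMeasure := by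
  have hm : Measurable fun ω : Tape => (ω 0, ω.tail) :=
    (measurable_pi_apply 0).prodMk Tape.measurable_tail
  have hf' : Measurable fun p : unitInterval × Tape => f p.1 p.2 :=
    hf.comp ((measurable_subtype_coe.comp measurable_fst).prodMk measurable_snd)
  rw [← lintegral_unitInterval, ← lintegral_prod (fun p : unitInterval × Tape => f p.1 p.2)
    hf'.aemeasurable, ← map_head_tail_tapeMeasure, lintegral_map hf' hm]

/-! ### The distributions of the random numbers used by the algorithm -/

/-- The number of items to be skipped, computed from a uniform random number. -/
noncomputable def geoValue (w u : ℝ) : ℕ := ⌊Real.log u / Real.log (1 - w)⌋₊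

@[fun_prop]
lemma Measurable.geoValue {β : Type*} [MeasurableSpace β] {f g : β → ℝ} (hf : Measurable f)
    (hg : Measurable g) : Measurable fun b => geoValue (f b) (g b) := by
  unfold _root_.geoValue; fun_prop

/-- Both logarithms are negative, so clearing the denominator reverses the floor inequalities;
exponentiating them gives intervals between consecutive powers of `1 - w`. -/
lemma geoValue_eq_iff {w u : ℝ} (hw : w ∈ Set.Ioo (0 : ℝ) 1) (hu : u ∈ Set.Ioo (0 : ℝ) 1) (n : ℕ) :
    geoValue w u = n ↔ (1 - w) ^ (n + 1) < u ∧ u ≤ (1 - w) ^ n := by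
  have h1 : 0 < 1 - w := by linarith [hw.2]
  have hl : Real.log (1 - w) < 0 := Real.log_neg h1 (by linarith [hw.1])
  have hu' : Real.log u < 0 := Real.log_neg hu.1 hu.2
  rw [geoValue, Nat.floor_eq_iff (div_nonneg_of_nonpos hu'.le hl.le), le_div_iff_of_neg hl,
    div_lt_iff_of_neg hl, and_comm, ← Nat.cast_add_one, ← Real.log_pow, ← Real.log_pow,
    Real.log_lt_log_iff (by positivity) hu.1, Real.log_le_log_iff hu.1 (by positivity)]

/-- The weights of the geometric distribution. -/
noncomputable def geoWeight (w : ℝ) (n : ℕ) : ENNReal := ENNReal.ofReal (w * (1 - w) ^ n)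

lemma lintegral_geoValue {w : ℝ} (hw : w ∈ Set.Ioo (0 : ℝ) 1) (G : ℕ → ENNReal) :
    ∫⁻ u in Set.Ioo (0 : ℝ) 1, G (geoValue w u) = ∑' n, geoWeight w n * G n := by
  have hm : Measurable fun u => geoValue w u := by fun_prop
  rw [← lintegral_map (f := G) (measurable_of_countable G) hm, lintegral_countable']
  refine tsum_congr fun n => ?_
  rw [mul_comm]
  congr 1
  rw [Measure.map_apply hm (measurableSet_singleton n),
    Measure.restrict_apply (hm (measurableSet_singleton n))]
  have h1 : 0 < 1 - w := by linarith [hw.2]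
  have h2 : 1 - w < 1 := by linarith [hw.1]
  -- The point `1` is removed because the interval for `n = 0` is closed there.
  have : (fun u => geoValue w u) ⁻¹' {n} ∩ Set.Ioo 0 1 =
      Set.Ioc ((1 - w) ^ (n + 1)) ((1 - w) ^ n) \ {1} := by
    ext u
    simp only [Set.mem_inter_iff, Set.mem_preimage, Set.mem_singleton_iff, Set.mem_sdiff,
      Set.mem_Ioc]
    constructor
    · rintro ⟨h, hu⟩
      exact ⟨(geoValue_eq_iff hw hu n).1 h, hu.2.ne⟩
    · rintro ⟨h, hu⟩
      have hu' : u ∈ Set.Ioo (0 : ℝ) 1 :=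
        ⟨(by positivity : (0 : ℝ) < (1 - w) ^ (n + 1)).trans h.1,
          lt_of_le_of_ne (h.2.trans (pow_le_one₀ h1.le h2.le)) hu⟩
      exact ⟨(geoValue_eq_iff hw hu' n).2 h, hu'⟩
  rw [this, measure_sdiff_null (by simp), Real.volume_Ioc, geoWeight]
  congr 1
  ring

lemma tsum_geoWeight {w : ℝ} (hw : w ∈ Set.Ioo (0 : ℝ) 1) : ∑' n, geoWeight w n = 1 := by
  have := lintegral_geoValue hw fun _ => 1
  simpa using this.symm

/-- Substitution `u = (x / w) ^ k`. The resulting density is that of the largest of `k` independent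
uniform numbers on `(0, w)`. -/
lemma lintegral_mul_rpow {k : ℕ} (hk : 1 ≤ k) {w : ℝ} (hw : 0 < w) (G : ℝ → ENNReal) :
    ∫⁻ u in Set.Ioo (0 : ℝ) 1, G (w * u ^ (1 / (k : ℝ))) =
      ∫⁻ x in Set.Ioo 0 w, ENNReal.ofReal (k * x ^ (k - 1) / w ^ k) * G x := by
  have hk0 : (k : ℝ) ≠ 0 := by positivity
  have him : (fun x : ℝ => (x / w) ^ k) '' Set.Ioo 0 w = Set.Ioo 0 1 := by
    ext u
    constructor
    · rintro ⟨x, hx, rfl⟩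
      have : 0 < x / w := div_pos hx.1 hw
      exact ⟨by positivity, pow_lt_one₀ this.le ((div_lt_one hw).2 hx.2) (by omega)⟩
    · intro hu
      refine ⟨w * u ^ (1 / (k : ℝ)), ⟨mul_pos hw (Real.rpow_pos_of_pos hu.1 _), ?_⟩, ?_⟩
      · have : u ^ (1 / (k : ℝ)) < 1 := Real.rpow_lt_one hu.1.le hu.2 (by positivity)
        nlinarith
      · simp only
        rw [mul_div_cancel_left₀ _ hw.ne', ← Real.rpow_natCast, ← Real.rpow_mul hu.1.le,
          one_div_mul_cancel hk0, Real.rpow_one]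
  have hinj : Set.InjOn (fun x : ℝ => (x / w) ^ k) (Set.Ioo 0 w) := by
    intro x hx y hy h
    have := (pow_left_inj₀ (div_pos hx.1 hw).le (div_pos hy.1 hw).le (by omega)).1 h
    field_simp at this
    exact this
  have hd : ∀ x ∈ Set.Ioo 0 w, HasDerivWithinAt (fun x : ℝ => (x / w) ^ k)
      (k * x ^ (k - 1) / w ^ k) (Set.Ioo 0 w) x := by
    intro x hx
    have := ((hasDerivAt_id x).div_const w).pow k
    refine (this.congr_deriv ?_).hasDerivWithinAt
    obtain ⟨j, rfl⟩ : ∃ j, k = j + 1 := ⟨k - 1, by omega⟩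
    simp only [id, Nat.add_sub_cancel, div_pow]
    field_simp
    ring
  rw [← him, lintegral_image_eq_lintegral_abs_deriv_mul measurableSet_Ioo hd hinj]
  refine setLIntegral_congr_fun measurableSet_Ioo fun x hx => ?_
  have h1 : 0 ≤ (k : ℝ) * x ^ (k - 1) / w ^ k := by
    have := hx.1.le; positivity
  have h2 : ((x / w) ^ k) ^ (1 / (k : ℝ)) = x / w := by
    rw [← Real.rpow_natCast, ← Real.rpow_mul (div_pos hx.1 hw).le, mul_one_div_cancel hk0,
      Real.rpow_one]
  simp only [abs_of_nonneg h1, h2]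
  rw [mul_div_cancel₀ _ hw.ne']

/-- The density of the `k`-th smallest of `r` independent uniform random numbers. -/
noncomputable def orderDensity (k r : ℕ) (x : ℝ) : ℝ :=
  k * r.choose k * x ^ (k - 1) * (1 - x) ^ (r - k)

lemma orderDensity_nonneg (k r : ℕ) {x : ℝ} (hx : x ∈ Set.Ioo (0 : ℝ) 1) :
    0 ≤ orderDensity k r x := by
  have h1 := hx.1.le
  have h2 : 0 ≤ 1 - x := by linarith [hx.2]
  unfold orderDensity; positivity

@[fun_prop]
lemma measurable_orderDensity (k r : ℕ) : Measurable (orderDensity k r) := by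
  unfold orderDensity; fun_prop

/-- The expectation of `G` at the `k`-th smallest of `r` independent uniform random numbers. -/
noncomputable def orderMean (k r : ℕ) (G : ℝ → ENNReal) : ENNReal :=
  ∫⁻ x in Set.Ioo (0 : ℝ) 1, ENNReal.ofReal (orderDensity k r x) * G x

lemma orderMean_congr {k r : ℕ} {G G' : ℝ → ENNReal} (h : ∀ x ∈ Set.Ioo (0 : ℝ) 1, G x = G' x) :
    orderMean k r G = orderMean k r G' :=
  setLIntegral_congr_fun measurableSet_Ioo fun x hx => by simp only [h x hx]

lemma orderMean_add {k r : ℕ} {G G' : ℝ → ENNReal} (h : Measurable G) :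
    orderMean k r (fun x => G x + G' x) = orderMean k r G + orderMean k r G' := by
  unfold orderMean
  rw [← lintegral_add_left (by fun_prop)]
  simp only [mul_add]

lemma orderMean_sum {k r : ℕ} {ι : Type*} (s : Finset ι) {G : ι → ℝ → ENNReal}
    (h : ∀ i ∈ s, Measurable (G i)) :
    orderMean k r (fun x => ∑ i ∈ s, G i x) = ∑ i ∈ s, orderMean k r (G i) := by
  unfold orderMean
  rw [← lintegral_finsetSum' _ (fun i hi => by have := h i hi; fun_prop)]
  simp only [Finset.mul_sum]

lemma orderMean_const_mul {k r : ℕ} (c : ENNReal) {G : ℝ → ENNReal} (h : Measurable G) :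
    orderMean k r (fun x => c * G x) = c * orderMean k r G := by
  unfold orderMean
  rw [← lintegral_const_mul _ (by fun_prop)]
  simp only [mul_left_comm]

/-- The `k`-th smallest of `k` numbers is their maximum, so this is the law of the first threshold.
-/
lemma orderMean_self {k : ℕ} (hk : 1 ≤ k) (G : ℝ → ENNReal) :
    ∫⁻ u in Set.Ioo (0 : ℝ) 1, G (u ^ (1 / (k : ℝ))) = orderMean k k G := by
  have := lintegral_mul_rpow hk one_pos G
  simpa [orderMean, orderDensity] using this

lemma choose_succ_mul {k r : ℕ} (h : k ≤ r) :
    ((r + 1).choose k : ℝ) * (r + 1 - k) = r.choose k * (r + 1) := by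
  have := Nat.choose_mul_succ_eq r k
  have h2 : ((r + 1 - k : ℕ) : ℝ) = r + 1 - k := by
    rw [Nat.cast_sub (by omega)]; push_cast; ring
  rw [← h2]
  exact_mod_cast this.symm

/-- A further uniform number exceeds the `k`-th smallest `x` with probability `1 - x` and then
leaves it in place; by symmetry this has total probability `(r + 1 - k) / (r + 1)`. The densities
are proportional, so the integrands already agree. -/
lemma orderMean_skip {k r : ℕ} (h : k ≤ r) {G : ℝ → ENNReal} (hG : Measurable G) :
    orderMean k r (fun x => ENNReal.ofReal (1 - x) * G x) =
      ENNReal.ofReal ((r + 1 - k) / (r + 1)) * orderMean k (r + 1) G := by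
  unfold orderMean
  rw [← lintegral_const_mul _ (by fun_prop)]
  refine setLIntegral_congr_fun measurableSet_Ioo fun x hx => ?_
  have hkr : (k : ℝ) ≤ r := by exact_mod_cast h
  simp only [← mul_assoc]
  rw [← ENNReal.ofReal_mul (orderDensity_nonneg _ _ hx), ← ENNReal.ofReal_mul
    (div_nonneg (by linarith) (by positivity))]
  congr 2
  unfold orderDensity
  have := choose_succ_mul h
  rw [Nat.succ_sub h, pow_succ]
  field_simp
  linear_combination (-(k * x ^ (k - 1) * (1 - x) ^ (r - k) * (1 - x))) * this

lemma lintegral_one_sub_pow (n : ℕ) {x : ℝ} (hx : x ∈ Set.Ioo (0 : ℝ) 1) :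
    ∫⁻ w in Set.Ioo x 1, ENNReal.ofReal ((1 - w) ^ n) =
      ENNReal.ofReal ((1 - x) ^ (n + 1) / (n + 1)) := by
  rw [setLIntegral_congr Ioo_ae_eq_Ioc, ← ofReal_integral_eq_lintegral_ofReal]
  · rw [← intervalIntegral.integral_of_le hx.2.le,
      intervalIntegral.integral_comp_sub_left (fun y => y ^ n)]
    simp
  · exact (Continuous.integrableOn_Icc (by fun_prop)).mono_set Set.Ioc_subset_Icc_self
  · refine (ae_restrict_mem measurableSet_Ioc).mono fun w hw => ?_
    have : 0 ≤ 1 - w := by linarith [hw.2]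
    simp only [Pi.zero_apply]; positivity

/-- The complementary case: the further number falls below the `k`-th smallest `w`, and the new
`k`-th smallest is the maximum of `k` independent uniform numbers on `(0, w)`. After Tonelli only
the integral of `(1 - w) ^ (r - k)` over `w > x` is left. -/
lemma orderMean_replace {k r : ℕ} (hk : 1 ≤ k) (h : k ≤ r) {G : ℝ → ENNReal} (hG : Measurable G) :
    orderMean k r (fun w => ENNReal.ofReal w *
      ∫⁻ u in Set.Ioo (0 : ℝ) 1, G (w * u ^ (1 / (k : ℝ)))) =
      ENNReal.ofReal (k / (r + 1)) * orderMean k (r + 1) G := by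
  have e1 : orderMean k r (fun w => ENNReal.ofReal w *
      ∫⁻ u in Set.Ioo (0 : ℝ) 1, G (w * u ^ (1 / (k : ℝ)))) =
      ∫⁻ w in Set.Ioo (0 : ℝ) 1, ∫⁻ x in Set.Ioo (0 : ℝ) 1, (Set.Ioi x).indicator
        (fun w => ENNReal.ofReal (k * k * r.choose k * (1 - w) ^ (r - k))) w *
        (ENNReal.ofReal (x ^ (k - 1)) * G x) := by
    refine setLIntegral_congr_fun measurableSet_Ioo fun w hw => ?_
    simp only
    rw [lintegral_mul_rpow hk hw.1, ← mul_assoc, ← ENNReal.ofReal_mul (orderDensity_nonneg _ _ hw),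
      ← lintegral_const_mul' _ _ ENNReal.ofReal_ne_top]
    -- The inner domain is made independent of `w`, the constraint `x < w` becoming an indicator, so
    -- that the integrals can be swapped.
    have hs : Set.Ioo 0 w = Set.Ioo 0 1 ∩ Set.Iio w := by
      ext x; simp only [Set.mem_Ioo, Set.mem_inter_iff, Set.mem_Iio]
      exact ⟨fun h => ⟨⟨h.1, h.2.trans hw.2⟩, h.2⟩, fun h => ⟨h.1.1, h.2⟩⟩
    rw [hs, ← Measure.restrict_restrict_of_subset Set.inter_subset_left,
      Measure.restrict_restrict (by measurability), Set.inter_comm _ (Set.Iio w), Set.inter_assoc,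
      Set.inter_self, ← Measure.restrict_restrict measurableSet_Iio,
      ← lintegral_indicator measurableSet_Iio]
    refine setLIntegral_congr_fun measurableSet_Ioo fun x hx => ?_
    simp only [Set.indicator, Set.mem_Iio, Set.mem_Ioi]
    split_ifs with hxw
    · rw [← mul_assoc, ← mul_assoc, ← ENNReal.ofReal_mul
        (mul_nonneg (orderDensity_nonneg _ _ hw) hw.1.le), ← ENNReal.ofReal_mul]
      · congr 2
        unfold orderDensity
        obtain ⟨j, rfl⟩ : ∃ j, k = j + 1 := ⟨k - 1, by omega⟩
        have := hw.1.ne'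
        simp only [Nat.add_sub_cancel]
        field_simp
        ring
      · have : 0 ≤ 1 - w := by linarith [hw.2]
        positivity
    · simp
  rw [e1, lintegral_lintegral_swap]
  · rw [orderMean, ← lintegral_const_mul _ (by fun_prop)]
    refine setLIntegral_congr_fun measurableSet_Ioo fun x hx => ?_
    rw [lintegral_mul_const _ (Measurable.indicator (by fun_prop) measurableSet_Ioi),
      lintegral_indicator measurableSet_Ioi, Measure.restrict_restrict measurableSet_Ioi]
    have hs : Set.Ioi x ∩ Set.Ioo 0 1 = Set.Ioo x 1 := by
      ext w; simp only [Set.mem_Ioo, Set.mem_inter_iff, Set.mem_Ioi]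
      exact ⟨fun h => ⟨h.1, h.2.2⟩, fun h => ⟨h.1, hx.1.trans h.1, h.2⟩⟩
    rw [hs]
    have hc : ∀ w : ℝ, ENNReal.ofReal (k * k * r.choose k * (1 - w) ^ (r - k)) =
      ENNReal.ofReal (k * k * r.choose k) * ENNReal.ofReal ((1 - w) ^ (r - k)) :=
        fun w => ENNReal.ofReal_mul (by positivity)
    simp only [hc]
    rw [lintegral_const_mul' _ _ ENNReal.ofReal_ne_top, lintegral_one_sub_pow _ hx,
      ← ENNReal.ofReal_mul (by positivity), ← mul_assoc, ← mul_assoc]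
    have h1 : 0 ≤ 1 - x := by linarith [hx.2]
    rw [← ENNReal.ofReal_mul (by positivity), ← ENNReal.ofReal_mul (by positivity)]
    congr 2
    unfold orderDensity
    have hkr : ((r - k : ℕ) : ℝ) = r - k := by rw [Nat.cast_sub h]
    have hp : (0 : ℝ) < r - k + 1 := by rw [← hkr]; positivity
    have := choose_succ_mul h
    rw [Nat.succ_sub h, hkr]
    field_simp
    linear_combination (-(x ^ (k - 1) * (1 - x) ^ (r - k) * (1 - x))) * this
  · refine (Measurable.mul ?_ (by fun_prop)).aemeasurable
    have : MeasurableSet {p : ℝ × ℝ | p.2 < p.1} := measurableSet_lt measurable_snd measurable_fst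
    exact Measurable.ite this (by fun_prop) measurable_const

/-- Each index below `k` is taken on an interval of length `1 / k`, so the replaced position is
uniform. -/
lemma lintegral_floor_mul {k : ℕ} (hk : 1 ≤ k) (G : ℕ → ENNReal) :
    ∫⁻ u in Set.Ioo (0 : ℝ) 1, G ⌊(k : ℝ) * u⌋₊ =
      ∑ j ∈ Finset.range k, ENNReal.ofReal (1 / k) * G j := by
  have hk0 : (0 : ℝ) < k := by positivity
  have hm : Measurable fun u : ℝ => ⌊(k : ℝ) * u⌋₊ := by fun_prop
  rw [← lintegral_map (f := G) (measurable_of_countable G) hm, lintegral_countable',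
    tsum_eq_sum (s := Finset.range k)]
  · refine Finset.sum_congr rfl fun j hj => ?_
    rw [mul_comm]
    congr 1
    rw [Measure.map_apply hm (measurableSet_singleton j),
      Measure.restrict_apply (hm (measurableSet_singleton j))]
    have hjk : (j : ℝ) + 1 ≤ k := by exact_mod_cast Finset.mem_range.1 hj
    have : (fun u : ℝ => ⌊(k : ℝ) * u⌋₊) ⁻¹' {j} ∩ Set.Ioo 0 1 =
        Set.Ico (j / k : ℝ) ((j + 1) / k) \ {0} := by
      ext u
      simp only [Set.mem_inter_iff, Set.mem_preimage, Set.mem_singleton_iff, Set.mem_sdiff,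
        Set.mem_Ico, Set.mem_Ioo, div_le_iff₀ hk0, lt_div_iff₀ hk0]
      constructor
      · rintro ⟨h, hu⟩
        rw [Nat.floor_eq_iff (mul_nonneg hk0.le hu.1.le)] at h
        exact ⟨⟨by linarith, by linarith⟩, hu.1.ne'⟩
      · rintro ⟨h, hu⟩
        have hu0 : 0 < u := by
          have : 0 ≤ u * k := le_trans (by positivity) h.1
          exact lt_of_le_of_ne (nonneg_of_mul_nonneg_left this hk0) (Ne.symm hu)
        rw [Nat.floor_eq_iff (mul_nonneg hk0.le hu0.le)]
        exact ⟨⟨by linarith, by linarith⟩, hu0, by nlinarith⟩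
    rw [this, measure_sdiff_null (by simp), Real.volume_Ico]
    congr 1
    ring
  · intro j hj
    rw [Measure.map_apply hm (measurableSet_singleton j),
      Measure.restrict_apply (hm (measurableSet_singleton j))]
    suffices h : (fun u : ℝ => ⌊(k : ℝ) * u⌋₊) ⁻¹' {j} ∩ Set.Ioo 0 1 = ∅ by
      rw [h, measure_empty, mul_zero]
    ext u
    simp only [Set.mem_inter_iff, Set.mem_preimage, Set.mem_singleton_iff, Set.mem_Ioo,
      Set.mem_empty_iff_false, iff_false, not_and]
    intro h hu hu1
    rw [Nat.floor_eq_iff (mul_nonneg hk0.le hu.le)] at h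
    have : (k : ℝ) ≤ j := by exact_mod_cast not_lt.1 (fun h => hj (Finset.mem_range.2 h))
    nlinarith [h.1]

/-! ### Sub-multisets -/

section Multisets

variable {α : Type*}

/-- Double counting: a sub-multiset with `j` elements extends by one further element in `card X - j`
ways. If `X` has fewer than `j` elements, both sides are empty. -/
lemma Multiset.powersetCard_bind_powersetCard (j : ℕ) (X : Multiset α) :
    (X.powersetCard (j + 1)).bind (Multiset.powersetCard j) =
      (X.card - j) • X.powersetCard j := by
  induction X using Multiset.induction_on generalizing j with
  | empty => simp [Multiset.powersetCard_zero_right]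
  | cons a X ih =>
    rw [Multiset.powersetCard_cons, Multiset.add_bind, ih, Multiset.bind_map, Multiset.card_cons]
    cases j with
    | zero =>
      simp only [Multiset.powersetCard_zero_left, Multiset.singleton_bind]
      rw [Nat.sub_zero, Nat.sub_zero, add_nsmul, one_nsmul]
    | succ i =>
      have : (X.powersetCard (i + 1)).bind (fun A => Multiset.powersetCard (i + 1) (a ::ₘ A)) =
          X.powersetCard (i + 1) + ((X.card - i) • X.powersetCard i).map (Multiset.cons a) := by
        have hX : X.powersetCard (i + 1) = (X.powersetCard (i + 1)).bind fun A => {A} := by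
          rw [Multiset.bind_singleton, Multiset.map_id']
        conv_rhs => rw [← ih, Multiset.map_bind, hX]
        rw [Multiset.bind_assoc]
        simp only [Multiset.singleton_bind]
        rw [← Multiset.bind_add]
        refine Multiset.bind_congr fun A hA => ?_
        rw [Multiset.powersetCard_cons]
        congr 1
        rw [← (Multiset.mem_powersetCard.1 hA).2, Multiset.powersetCard_self]
      rw [this, Multiset.powersetCard_cons, ← add_assoc, Multiset.map_nsmul, smul_add]
      congr 1
      · rcases lt_or_ge X.card (i + 1) with h | h
        · simp [Multiset.powersetCard_eq_empty _ h]
        · rw [show X.card + 1 - (i + 1) = X.card - (i + 1) + 1 by omega, add_nsmul, one_nsmul]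
      · congr 1; omega

/-- Deleting each position once produces all sub-multisets with one element fewer, with
multiplicity. This turns a uniformly chosen position into a sum over sub-multisets. -/
lemma List.sum_eraseIdx_eq_sum_powersetCard {M : Type*} [AddCommMonoid M] (j : ℕ) (S : List α)
    (hS : S.length = j + 1) (g : Multiset α → M) :
    ∑ i ∈ Finset.range (j + 1), g (S.eraseIdx i : Multiset α) =
      (((S : Multiset α).powersetCard j).map g).sum := by
  induction S generalizing j g with
  | nil => simp at hS
  | cons a S ih =>
    rw [Finset.sum_range_succ']
    simp only [List.length_cons, Nat.add_right_cancel_iff] at hS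
    simp only [List.eraseIdx_cons_succ, List.eraseIdx_cons_zero]
    cases j with
    | zero =>
      have : S = [] := List.length_eq_zero_iff.1 hS
      subst this
      simp
    | succ i =>
      rw [← Multiset.cons_coe, Multiset.powersetCard_cons, Multiset.map_add, Multiset.sum_add,
        Multiset.map_map, add_comm]
      congr 1
      · conv_rhs => rw [← hS, ← Multiset.coe_card, Multiset.powersetCard_self]
        simp
      · rw [← ih i hS (g ∘ Multiset.cons a)]
        simp

end Multisets

/-! ### Reservoir sampling, one item at a time -/

section Sampling

variable {α : Type}

/-- The reservoir, the parameters `w` and `q`, and the random numbers not used so far. -/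
abbrev SampleState (α : Type) : Type := List α × ℝ × ℕ × Tape

/-- Process one item of the stream. -/
noncomputable def sampleStep (k : ℕ) (s : SampleState α) (x : Option α) : SampleState α :=
  let (S, w, q, ω) := s
  if S.length < k then
    match x with
    | none => (S, w, q, ω)
    | some y =>
      if S.length + 1 < k then (S ++ [y], w, q, ω)
      else
        let w' := (ω 0 : ℝ) ^ (1 / (k : ℝ))
        (S ++ [y], w', geoValue w' (ω.tail 0), ω.tail.tail)
  else if 0 < q then (S, w, q - 1, ω)
  else
    match x with
    | none => (S, w, geoValue w (ω 0), ω.tail)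
    | some y =>
      let w' := w * (ω.tail 0 : ℝ) ^ (1 / (k : ℝ))
      (S.set ⌊(k : ℝ) * (ω 0 : ℝ)⌋₊ y, w', geoValue w' (ω.tail.tail 0), ω.tail.tail.tail)

/-- Process a list of items. -/
noncomputable def sampleRun (k : ℕ) (s : SampleState α) (l : List (Option α)) : SampleState α :=
  l.foldl (sampleStep k) s

/-- Measurability of a function of the state for each reservoir. -/
def FiberMeasurable {β : Type*} [MeasurableSpace β] (F : SampleState α → β) : Prop :=
  ∀ S, Measurable fun p : ℝ × ℕ × Tape => F (S, p)

variable {β : Type*} [MeasurableSpace β]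

/-- The overwritten position is random but lies in the countable type `ℕ`, so measurability can be
checked for each value of it. -/
lemma measurable_set_floor {F : SampleState α → β} (hF : FiberMeasurable F) (S : List α) (y : α)
    {γ : Type*} [MeasurableSpace γ] {j : γ → ℕ} (hj : Measurable j) {g : γ → ℝ × ℕ × Tape}
    (hg : Measurable g) : Measurable fun p => F (S.set (j p) y, g p) := by
  have : Measurable fun z : (ℝ × ℕ × Tape) × ℕ => F (S.set z.2 y, z.1) :=
    measurable_from_prod_countable_left fun n => hF (S.set n y)
  exact this.comp (hg.prodMk hj)

/-- The lists carry no σ-algebra, so measurability is tracked only in the other coordinates; this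
class of functions has to be stable under a sampling step. -/
lemma FiberMeasurable.comp_sampleStep {F : SampleState α → β} (hF : FiberMeasurable F) (k : ℕ)
    (x : Option α) : FiberMeasurable fun s => F (sampleStep k s x) := by
  intro S
  by_cases hS : S.length < k
  · cases x with
    | none => simpa [sampleStep, hS] using hF S
    | some y =>
      by_cases h1 : S.length + 1 < k
      · simpa [sampleStep, hS, h1] using hF _
      · simp only [sampleStep, hS, h1, if_true, if_false]
        exact (hF (S ++ [y])).comp (by fun_prop)
  · have hq : MeasurableSet {p : ℝ × ℕ × Tape | 0 < p.2.1} :=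
      measurableSet_lt measurable_const (by fun_prop)
    have : (fun p : ℝ × ℕ × Tape => F (sampleStep k (S, p) x)) = fun p => if 0 < p.2.1
      then F (S, p.1, p.2.1 - 1, p.2.2) else F (match x with
        | none => (S, p.1, geoValue p.1 (p.2.2 0), p.2.2.tail)
        | some y => (S.set ⌊(k : ℝ) * (p.2.2 0 : ℝ)⌋₊ y,
          p.1 * (p.2.2.tail 0 : ℝ) ^ (1 / (k : ℝ)),
          geoValue (p.1 * (p.2.2.tail 0 : ℝ) ^ (1 / (k : ℝ))) (p.2.2.tail.tail 0),
          p.2.2.tail.tail.tail)) := by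
      funext p
      simp only [sampleStep, hS, if_false]
      split_ifs <;> cases x <;> rfl
    rw [this]
    refine Measurable.ite hq ((hF S).comp (by fun_prop)) ?_
    cases x with
    | none => exact (hF S).comp (by fun_prop)
    | some y => exact measurable_set_floor hF S y (by fun_prop) (by fun_prop)

lemma FiberMeasurable.comp_sampleRun {F : SampleState α → β} (hF : FiberMeasurable F) (k : ℕ)
    (l : List (Option α)) : FiberMeasurable fun s => F (sampleRun k s l) := by
  induction l with
  | nil => exact hF
  | cons x l ih => exact ih.comp_sampleStep k x

/-- The mean of `F` for a geometric `q` and random numbers independent of each other. -/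
noncomputable def tailMean (F : ℝ × ℕ × Tape → ENNReal) (w : ℝ) : ENNReal :=
  ∑' n, geoWeight w n * ∫⁻ ω, F (w, n, ω) ∂tapeMeasure

@[fun_prop]
lemma measurable_geoWeight (n : ℕ) : Measurable fun w => geoWeight w n := by
  unfold geoWeight; fun_prop

lemma measurable_tailMean {F : ℝ × ℕ × Tape → ENNReal} (hF : Measurable F) :
    Measurable (tailMean F) := by
  refine Measurable.tsum fun n => (measurable_geoWeight n).mul ?_
  have : Measurable fun p : ℝ × Tape => F (p.1, n, p.2) := hF.comp (by fun_prop)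
  exact this.lintegral_prod_right'

lemma lintegral_geoValue_tape {F : ℝ × ℕ × Tape → ENNReal} (hF : Measurable F) {w : ℝ}
    (hw : w ∈ Set.Ioo (0 : ℝ) 1) :
    ∫⁻ ω, F (w, geoValue w (ω 0), ω.tail) ∂tapeMeasure = tailMean F w := by
  rw [lintegral_tape (f := fun u ω => F (w, geoValue w u, ω)) (hF.comp (by fun_prop)),
    lintegral_geoValue hw fun n => ∫⁻ ω, F (w, n, ω) ∂tapeMeasure]
  rfl

/-- Memorylessness: `q = 0` has probability `w`, and given `q > 0` the number `q - 1` is again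
geometric. -/
lemma tailMean_eq_add (F : ℝ × ℕ × Tape → ENNReal) {w : ℝ} (hw : w ∈ Set.Ioo (0 : ℝ) 1) :
    tailMean F w = ENNReal.ofReal w * ∫⁻ ω, F (w, 0, ω) ∂tapeMeasure +
      ENNReal.ofReal (1 - w) * tailMean (fun p => F (p.1, p.2.1 + 1, p.2.2)) w := by
  have h1 : 0 ≤ 1 - w := by linarith [hw.2]
  rw [tailMean, tsum_eq_zero_add' ENNReal.summable, tailMean, ← ENNReal.tsum_mul_left]
  congr 1
  · simp [geoWeight]
  · refine tsum_congr fun n => ?_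
    rw [← mul_assoc, geoWeight, geoWeight, ← ENNReal.ofReal_mul h1]
    congr 2
    ring

/-- A skipped dummy leaves `q - 1`, geometric given `q > 0`; a dummy that is hit causes a fresh draw
with the same `w`. Both branches have the same law, so dummies do not disturb the sampling. -/
lemma tailMean_sampleStep_none {F : SampleState α → ENNReal} (hF : FiberMeasurable F) {k : ℕ}
    {S : List α} (hS : S.length = k) {w : ℝ} (hw : w ∈ Set.Ioo (0 : ℝ) 1) :
    tailMean (fun p => F (sampleStep k (S, p) none)) w = tailMean (fun p => F (S, p)) w := by
  have h1 : 0 ≤ 1 - w := by linarith [hw.2]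
  rw [tailMean_eq_add _ hw]
  simp only [sampleStep, hS, lt_irrefl, if_false, Nat.succ_pos, if_true, Nat.add_sub_cancel]
  rw [lintegral_geoValue_tape (F := fun p => F (S, p)) (hF S) hw]
  rw [← add_mul, ← ENNReal.ofReal_add hw.1.le h1]
  simp

/-- With probability `w` the item is hit and overwrites a uniform position; otherwise `q` has its
former law by memorylessness. -/
lemma tailMean_sampleStep_some {F : SampleState α → ENNReal} (hF : FiberMeasurable F) {k : ℕ}
    (hk : 1 ≤ k) {S : List α} (hS : S.length = k) (y : α) {w : ℝ} (hw : w ∈ Set.Ioo (0 : ℝ) 1) :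
    tailMean (fun p => F (sampleStep k (S, p) (some y))) w =
      ENNReal.ofReal w * (∑ j ∈ Finset.range k, ENNReal.ofReal (1 / k) *
        ∫⁻ v in Set.Ioo (0 : ℝ) 1, tailMean (fun p => F (S.set j y, p)) (w * v ^ (1 / (k : ℝ)))) +
      ENNReal.ofReal (1 - w) * tailMean (fun p => F (S, p)) w := by
  rw [tailMean_eq_add _ hw]
  simp only [sampleStep, hS, lt_irrefl, if_false, Nat.succ_pos, if_true, Nat.add_sub_cancel]
  congr 2
  rw [lintegral_tape (f := fun u ω => F (S.set ⌊(k : ℝ) * u⌋₊ y,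
    w * (ω 0 : ℝ) ^ (1 / (k : ℝ)), geoValue (w * (ω 0 : ℝ) ^ (1 / (k : ℝ))) (ω.tail 0),
    ω.tail.tail)) (measurable_set_floor hF S y (by fun_prop) (by fun_prop)),
    lintegral_floor_mul hk fun j => ∫⁻ ω, F (S.set j y,
    w * (ω 0 : ℝ) ^ (1 / (k : ℝ)), geoValue (w * (ω 0 : ℝ) ^ (1 / (k : ℝ))) (ω.tail 0),
    ω.tail.tail) ∂tapeMeasure]
  refine Finset.sum_congr rfl fun j _ => ?_
  congr 1
  rw [lintegral_tape (f := fun v ω => F (S.set j y, w * v ^ (1 / (k : ℝ)),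
    geoValue (w * v ^ (1 / (k : ℝ))) (ω 0), ω.tail)) ((hF _).comp (by fun_prop))]
  refine setLIntegral_congr_fun measurableSet_Ioo fun v hv => ?_
  have hv0 := Real.rpow_pos_of_pos hv.1 (1 / (k : ℝ))
  have hv1 : v ^ (1 / (k : ℝ)) < 1 := Real.rpow_lt_one hv.1.le hv.2 (by positivity)
  exact lintegral_geoValue_tape (F := fun p => F (S.set j y, p)) (hF _)
    ⟨mul_pos hw.1 hv0, by nlinarith [hw.1, hw.2]⟩

/-- After the real items `X` the reservoir is a uniform sample of size `k` of `X`, `w` is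
distributed like the `k`-th smallest of independent uniform numbers, one for each item, `q` is
geometrically distributed given `w`, and the unused random numbers are fresh. -/
def SampleLaw (k : ℕ) (X : List α) (f : Tape → SampleState α) : Prop :=
  ∃ Φ : (List α → ENNReal) →ₗ[ENNReal] ENNReal,
    (∀ h h', (∀ S, S.length = k → h S = h' S) → Φ h = Φ h') ∧
    (∀ h : Multiset α → ENNReal, Φ (fun S => h S) = ENNReal.ofReal (1 / X.length.choose k) *
      (((X : Multiset α).powersetCard k).map h).sum) ∧
    ∀ F : SampleState α → ENNReal, FiberMeasurable F → ∫⁻ ω, F (f ω) ∂tapeMeasure =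
      Φ fun S => orderMean k X.length (tailMean fun p => F (S, p))

lemma SampleLaw.step_none {k : ℕ} {X : List α} {f : Tape → SampleState α} (hf : SampleLaw k X f) :
    SampleLaw k X fun ω => sampleStep k (f ω) none := by
  obtain ⟨Φ, h1, h2, h3⟩ := hf
  refine ⟨Φ, h1, h2, fun F hF => ?_⟩
  rw [h3 _ (hF.comp_sampleStep k none)]
  exact h1 _ _ fun S hS => orderMean_congr fun w hw => tailMean_sampleStep_none hF hS hw

/-- The reservoir has just been filled with all real items, so it is deterministic and `Φ` is
evaluation at it. -/
lemma SampleLaw.init {k : ℕ} (hk : 1 ≤ k) {X : List α} (hX : X.length = k) :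
    SampleLaw k X fun ω => (X, (ω 0 : ℝ) ^ (1 / (k : ℝ)),
      geoValue ((ω 0 : ℝ) ^ (1 / (k : ℝ))) (ω.tail 0), ω.tail.tail) := by
  refine ⟨LinearMap.proj X, fun h h' H => H X hX, fun h => ?_, fun F hF => ?_⟩
  · subst hX
    rw [← Multiset.coe_card, Multiset.powersetCard_self]
    simp
  · rw [lintegral_tape (f := fun v ω => F (X, v ^ (1 / (k : ℝ)),
      geoValue (v ^ (1 / (k : ℝ))) (ω 0), ω.tail)) ((hF _).comp (by fun_prop))]
    simp only [LinearMap.proj_apply, hX]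
    rw [← orderMean_self hk]
    refine setLIntegral_congr_fun measurableSet_Ioo fun v hv => ?_
    exact lintegral_geoValue_tape (F := fun p => F (X, p)) (hF _)
      ⟨Real.rpow_pos_of_pos hv.1 _, Real.rpow_lt_one hv.1.le hv.2 (by positivity)⟩

/-- Averaging over `w` gives acceptance probability `k / (r + 1)` whatever the reservoir is, and
each of the `k` positions is overwritten with equal probability; hence the mixture with weight `(r +
1 - k) / (r + 1)` for the old reservoir and `1 / (r + 1)` per position. In both cases the law of the
threshold becomes the order density for `r + 1` items. -/
lemma SampleLaw.step_some {k : ℕ} (hk : 1 ≤ k) {X : List α} (hX : k ≤ X.length)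
    {f : Tape → SampleState α} (hf : SampleLaw k X f) (y : α) :
    SampleLaw k (X ++ [y]) fun ω => sampleStep k (f ω) (some y) := by
  obtain ⟨Φ, h1, h2, h3⟩ := hf
  set r := X.length with hr
  have hkr : (k : ℝ) ≤ r := by exact_mod_cast hX
  have hk0 : (0 : ℝ) < k := by positivity
  refine ⟨ENNReal.ofReal ((r + 1 - k) / (r + 1)) • Φ + ENNReal.ofReal (1 / (r + 1)) •
    ∑ j ∈ Finset.range k, Φ ∘ₗ LinearMap.funLeft ENNReal ENNReal (fun S => S.set j y),
    ?_, ?_, ?_⟩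
  · intro h h' H
    simp only [LinearMap.add_apply, LinearMap.smul_apply, LinearMap.sum_apply,
      LinearMap.comp_apply]
    congr 2
    · exact h1 _ _ H
    · refine Finset.sum_congr rfl fun j _ => h1 _ _ fun S hS => ?_
      exact H _ (by simp [hS])
  · intro h
    simp only [LinearMap.add_apply, LinearMap.smul_apply, LinearMap.sum_apply,
      LinearMap.comp_apply]
    rw [h2, ← map_sum]
    -- Overwriting a position means deleting it and adding `y`, so the sum over positions runs over
    -- the `(k - 1)`-element sub-multisets of the reservoir.
    have e1 : Φ (∑ j ∈ Finset.range k, LinearMap.funLeft ENNReal ENNReal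
        (fun S : List α => S.set j y) fun S => h S) = Φ fun S : List α =>
        (((S : Multiset α).powersetCard (k - 1)).map fun B => h (y ::ₘ B)).sum := by
      refine h1 _ _ fun S hS => ?_
      obtain ⟨i, rfl⟩ : ∃ i, k = i + 1 := ⟨k - 1, by omega⟩
      rw [Nat.add_sub_cancel, ← List.sum_eraseIdx_eq_sum_powersetCard i S hS]
      simp only [Finset.sum_apply, LinearMap.funLeft_apply]
      refine Finset.sum_congr rfl fun j hj => ?_
      congr 1
      rw [Multiset.cons_coe, Multiset.coe_eq_coe]
      exact List.set_perm_cons_eraseIdx (by rw [hS]; exact Finset.mem_range.1 hj) y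
    rw [e1, h2 fun M => ((M.powersetCard (k - 1)).map fun B => h (y ::ₘ B)).sum]
    obtain ⟨i, rfl⟩ : ∃ i, k = i + 1 := ⟨k - 1, by omega⟩
    rw [Nat.add_sub_cancel, ← Multiset.sum_bind, ← Multiset.map_bind,
      Multiset.powersetCard_bind_powersetCard]
    -- The `k`-element sub-multisets of the longer list split into those taken from `X` and those
    -- with `y` added; the two terms of the mixture match them separately.
    have e2 : ((X ++ [y] : List α) : Multiset α) = y ::ₘ (X : Multiset α) := by
      rw [Multiset.cons_coe, Multiset.coe_eq_coe]; exact List.perm_append_singleton y X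
    rw [e2, Multiset.powersetCard_cons, Multiset.map_add, Multiset.sum_add, Multiset.map_nsmul,
      Multiset.sum_nsmul, Multiset.map_map, mul_add, List.length_append, List.length_singleton,
      ← hr, Multiset.coe_card, ← hr]
    have hc0 : (0 : ℝ) < r.choose (i + 1) := by exact_mod_cast Nat.choose_pos hX
    have hc1 : (0 : ℝ) < (r + 1).choose (i + 1) := by exact_mod_cast Nat.choose_pos (by omega)
    have hc := choose_succ_mul hX
    have hri : ((r - i : ℕ) : ℝ) = r + 1 - ((i + 1 : ℕ) : ℝ) := by
      rw [Nat.cast_sub (by omega)]; push_cast; ring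
    congr 1
    · rw [smul_eq_mul, ← mul_assoc, ← ENNReal.ofReal_mul
        (div_nonneg (by linarith) (by positivity))]
      congr 2
      field_simp
      linarith
    · rw [smul_eq_mul, nsmul_eq_mul, ← mul_assoc, ← mul_assoc, ← ENNReal.ofReal_natCast (r - i),
        ← ENNReal.ofReal_mul (by positivity), ← ENNReal.ofReal_mul (by positivity), hri]
      congr 2
      field_simp
      linarith
  · intro F hF
    rw [h3 _ (hF.comp_sampleStep k (some y))]
    simp only [LinearMap.add_apply, LinearMap.smul_apply, LinearMap.sum_apply,
      LinearMap.comp_apply]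
    rw [← map_sum, ← map_smul, ← map_smul, ← map_add]
    refine h1 _ _ fun S hS => ?_
    have hmw : ∀ j, Measurable fun w => ∫⁻ v in Set.Ioo (0 : ℝ) 1,
        tailMean (fun p => F (S.set j y, p)) (w * v ^ (1 / (k : ℝ))) := fun j => by
      have : Measurable fun p : ℝ × ℝ => tailMean (fun p => F (S.set j y, p))
          (p.1 * p.2 ^ (1 / (k : ℝ))) := (measurable_tailMean (hF _)).comp (by fun_prop)
      exact this.lintegral_prod_right'
    rw [orderMean_congr fun w hw => tailMean_sampleStep_some hF hk hS y hw, orderMean_add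
      (by fun_prop), orderMean_skip hX (measurable_tailMean (hF S)), add_comm]
    simp only [Pi.add_apply, Pi.smul_apply, Finset.sum_apply, LinearMap.funLeft_apply,
      List.length_append, List.length_singleton, smul_eq_mul]
    congr 1
    simp only [Finset.mul_sum]
    rw [orderMean_sum _ fun j _ => by fun_prop]
    refine Finset.sum_congr rfl fun j _ => ?_
    simp only [mul_left_comm (ENNReal.ofReal _) (ENNReal.ofReal (1 / (k : ℝ)))]
    rw [orderMean_const_mul _ (by fun_prop), orderMean_replace hk hX (measurable_tailMean (hF _)),
      ← mul_assoc, ← ENNReal.ofReal_mul (by positivity)]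
    congr 2
    field_simp

end Sampling

/-! ### The law of the sampling run on a list of items -/

section SamplingCost

variable {α : Type}

lemma sampleRun_append (k : ℕ) (s : SampleState α) (l l' : List (Option α)) :
    sampleRun k s (l ++ l') = sampleRun k (sampleRun k s l) l' := List.foldl_append

lemma sampleRun_append_singleton (k : ℕ) (s : SampleState α) (l : List (Option α)) (x : Option α) :
    sampleRun k s (l ++ [x]) = sampleStep k (sampleRun k s l) x := by
  rw [sampleRun_append]; rfl

/-- Until the reservoir is full, every real item is stored and nothing is read from the tape. -/
lemma sampleRun_of_length_lt {k : ℕ} (w : ℝ) (q : ℕ) (ω : Tape) (l : List (Option α))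
    (h : l.reduceOption.length < k) :
    sampleRun k ([], w, q, ω) l = (l.reduceOption, w, q, ω) := by
  induction l using List.reverseRecOn with
  | nil => rfl
  | append_singleton l x ih =>
    rw [List.reduceOption_append, List.length_append] at h
    rw [sampleRun_append_singleton, ih (by omega), List.reduceOption_append]
    cases x with
    | none => simp [sampleStep, show l.reduceOption.length < k by omega]
    | some y =>
      have h1 : l.reduceOption.length + 1 < k := by simpa using h
      simp [sampleStep, h1, show l.reduceOption.length < k by omega]

lemma sampleLaw_sampleRun {k : ℕ} (hk : 1 ≤ k) (w : ℝ) (q : ℕ) (l : List (Option α))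
    (h : k ≤ l.reduceOption.length) :
    SampleLaw k l.reduceOption fun ω => sampleRun k ([], w, q, ω) l := by
  induction l using List.reverseRecOn with
  | nil => simp at h; omega
  | append_singleton l x ih =>
    simp only [sampleRun_append_singleton]
    cases x with
    | none =>
      rw [List.reduceOption_append] at h ⊢
      simp only [List.reduceOption_cons_of_none, List.reduceOption_nil, List.append_nil] at h ⊢
      exact (ih h).step_none
    | some y =>
      rw [List.reduceOption_append] at h ⊢
      simp only [List.reduceOption_cons_of_some, List.reduceOption_nil] at h ⊢
      rcases le_or_gt k l.reduceOption.length with h1 | h1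
      · exact (ih h1).step_some hk h1 y
      · have h2 : l.reduceOption.length + 1 = k := by
          rw [List.length_append, List.length_singleton] at h; omega
        simp only [sampleRun_of_length_lt w q _ l h1, sampleStep, h1, if_true, h2, lt_irrefl,
          if_false]
        exact SampleLaw.init hk (by simpa using h2)

/-- For the constant `1` the skip and replacement identities add up to conservation of mass from `r`
to `r + 1`; the induction starts with the maximum of `k` numbers. -/
lemma orderMean_one {k r : ℕ} (hk : 1 ≤ k) (h : k ≤ r) : orderMean k r (fun _ => 1) = 1 := by
  induction r, h using Nat.le_induction with
  | base => rw [← orderMean_self hk]; simp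
  | succ r h ih =>
    have e1 := orderMean_skip h (measurable_const (a := (1 : ENNReal)))
    have e2 := orderMean_replace hk h (measurable_const (a := (1 : ENNReal)))
    have hkr : (k : ℝ) ≤ r := by exact_mod_cast h
    have : orderMean k r (fun _ => 1) = orderMean k (r + 1) (fun _ => 1) := by
      calc orderMean k r (fun _ => 1)
          = orderMean k r (fun x => ENNReal.ofReal (1 - x) * 1 + ENNReal.ofReal x *
            ∫⁻ u in Set.Ioo (0 : ℝ) 1, 1) := by
            refine orderMean_congr fun x hx => ?_
            rw [lintegral_one, Measure.restrict_apply_univ, Real.volume_Ioo]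
            simp only [sub_zero, ENNReal.ofReal_one, mul_one]
            rw [← ENNReal.ofReal_add (by linarith [hx.2]) hx.1.le]
            simp
        _ = _ := by
            rw [orderMean_add (by fun_prop), e1, e2, ← add_mul, ← ENNReal.ofReal_add
              (div_nonneg (by linarith) (by positivity)) (by positivity), ← add_div]
            rw [show ((r : ℝ) + 1 - k + k) / (r + 1) = 1 by field_simp; ring]
            simp
    rw [← this, ih]

lemma tailMean_const (c : ENNReal) {w : ℝ} (hw : w ∈ Set.Ioo (0 : ℝ) 1) :
    tailMean (fun _ => c) w = c := by
  simp [tailMean, ENNReal.tsum_mul_right, tsum_geoWeight hw]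

lemma orderMean_tailMean_const {k r : ℕ} (hk : 1 ≤ k) (h : k ≤ r) (c : ENNReal) :
    orderMean k r (tailMean fun _ => c) = c := by
  rw [orderMean_congr (G' := fun _ => c * 1) fun x hx => by rw [tailMean_const c hx, mul_one],
    orderMean_const_mul c measurable_const, orderMean_one hk h, mul_one]

/-- Apply the law to the indicator of a single multiset: `w`, `q` and the tape integrate out to `1`,
and exactly one of the equally weighted sub-multisets contributes. Lists with fewer than `k` real
items are the deterministic case. -/
lemma isUniformSample_sampleRun {k : ℕ} (hk : 1 ≤ k) (w : ℝ) (q : ℕ) (l : List (Option α))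
    (hl : l.reduceOption.Nodup) :
    IsUniformSample tapeMeasure (fun ω => (sampleRun k ([], w, q, ω) l).1) k
      {y | y ∈ l.reduceOption} := by
  classical
  set X := l.reduceOption with hX
  have hJ : {y | y ∈ X} = (X.toFinset : Set α) := by ext; simp
  have hc : (X.toFinset : Set α).ncard = X.length := by
    rw [Set.ncard_coe_finset, List.toFinset_card_of_nodup hl]
  rw [hJ]
  refine ⟨X.toFinset.finite_toSet, fun A hA hcard => ?_⟩
  rw [hc] at hcard ⊢
  have hm : MeasurableSet {ω | ((sampleRun k ([], w, q, ω) l).1 : Multiset α) = A.val} := by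
    have : FiberMeasurable fun s : SampleState α => (s.1 : Multiset α) = A.val :=
      fun S => measurable_const (a := (S : Multiset α) = A.val)
    have := (this.comp_sampleRun k l []).comp
      (show Measurable fun ω : Tape => (w, q, ω) by fun_prop)
    exact measurableSet_setOfPred.2 this
  refine ⟨hm, ?_⟩
  rcases lt_or_ge X.length k with h | h
  · have hr := fun ω => sampleRun_of_length_lt w q ω l h
    rw [min_eq_right h.le] at hcard ⊢
    have hAX : A = X.toFinset := Finset.eq_of_subset_of_card_le (by exact_mod_cast hA)
      (by rw [hcard, List.toFinset_card_of_nodup hl])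
    have : {ω | ((sampleRun k ([], w, q, ω) l).1 : Multiset α) = A.val} = Set.univ := by
      ext ω
      simp only [hr, hAX, Set.mem_ofPred_eq, Set.mem_univ, List.toFinset_val,
        hl.dedup, ← hX]
    rw [this]
    simp
  · obtain ⟨Φ, h1, h2, h3⟩ := sampleLaw_sampleRun hk w q l h
    rw [min_eq_left h] at hcard ⊢
    have hF : FiberMeasurable fun s : SampleState α =>
      if (s.1 : Multiset α) = A.val then (1 : ENNReal) else 0 := fun S =>
      measurable_const (a := if (S : Multiset α) = A.val then (1 : ENNReal) else 0)
    have e := (h3 _ hF).trans (congrArg Φ (funext fun S => orderMean_tailMean_const hk h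
      (if (S : Multiset α) = A.val then (1 : ENNReal) else 0)))
    rw [h2 fun M => if M = A.val then (1 : ENNReal) else 0] at e
    have hmem : A.val ∈ (X : Multiset α).powersetCard k := by
      rw [Multiset.mem_powersetCard]
      refine ⟨(Multiset.le_iff_subset A.nodup).2 fun a ha => ?_, hcard⟩
      have := hA (Finset.mem_coe.2 ha)
      simpa using this
    have hnd : ((X : Multiset α).powersetCard k).Nodup :=
      Multiset.Nodup.powersetCard (Multiset.coe_nodup.2 hl)
    have hs : (((X : Multiset α).powersetCard k).map
        fun M => if M = A.val then (1 : ENNReal) else 0).sum = 1 := by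
      have : (((X : Multiset α).powersetCard k).map
        fun M => if M = A.val then (1 : ENNReal) else 0).sum =
        ∑ M ∈ (⟨_, hnd⟩ : Finset (Multiset α)), if M = A.val then (1 : ENNReal) else 0 := rfl
      rw [this, Finset.sum_ite_eq']
      exact if_pos hmem
    rw [hs, mul_one] at e
    have hpos : (0 : ℝ) < X.length.choose k := by exact_mod_cast Nat.choose_pos h
    rw [← ENNReal.ofReal_natCast, ← ENNReal.ofReal_inv_of_pos hpos, ← one_div, ← e,
      ← lintegral_indicator_one hm]
    refine lintegral_congr fun ω => ?_
    simp [Set.indicator]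

/-! ### The expected time of the sampling -/

/-- The time spent on one item `x.1` that is retrieved in time `x.2`. -/
def sampleStepCost (k : ℕ) (s : SampleState α) (x : Option α × ℕ) : ℕ :=
  if s.1.length < k then
    match x.1 with
    | none => 6 + x.2
    | some _ => if s.1.length + 1 < k then 8 + x.2 else 17 + x.2
  else if 0 < s.2.2.1 then 0
  else
    match x.1 with
    | none => 12 + x.2
    | some _ => 20 + x.2

/-- The time spent on a list of items. -/
noncomputable def sampleCost (k : ℕ) : SampleState α → List (Option α × ℕ) → ℕ
  | _, [] => 0
  | s, x :: l => sampleStepCost k s x + sampleCost k (sampleStep k s x.1) l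

lemma sampleCost_append (k : ℕ) (s : SampleState α) (l l' : List (Option α × ℕ)) :
    sampleCost k s (l ++ l') =
      sampleCost k s l + sampleCost k (sampleRun k s (l.map Prod.fst)) l' := by
  induction l generalizing s with
  | nil => simp [sampleCost, sampleRun]
  | cons x l ih => simp [sampleCost, ih, sampleRun, add_assoc]

lemma fiberMeasurable_sampleStepCost (k : ℕ) (x : Option α × ℕ) :
    FiberMeasurable fun s : SampleState α => sampleStepCost k s x := by
  intro S
  have hq : MeasurableSet {p : ℝ × ℕ × Tape | 0 < p.2.1} :=
    measurableSet_lt measurable_const (by fun_prop)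
  rcases x with ⟨_ | y, c⟩
  · exact Measurable.ite (MeasurableSet.const (S.length < k)) measurable_const
      (Measurable.ite hq measurable_const measurable_const)
  · exact Measurable.ite (MeasurableSet.const (S.length < k))
      (measurable_const (a := if S.length + 1 < k then 8 + c else 17 + c))
      (Measurable.ite hq measurable_const measurable_const)

lemma fiberMeasurable_sampleCost (k : ℕ) (l : List (Option α × ℕ)) :
    FiberMeasurable fun s : SampleState α => sampleCost k s l := by
  induction l with
  | nil => exact fun S => measurable_const
  | cons x l ih =>
    exact fun S => (fiberMeasurable_sampleStepCost k x S).add (ih.comp_sampleStep k x.1 S)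

/-- A constant fraction of the items of every prefix is real. -/
def PrefixDense (K : ℕ) (l : List (Option α)) : Prop :=
  ∀ l', l' <+: l → l'.length ≤ K * l'.reduceOption.length

/-- Only items met while filling or with `q = 0` cost anything; `20` belongs to the most expensive
case, a replacement. -/
lemma sampleStepCost_le {k G : ℕ} (s : SampleState α) {x : Option α × ℕ} (hx : x.2 ≤ G) :
    sampleStepCost k s x ≤ (20 + G) * (if s.1.length < k ∨ s.2.2.1 = 0 then 1 else 0) := by
  unfold sampleStepCost
  rcases x with ⟨_ | y, c⟩ <;> simp only at hx ⊢ <;> split_ifs <;> omega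

/-- While filling, the next item is certainly touched; after `r ≥ k` real items it is touched with
probability `P(q = 0)`, the mean `k / (r + 1)` of `w`. Density gives `l.length ≤ K * r`, and the
stated fraction dominates both cases. -/
lemma lintegral_sampleStepCost_le {k K G : ℕ} (hk : 1 ≤ k) (w : ℝ) (q : ℕ)
    (l : List (Option α)) {x : Option α × ℕ} (hx : x.2 ≤ G)
    (hd : l.length ≤ K * l.reduceOption.length) (hK : 1 ≤ K) :
    ∫⁻ ω, (sampleStepCost k (sampleRun k ([], w, q, ω) l) x : ENNReal) ∂tapeMeasure ≤
      ENNReal.ofReal ((20 + G) * (2 * (k * K) / (k * K + l.length + 1))) := by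
  set X := l.reduceOption with hX
  have hdr : (l.length : ℝ) ≤ K * X.length := by exact_mod_cast hd
  have hk' : (1 : ℝ) ≤ k := by exact_mod_cast hk
  have hK' : (1 : ℝ) ≤ K := by exact_mod_cast hK
  have hl0 : (0 : ℝ) ≤ l.length := by positivity
  have hden : (0 : ℝ) < k * K + l.length + 1 := by positivity
  set F : SampleState α → ENNReal := fun s => if s.1.length < k ∨ s.2.2.1 = 0 then 1 else 0 with hFd
  have hF : FiberMeasurable F := fun S => by
    have h0 : MeasurableSet {p : ℝ × ℕ × Tape | p.2.1 = 0} :=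
      (measurableSet_singleton 0).preimage (by fun_prop)
    exact Measurable.ite ((MeasurableSet.const (S.length < k)).union h0) measurable_const
      measurable_const
  have hstep : ∀ s, (sampleStepCost k s x : ENNReal) ≤ ((20 + G : ℕ) : ENNReal) * F s := by
    intro s
    have := sampleStepCost_le (k := k) s hx
    calc (sampleStepCost k s x : ENNReal) ≤ (((20 + G) *
          (if s.1.length < k ∨ s.2.2.1 = 0 then 1 else 0) : ℕ) : ENNReal) := by exact_mod_cast this
      _ = _ := by push_cast; rfl
  have hbound : ∫⁻ ω, F (sampleRun k ([], w, q, ω) l) ∂tapeMeasure ≤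
      ENNReal.ofReal (2 * (k * K) / (k * K + l.length + 1)) := by
    rcases lt_or_ge X.length k with h | h
    · have hr := fun ω => sampleRun_of_length_lt w q ω l h
      have h' : (X.length : ℝ) + 1 ≤ k := by exact_mod_cast h
      simp only [hr, hFd, ← hX, h, true_or, if_true, lintegral_one, measure_univ]
      rw [← ENNReal.ofReal_one]
      refine ENNReal.ofReal_le_ofReal ?_
      rw [le_div_iff₀ hden]
      nlinarith
    · obtain ⟨Φ, h1, h2, h3⟩ := sampleLaw_sampleRun hk w q l h
      have h' : (k : ℝ) ≤ X.length := by exact_mod_cast h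
      rw [h3 F hF, ← hX]
      have hone : Φ (fun _ => 1) = 1 := by
        have e := h2 fun _ => 1
        simp only [Multiset.map_const', Multiset.sum_replicate, Multiset.card_powersetCard,
          Multiset.coe_card, nsmul_eq_mul, mul_one, ← hX] at e
        have hpos : (0 : ℝ) < X.length.choose k := by exact_mod_cast Nat.choose_pos h
        rw [e, ← ENNReal.ofReal_natCast, ← ENNReal.ofReal_mul (by positivity), one_div_mul_cancel
          hpos.ne', ENNReal.ofReal_one]
      have hval : Φ (fun S => orderMean k X.length (tailMean fun p => F (S, p))) =
          ENNReal.ofReal (k / (X.length + 1)) := by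
        rw [h1 _ (ENNReal.ofReal (k / (X.length + 1)) • fun _ => 1), map_smul, hone, smul_eq_mul,
          mul_one]
        intro S hS
        -- For the constant `1` the replacement identity computes the mean of the `k`-th smallest
        -- number.
        have e2 := orderMean_replace hk h (measurable_const (a := (1 : ENNReal)))
        rw [orderMean_one hk (by omega : k ≤ X.length + 1)] at e2
        simp only [Pi.smul_apply, smul_eq_mul]
        rw [← e2]
        refine orderMean_congr fun w hw => ?_
        rw [tailMean, tsum_eq_single 0]
        · simp [hFd, geoWeight]
        · intro n hn
          simp [hFd, hS, hn]
      rw [hval]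
      refine ENNReal.ofReal_le_ofReal ?_
      rw [div_le_div_iff₀ (by positivity) hden]
      have : (k : ℝ) * K + l.length + 1 ≤ 2 * K * (X.length + 1) := by nlinarith
      calc (k : ℝ) * (k * K + l.length + 1) ≤ k * (2 * K * (X.length + 1)) :=
            mul_le_mul_of_nonneg_left this (by positivity)
        _ = _ := by ring
  calc _ ≤ ∫⁻ ω, ((20 + G : ℕ) : ENNReal) * F (sampleRun k ([], w, q, ω) l) ∂tapeMeasure :=
        lintegral_mono fun ω => hstep _
    _ = ((20 + G : ℕ) : ENNReal) * ∫⁻ ω, F (sampleRun k ([], w, q, ω) l) ∂tapeMeasure :=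
        lintegral_const_mul' _ _ (ENNReal.natCast_ne_top _)
    _ ≤ _ := by
        rw [ENNReal.ofReal_mul (by positivity)]
        refine mul_le_mul' (le_of_eq ?_) hbound
        rw [← ENNReal.ofReal_natCast]
        push_cast
        rfl

lemma lintegral_sampleCost_le_sum {k K G : ℕ} (hk : 1 ≤ k) (hK : 1 ≤ K) (w : ℝ) (q : ℕ)
    (l : List (Option α × ℕ)) (hG : ∀ x ∈ l, x.2 ≤ G) (hd : PrefixDense K (l.map Prod.fst)) :
    ∫⁻ ω, (sampleCost k ([], w, q, ω) l : ENNReal) ∂tapeMeasure ≤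
      ENNReal.ofReal ((20 + G) *
        ∑ j ∈ Finset.range l.length, (2 * (k * K) / (k * K + j + 1) : ℝ)) := by
  induction l using List.reverseRecOn with
  | nil => simp [sampleCost]
  | append_singleton l x ih =>
    simp only [sampleCost_append, Nat.cast_add]
    have hm : Measurable fun ω : Tape => (sampleCost k ([], w, q, ω) l : ENNReal) :=
      (measurable_of_countable _).comp (((fiberMeasurable_sampleCost k l) []).comp
        (show Measurable fun ω : Tape => (w, q, ω) by fun_prop))
    rw [lintegral_add_left hm, List.length_append, List.length_singleton, Finset.sum_range_succ,
      mul_add, ENNReal.ofReal_add (by positivity) (by positivity)]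
    refine add_le_add (ih (fun y hy => hG y (by simp [hy])) fun l' hl' =>
      hd l' (hl'.trans (by simp))) ?_
    have := lintegral_sampleStepCost_le (k := k) (K := K) hk w q (l.map Prod.fst)
      (hG x (by simp)) (hd _ (by simp)) hK
    simpa [sampleCost] using this

/-- Telescoping: `1 / (a + j + 1) ≤ log ((a + j + 1) / (a + j))`. -/
lemma sum_div_le_log {a : ℝ} (ha : 0 < a) (n : ℕ) :
    ∑ j ∈ Finset.range n, 2 * a / (a + j + 1) ≤ 2 * a * Real.log (1 + n / a) := by
  induction n with
  | zero => simp
  | succ n ih =>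
    rw [Finset.sum_range_succ]
    have h1 : (0 : ℝ) < a + n := by positivity
    have h2 : (0 : ℝ) < a + n + 1 := by positivity
    have e1 : (1 : ℝ) + n / a = (a + n) / a := by field_simp
    have e2 : (1 : ℝ) + (n + 1 : ℕ) / a = (a + n + 1) / a := by push_cast; field_simp; ring
    have h3 := Real.one_sub_inv_le_log_of_pos (div_pos h2 h1)
    rw [Real.log_div h2.ne' h1.ne'] at h3
    have h4 : 1 - ((a + n + 1) / (a + n))⁻¹ = 1 / (a + n + 1) := by field_simp; ring
    rw [h4] at h3
    rw [e1, Real.log_div h1.ne' ha.ne'] at ih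
    rw [e2, Real.log_div h2.ne' ha.ne']
    have : 2 * a / (a + n + 1) = 2 * a * (1 / (a + n + 1)) := by ring
    rw [this]
    nlinarith

/-- The harmonic sum with `a = k * K`; the list is at most `K` times as long as its real part, so
`K` cancels inside the logarithm. -/
lemma lintegral_sampleCost_le {k K G : ℕ} (hk : 1 ≤ k) (hK : 1 ≤ K) (w : ℝ) (q : ℕ)
    (l : List (Option α × ℕ)) (hG : ∀ x ∈ l, x.2 ≤ G) (hd : PrefixDense K (l.map Prod.fst)) :
    ∫⁻ ω, (sampleCost k ([], w, q, ω) l : ENNReal) ∂tapeMeasure ≤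
      ENNReal.ofReal ((20 + G) * (2 * (k * K) *
        Real.log (1 + (l.map Prod.fst).reduceOption.length / k))) := by
  refine (lintegral_sampleCost_le_sum hk hK w q l hG hd).trans (ENNReal.ofReal_le_ofReal ?_)
  have hk' : (0 : ℝ) < k := by exact_mod_cast hk
  have hK' : (0 : ℝ) < K := by exact_mod_cast hK
  refine mul_le_mul_of_nonneg_left ((sum_div_le_log (by positivity) _).trans ?_) (by positivity)
  refine mul_le_mul_of_nonneg_left (Real.log_le_log (by positivity) ?_) (by positivity)
  have := hd _ List.prefix_rfl
  rw [List.length_map] at this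
  have : (l.length : ℝ) ≤ K * (l.map Prod.fst).reduceOption.length := by exact_mod_cast this
  rw [add_le_add_iff_left, div_le_div_iff₀ (by positivity) hk']
  nlinarith

end SamplingCost

/-! ### Timed computations -/

section Timed

variable {α β : Type}

@[simp] lemma Timed.bind_val (x : Timed α) (f : α → Timed β) :
    (x >>= f).val = (f x.val).val := rfl

@[simp] lemma Timed.bind_cost (x : Timed α) (f : α → Timed β) :
    (x >>= f).cost = x.cost + (f x.val).cost := rfl

@[simp] lemma Timed.pure_val (a : α) : (pure a : Timed α).val = a := rfl

@[simp] lemma Timed.pure_cost (a : α) : (pure a : Timed α).cost = 0 := rfl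

@[simp] lemma spend_cost (n : ℕ) : (spend n).cost = n := rfl

lemma Timed.foldlM_val (f : β → α → Timed β) (b : β) (l : List α) :
    (l.foldlM f b).val = l.foldl (fun b a => (f b a).val) b := by
  induction l generalizing b with
  | nil => rfl
  | cons a l ih => simp [ih]

lemma RTimed.bind_val (x : RTimed α) (f : α → RTimed β) (ω : Tape) :
    ((x >>= f) ω).val = (f (x ω).val.1 (x ω).val.2).val := rfl

lemma RTimed.bind_cost (x : RTimed α) (f : α → RTimed β) (ω : Tape) :
    ((x >>= f) ω).cost = (x ω).cost + (f (x ω).val.1 (x ω).val.2).cost := rfl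

lemma RTimed.pure_val (a : α) (ω : Tape) : ((pure a : RTimed α) ω).val = (a, ω) := rfl

lemma RTimed.pure_cost (a : α) (ω : Tape) : ((pure a : RTimed α) ω).cost = 0 := rfl

lemma RTimed.lift_val (x : Timed α) (ω : Tape) : ((liftM x : RTimed α) ω).val = (x.val, ω) := rfl

lemma RTimed.lift_cost (x : Timed α) (ω : Tape) : ((liftM x : RTimed α) ω).cost = x.cost := rfl

lemma rand_val (ω : Tape) : (rand ω).val = ((ω 0 : ℝ), ω.tail) := rfl

lemma rand_cost (ω : Tape) : (rand ω).cost = 1 := rfl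

lemma geo_val (w : ℝ) (ω : Tape) : (geo w ω).val = (geoValue w (ω 0), ω.tail) := rfl

lemma geo_cost (w : ℝ) (ω : Tape) : (geo w ω).cost = 6 := rfl

end Timed

/-! ### The algorithm processes the items of the batches one at a time -/

section Batches

variable {V : Type} {dom : V → Type}

/-- The item at a position of a batch, and the time to retrieve it. -/
def Batch.item (B : Batch dom) (z : ℕ) : Option (Tup dom) × ℕ := ((B.get z).val, (B.get z).cost)

/-- The last items of a batch. -/
def Batch.rest (B : Batch dom) (rem : ℕ) : List (Option (Tup dom) × ℕ) :=
  (List.range' (B.size - rem) rem).map B.item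

/-- The items of a batch. -/
def Batch.items (B : Batch dom) : List (Option (Tup dom) × ℕ) := (List.range B.size).map B.item

lemma Batch.rest_size (B : Batch dom) : B.rest B.size = B.items := by
  simp [Batch.rest, Batch.items, List.range_eq_range']

lemma Batch.rest_succ (B : Batch dom) {rem : ℕ} (h : rem + 1 ≤ B.size) :
    B.rest (rem + 1) = B.item (B.size - (rem + 1)) :: B.rest rem := by
  rw [Batch.rest, List.range'_succ, List.map_cons, show B.size - (rem + 1) + 1 = B.size - rem by omega]
  rfl

/-- Jumping over `q + 1` items is passing one and then jumping over `q`. This reduces the loop to a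
sampler that moves one item at a time. -/
lemma sampleLoop_succ_succ (k : ℕ) (B : Batch dom) (S : List (Tup dom)) (w : ℝ) {rem : ℕ} (q : ℕ)
    (h : rem + 1 ≤ B.size) :
    sampleLoop k B S w (rem + 1) (q + 1) = sampleLoop k B S w rem q := by
  rw [sampleLoop, sampleLoop.eq_1 k B S w rem q]
  by_cases hq : q < rem
  · rw [dif_pos hq, dif_pos (by omega)]
    rw [show B.size - (rem + 1) + (q + 1) = B.size - rem + q by omega,
      show rem + 1 - (q + 1 + 1) = rem - (q + 1) by omega]
  · rw [dif_neg hq, dif_neg (by omega), show q + 1 - (rem + 1) = q - rem by omega]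

/-- Skipped items are free on both sides; the `3` pays for leaving the loop. -/
lemma sampleLoop_eq {k : ℕ} (B : Batch dom) (rem : ℕ) (h : rem ≤ B.size) (S : List (Tup dom))
    (hS : S.length = k) (w : ℝ) (q : ℕ) (ω : Tape) :
    (sampleLoop k B S w rem q ω).val =
      (((sampleRun k (S, w, q, ω) ((B.rest rem).map Prod.fst)).1,
        (sampleRun k (S, w, q, ω) ((B.rest rem).map Prod.fst)).2.1,
        (sampleRun k (S, w, q, ω) ((B.rest rem).map Prod.fst)).2.2.1),
        (sampleRun k (S, w, q, ω) ((B.rest rem).map Prod.fst)).2.2.2) ∧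
    (sampleRun k (S, w, q, ω) ((B.rest rem).map Prod.fst)).1.length = k ∧
    (sampleLoop k B S w rem q ω).cost = sampleCost k (S, w, q, ω) (B.rest rem) + 3 := by
  induction rem generalizing S w q ω with
  | zero =>
    rw [sampleLoop, dif_neg (by omega)]
    exact ⟨rfl, hS, rfl⟩
  | succ rem ih =>
    rw [B.rest_succ h]
    simp only [List.map_cons, sampleCost, sampleRun, List.foldl_cons]
    cases q with
    | succ q =>
      rw [sampleLoop_succ_succ k B S w q h]
      have := ih (by omega) S hS w q ω
      simpa [sampleStep, sampleStepCost, hS, sampleRun] using this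
    | zero =>
      rw [sampleLoop, dif_pos (Nat.succ_pos _)]
      simp only [Nat.add_zero, Nat.zero_add, Nat.add_sub_cancel]
      cases hx : (B.get (B.size - (rem + 1))).val with
      | none =>
        have := ih (by omega) S hS w (geoValue w (ω 0)) ω.tail
        simp only [RTimed.bind_val, RTimed.bind_cost, RTimed.lift_val, RTimed.lift_cost, hx,
          geo_val, geo_cost, sampleStep, sampleStepCost, hS, lt_irrefl, if_false, Batch.item,
          spend_cost] at this ⊢
        refine ⟨this.1, this.2.1, ?_⟩
        rw [this.2.2]; ring
      | some y =>
        have := ih (by omega) (S.set ⌊(k : ℝ) * (ω 0 : ℝ)⌋₊ y) (by simpa using hS)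
          (w * (ω.tail 0 : ℝ) ^ (1 / (k : ℝ)))
          (geoValue (w * (ω.tail 0 : ℝ) ^ (1 / (k : ℝ))) (ω.tail.tail 0)) ω.tail.tail.tail
        simp only [RTimed.bind_val, RTimed.bind_cost, RTimed.lift_val, RTimed.lift_cost, hx,
          geo_val, geo_cost, sampleStep, sampleStepCost, hS, lt_irrefl, if_false, Batch.item,
          spend_cost, rand_val, rand_cost] at this ⊢
        refine ⟨this.1, this.2.1, ?_⟩
        rw [this.2.2]; ring

lemma fillLoop_of_length_eq {k : ℕ} (B : Batch dom) (rem : ℕ) {S : List (Tup dom)}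
    (hS : S.length = k) : (fillLoop k B rem S).val = (S, rem) ∧
    (fillLoop k B rem S).cost = if rem = 0 then 2 else 3 := by
  cases rem <;> simp [fillLoop, hS]

/-- Either the batch ends first, or the reservoir becomes full. In the latter case the item-wise
sampler draws the first `w` and `q` with the last filling item, the algorithm only after the loop:
`9` is the cost of these draws, and `2` or `3` that of the final test of the loop. -/
lemma fillLoop_eq {k : ℕ} (B : Batch dom) (rem : ℕ) (h : rem ≤ B.size) (S : List (Tup dom))
    (hS : S.length < k) (w : ℝ) (q : ℕ) (ω : Tape) {S' : List (Tup dom)} {rem' : ℕ}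
    (hf : (fillLoop k B rem S).val = (S', rem')) :
    rem' ≤ rem ∧
    ((S'.length < k ∧ rem' = 0 ∧
      sampleRun k (S, w, q, ω) ((B.rest rem).map Prod.fst) = (S', w, q, ω) ∧
      (fillLoop k B rem S).cost = sampleCost k (S, w, q, ω) (B.rest rem) + 2) ∨
    (S'.length = k ∧
      sampleRun k (S, w, q, ω) ((B.rest rem).map Prod.fst) =
        sampleRun k (S', (ω 0 : ℝ) ^ (1 / (k : ℝ)), geoValue ((ω 0 : ℝ) ^ (1 / (k : ℝ))) (ω.tail 0),
          ω.tail.tail) ((B.rest rem').map Prod.fst) ∧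
      (fillLoop k B rem S).cost + 9 + sampleCost k (S', (ω 0 : ℝ) ^ (1 / (k : ℝ)),
        geoValue ((ω 0 : ℝ) ^ (1 / (k : ℝ))) (ω.tail 0), ω.tail.tail) (B.rest rem') =
        sampleCost k (S, w, q, ω) (B.rest rem) + if rem' = 0 then 2 else 3)) := by
  induction rem generalizing S with
  | zero =>
    simp only [fillLoop, Timed.bind_val, Timed.pure_val, Prod.mk.injEq] at hf
    obtain ⟨rfl, rfl⟩ := hf
    exact ⟨le_rfl, Or.inl ⟨hS, rfl, rfl, rfl⟩⟩
  | succ rem ih =>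
    rw [B.rest_succ h]
    simp only [List.map_cons, sampleCost, sampleRun, List.foldl_cons, Batch.item]
    cases hx : (B.get (B.size - (rem + 1))).val with
    | none =>
      have e : fillLoop k B (rem + 1) S = ⟨(fillLoop k B rem S).val,
          6 + (B.get (B.size - (rem + 1))).cost + (fillLoop k B rem S).cost⟩ := by
        simp only [fillLoop, hS, if_true, bind, hx, spend_cost]
        congr 1; ring
      rw [e] at hf ⊢
      obtain ⟨h1, h2⟩ := ih (by omega) S hS hf
      refine ⟨by omega, h2.imp ?_ ?_⟩
      · rintro ⟨h3, h4, h5, h6⟩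
        refine ⟨h3, h4, ?_, ?_⟩
        · simpa [sampleStep, hS, sampleRun] using h5
        · simp only [sampleStep, sampleStepCost, hS, if_true]; omega
      · rintro ⟨h3, h5, h6⟩
        refine ⟨h3, ?_, ?_⟩
        · simpa [sampleStep, hS, sampleRun] using h5
        · simp only [sampleStep, sampleStepCost, hS, if_true]; omega
    | some y =>
      have e : fillLoop k B (rem + 1) S = ⟨(fillLoop k B rem (S ++ [y])).val,
          8 + (B.get (B.size - (rem + 1))).cost + (fillLoop k B rem (S ++ [y])).cost⟩ := by
        simp only [fillLoop, hS, if_true, bind, hx, spend_cost]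
        congr 1; ring
      rw [e] at hf ⊢
      by_cases h1 : S.length + 1 < k
      · obtain ⟨h1', h2⟩ := ih (by omega) (S ++ [y]) (by simpa using h1) hf
        refine ⟨by omega, h2.imp ?_ ?_⟩
        · rintro ⟨h3, h4, h5, h6⟩
          refine ⟨h3, h4, ?_, ?_⟩
          · simpa [sampleStep, hS, h1, sampleRun] using h5
          · simp only [sampleStep, sampleStepCost, hS, h1, if_true]; omega
        · rintro ⟨h3, h5, h6⟩
          refine ⟨h3, ?_, ?_⟩
          · simpa [sampleStep, hS, h1, sampleRun] using h5
          · simp only [sampleStep, sampleStepCost, hS, h1, if_true]; omega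
      · have hSk : (S ++ [y]).length = k := by simp; omega
        obtain ⟨h3, h4⟩ := fillLoop_of_length_eq B rem hSk
        simp only at hf
        rw [h3, Prod.mk.injEq] at hf
        obtain ⟨rfl, rfl⟩ := hf
        refine ⟨by omega, Or.inr ⟨hSk, ?_, ?_⟩⟩
        · simp [sampleStep, hS, h1]
        · simp only [sampleStep, sampleStepCost, hS, h1, if_true, if_false]; omega

open Classical in
/-- The parameter `w` as the algorithm stores it. -/
noncomputable def storedParam (k : ℕ) (S : List (Tup dom)) (w : ℝ) : Option ℝ :=
  if S.length < k then none else some w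

/-- The time of `batchUpdate` that is not spent on items. -/
def batchOverhead (k : ℕ) (B : Batch dom) (S S' : List (Tup dom)) : ℕ :=
  (if (fillLoop k B B.size S).val.2 = 0 then 2 else 3) + 2 + if S'.length < k then 0 else 3

lemma batchOverhead_le (k : ℕ) (B : Batch dom) (S S' : List (Tup dom)) :
    batchOverhead k B S S' ≤ 8 := by
  unfold batchOverhead; split_ifs <;> omega

lemma batchUpdate_eq {k : ℕ} (B : Batch dom) (S : List (Tup dom)) (hS : S.length ≤ k) (w : ℝ)
    (q : ℕ) (ω : Tape) {S' : List (Tup dom)} {w' : ℝ} {q' : ℕ} {ω' : Tape}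
    (hs : sampleRun k (S, w, q, ω) (B.items.map Prod.fst) = (S', w', q', ω')) :
    (batchUpdate k S (storedParam k S w) q B ω).val = ((S', storedParam k S' w', q'), ω') ∧
    S'.length ≤ k ∧
    (batchUpdate k S (storedParam k S w) q B ω).cost =
      sampleCost k (S, w, q, ω) B.items + batchOverhead k B S S' := by
  rw [← B.rest_size] at hs ⊢
  rcases hS.lt_or_eq with hS | hS
  · obtain ⟨S1, rem, hf⟩ : ∃ S1 rem, (fillLoop k B B.size S).val = (S1, rem) := ⟨_, _, rfl⟩
    obtain ⟨hr, h | h⟩ := fillLoop_eq B B.size le_rfl S hS w q ω hf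
    · obtain ⟨h1, h2, h3, h4⟩ := h
      rw [h3, Prod.mk.injEq, Prod.mk.injEq, Prod.mk.injEq] at hs
      obtain ⟨rfl, rfl, rfl, rfl⟩ := hs
      simp only [batchUpdate, storedParam, RTimed.bind_val, RTimed.bind_cost, RTimed.lift_val,
        RTimed.lift_cost, hf, h1, if_true, RTimed.pure_val, RTimed.pure_cost, batchOverhead, h2, h4,
        hS, spend_cost]
      exact ⟨trivial, h1.le, trivial⟩
    · obtain ⟨h1, h3, h4⟩ := h
      obtain ⟨h5, h6, h7⟩ := sampleLoop_eq B rem hr S1 h1 ((ω 0 : ℝ) ^ (1 / (k : ℝ)))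
        (geoValue ((ω 0 : ℝ) ^ (1 / (k : ℝ))) (ω.tail 0)) ω.tail.tail
      rw [← h3, hs] at h5 h6
      simp only at h5 h6
      simp only [batchUpdate, storedParam, RTimed.bind_val, RTimed.bind_cost, RTimed.lift_val,
        RTimed.lift_cost, hf, h1, lt_irrefl, if_false, if_true, RTimed.pure_val, RTimed.pure_cost,
        batchOverhead, hS, rand_val, rand_cost, geo_val, geo_cost, h5, h6, h7, spend_cost]
      refine ⟨trivial, le_rfl, ?_⟩
      omega
  · obtain ⟨hf, hc⟩ := fillLoop_of_length_eq B B.size hS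
    obtain ⟨h5, h6, h7⟩ := sampleLoop_eq B B.size le_rfl S hS w q ω
    rw [hs] at h5 h6
    simp only at h5 h6
    simp only [batchUpdate, storedParam, RTimed.bind_val, RTimed.bind_cost, RTimed.lift_val,
      RTimed.lift_cost, hf, hc, hS, lt_irrefl, if_false, RTimed.pure_val, RTimed.pure_cost,
      batchOverhead, h5, h6, h7, spend_cost]
    refine ⟨trivial, le_rfl, ?_⟩
    omega

end Batches

/-! ### The whole stream as a single run of the sampler -/

section Stream

variable {V ι : Type} [DecidableEq V] [Fintype ι] {dom : V → Type} (Q : JoinQuery V ι)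
  (T : SimpleGraph ι)

/-- The index after one more insertion. -/
noncomputable def indexStep (L : Index ι dom) (p : ι × Tup dom) : Index ι dom :=
  (indexInsert Q T L p.1 p.2).val

/-- The batch defined by an insertion. -/
noncomputable def stepBatch (L : Index ι dom) (p : ι × Tup dom) : Batch dom :=
  (batchGenerate Q T (indexStep Q T L p) p.1 p.2).val

/-- The items of all the batches of a stream that starts with the index `L`. -/
noncomputable def streamItems : Index ι dom → List (ι × Tup dom) → List (Option (Tup dom) × ℕ)
  | _, [] => []
  | L, p :: D => (stepBatch Q T L p).items ++ streamItems (indexStep Q T L p) D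

/-- The time spent on updating the index and on starting the batches. -/
noncomputable def indexCost : Index ι dom → List (ι × Tup dom) → ℕ
  | _, [] => 0
  | L, p :: D => (indexInsert Q T L p.1 p.2).cost +
      (batchGenerate Q T (indexStep Q T L p) p.1 p.2).cost + indexCost (indexStep Q T L p) D

/-- The time that is not spent on items. -/
noncomputable def streamOverhead (k : ℕ) :
    Index ι dom → SampleState (Tup dom) → List (ι × Tup dom) → ℕ
  | _, _, [] => 0
  | L, s, p :: D =>
    let s' := sampleRun k s ((stepBatch Q T L p).items.map Prod.fst)
    2 + (indexInsert Q T L p.1 p.2).cost + (batchGenerate Q T (indexStep Q T L p) p.1 p.2).cost +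
      batchOverhead k (stepBatch Q T L p) s.1 s'.1 + streamOverhead k (indexStep Q T L p) s' D

lemma streamOverhead_le (k : ℕ) (L : Index ι dom) (s : SampleState (Tup dom))
    (D : List (ι × Tup dom)) :
    streamOverhead Q T k L s D ≤ 10 * D.length + indexCost Q T L D := by
  induction D generalizing L s with
  | nil => simp [streamOverhead]
  | cons p D ih =>
    simp only [streamOverhead, indexCost, List.length_cons]
    have := ih (indexStep Q T L p) (sampleRun k s ((stepBatch Q T L p).items.map Prod.fst))
    have := batchOverhead_le k (stepBatch Q T L p) s.1
      (sampleRun k s ((stepBatch Q T L p).items.map Prod.fst)).1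
    omega

lemma fiberMeasurable_streamOverhead (k : ℕ) (L : Index ι dom) (D : List (ι × Tup dom)) :
    FiberMeasurable fun s : SampleState (Tup dom) => streamOverhead Q T k L s D := by
  induction D generalizing L with
  | nil => exact fun S => measurable_const
  | cons p D ih =>
    intro S
    refine Measurable.add (Measurable.add measurable_const ?_)
      ((ih (indexStep Q T L p)).comp_sampleRun k _ S)
    have : FiberMeasurable fun s : SampleState (Tup dom) => batchOverhead k (stepBatch Q T L p) S s.1 :=
      fun S' => measurable_const (a := batchOverhead k (stepBatch Q T L p) S S')
    exact this.comp_sampleRun k _ S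

/-- The unused part of `q` is carried over to the next batch, so consecutive batches amount to one
run on their concatenation. The index evolves independently of the random numbers. -/
lemma foldlM_reservoirStep_eq {k : ℕ} (D : List (ι × Tup dom)) (L : Index ι dom)
    (S : List (Tup dom)) (hS : S.length ≤ k) (w : ℝ) (q : ℕ) (ω : Tape) :
    (D.foldlM (reservoirStep Q T k) ⟨L, S, storedParam k S w, q⟩ ω).val.1.S =
      (sampleRun k (S, w, q, ω) ((streamItems Q T L D).map Prod.fst)).1 ∧
    (D.foldlM (reservoirStep Q T k) ⟨L, S, storedParam k S w, q⟩ ω).cost =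
      sampleCost k (S, w, q, ω) (streamItems Q T L D) +
        streamOverhead Q T k L (S, w, q, ω) D := by
  induction D generalizing L S w q ω with
  | nil => exact ⟨rfl, rfl⟩
  | cons p D ih =>
    obtain ⟨⟨S', w', q', ω'⟩, hs⟩ : ∃ s, sampleRun k (S, w, q, ω)
      ((stepBatch Q T L p).items.map Prod.fst) = s := ⟨_, rfl⟩
    obtain ⟨h1, h2, h3⟩ := batchUpdate_eq (stepBatch Q T L p) S hS w q ω hs
    obtain ⟨h4, h5⟩ := ih (indexStep Q T L p) S' h2 w' q' ω'
    have hv : (reservoirStep Q T k ⟨L, S, storedParam k S w, q⟩ p ω).val =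
        (⟨indexStep Q T L p, S', storedParam k S' w', q'⟩, ω') := by
      simp only [reservoirStep, RTimed.bind_val, RTimed.lift_val, RTimed.pure_val]
      change ((⟨_, (batchUpdate k S (storedParam k S w) q (stepBatch Q T L p) ω).val.1.1,
        (batchUpdate k S (storedParam k S w) q (stepBatch Q T L p) ω).val.1.2.1,
        (batchUpdate k S (storedParam k S w) q (stepBatch Q T L p) ω).val.1.2.2⟩ : RJState ι dom),
        (batchUpdate k S (storedParam k S w) q (stepBatch Q T L p) ω).val.2) = _
      rw [h1]; rfl
    have hc : (reservoirStep Q T k ⟨L, S, storedParam k S w, q⟩ p ω).cost =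
        2 + ((indexInsert Q T L p.1 p.2).cost +
        ((batchGenerate Q T (indexStep Q T L p) p.1 p.2).cost +
        ((batchUpdate k S (storedParam k S w) q (stepBatch Q T L p) ω).cost + 0))) := rfl
    rw [List.foldlM_cons, RTimed.bind_val, RTimed.bind_cost, hv, hc, h3]
    simp only [streamItems, List.map_append, sampleRun_append, sampleCost_append, hs,
      streamOverhead]
    refine ⟨h4, ?_⟩
    rw [h5]
    ring

/-- The initial values `w = 0` and `q = 0` are placeholders: neither influences the run before the
reservoir is full, and `storedParam` hides `w` until then. -/
lemma reservoirSample_eq {k : ℕ} (hk : 1 ≤ k) (D : List (ι × Tup dom)) (ω : Tape) :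
    reservoirSample Q T k D ω =
      (sampleRun k ([], 0, 0, ω) ((streamItems Q T Index.empty D).map Prod.fst)).1 := by
  have := (foldlM_reservoirStep_eq Q T (k := k) D Index.empty [] (Nat.zero_le _) 0 0 ω).1
  rwa [storedParam, if_pos (show ([] : List (Tup dom)).length < k from hk)] at this

lemma reservoirTime_eq {k : ℕ} (hk : 1 ≤ k) (D : List (ι × Tup dom)) (ω : Tape) :
    reservoirTime Q T k D ω =
      4 + (sampleCost k ([], 0, 0, ω) (streamItems Q T Index.empty D) +
        streamOverhead Q T k Index.empty ([], 0, 0, ω) D) := by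
  have := (foldlM_reservoirStep_eq Q T (k := k) D Index.empty [] (Nat.zero_le _) 0 0 ω).2
  rw [storedParam, if_pos (show ([] : List (Tup dom)).length < k from hk)] at this
  rw [← this]; rfl

lemma measurable_reservoirTime {k : ℕ} (hk : 1 ≤ k) (D : List (ι × Tup dom)) :
    Measurable (reservoirTime Q T k D) := by
  have hm : Measurable fun ω : Tape => ((0 : ℝ), (0 : ℕ), ω) := by fun_prop
  rw [funext fun ω => reservoirTime_eq Q T hk D ω]
  exact measurable_const.add (((fiberMeasurable_sampleCost k _ []).comp hm).add
    ((fiberMeasurable_streamOverhead Q T k _ D []).comp hm))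

/-- Only the cost of the items is random to any relevant extent: the index cost is deterministic and
the overhead is at most `10` steps per insertion. -/
lemma expectedTime_le {k K G : ℕ} (hk : 1 ≤ k) (hK : 1 ≤ K) (D : List (ι × Tup dom))
    (hG : ∀ x ∈ streamItems Q T Index.empty D, x.2 ≤ G)
    (hd : PrefixDense K ((streamItems Q T Index.empty D).map Prod.fst)) :
    expectedTime (reservoirTime Q T k D) ≤
      ENNReal.ofReal (4 + 10 * D.length + indexCost Q T Index.empty D +
        (20 + G) * (2 * (k * K) * Real.log (1 +
          ((streamItems Q T Index.empty D).map Prod.fst).reduceOption.length / k))) := by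
  have hm : Measurable fun ω : Tape => ((0 : ℝ), (0 : ℕ), ω) := by fun_prop
  set A : ℕ := 4 + 10 * D.length + indexCost Q T Index.empty D with hA
  calc expectedTime (reservoirTime Q T k D)
      ≤ ∫⁻ ω, ((A : ENNReal) + (sampleCost k ([], 0, 0, ω) (streamItems Q T Index.empty D) :
          ENNReal)) ∂tapeMeasure := by
        refine lintegral_mono fun ω => ?_
        rw [reservoirTime_eq Q T hk]
        have := streamOverhead_le Q T k Index.empty ([], 0, 0, ω) D
        have h : 4 + (sampleCost k ([], 0, 0, ω) (streamItems Q T Index.empty D) +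
          streamOverhead Q T k Index.empty ([], 0, 0, ω) D) ≤
          A + sampleCost k ([], 0, 0, ω) (streamItems Q T Index.empty D) := by omega
        rw [← Nat.cast_add]
        exact Nat.cast_le.2 h
    _ = A + ∫⁻ ω, (sampleCost k ([], 0, 0, ω) (streamItems Q T Index.empty D) : ENNReal)
          ∂tapeMeasure := by
        rw [lintegral_add_left measurable_const, lintegral_const, measure_univ, mul_one]
    _ ≤ _ := by
        rw [ENNReal.ofReal_add (by positivity) (mul_nonneg (by positivity) (mul_nonneg
          (by positivity) (Real.log_nonneg (by
            have : (0 : ℝ) ≤ ((streamItems Q T Index.empty D).map Prod.fst).reduceOption.length / k :=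
              by positivity
            linarith))))]
        refine add_le_add (le_of_eq ?_) (lintegral_sampleCost_le hk hK 0 0 _ hG hd)
        rw [← ENNReal.ofReal_natCast, hA]
        push_cast
        rfl

end Stream

/-! ### Rooted trees -/

section Trees

variable {ι : Type} {T : SimpleGraph ι}

/-- Shortest walks from `r` to `p` and to `p'`, prolonged to `e`, are paths; in a tree they
coincide, hence so do their penultimate vertices. -/
lemma SimpleGraph.IsTree.eq_of_adj_of_dist (hT : T.IsTree) {r e p p' : ι} (h : T.Adj e p)
    (h' : T.Adj e p') (hd : T.dist r p + 1 = T.dist r e) (hd' : T.dist r p' + 1 = T.dist r e) :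
    p = p' := by
  obtain ⟨w, hw⟩ := hT.connected.exists_walk_length_eq_dist r p
  obtain ⟨w', hw'⟩ := hT.connected.exists_walk_length_eq_dist r p'
  have h1 : (w.concat h.symm).IsPath :=
    SimpleGraph.Walk.isPath_of_length_eq_dist _ (by simp; omega)
  have h2 : (w'.concat h'.symm).IsPath :=
    SimpleGraph.Walk.isPath_of_length_eq_dist _ (by simp; omega)
  have := (hT.isAcyclic.subsingleton_path _ _).elim ⟨_, h1⟩ ⟨_, h2⟩
  have := congrArg (fun q : T.Path r e => q.1.penultimate) this
  simpa using this

variable [Fintype ι]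

lemma mem_children {r e c : ι} :
    c ∈ children T r e ↔ T.Adj e c ∧ T.dist r c = T.dist r e + 1 := by
  classical
  simp [children]

lemma nodup_children (r e : ι) : (children T r e).Nodup := Finset.nodup_toList _

lemma length_children_le (r e : ι) : (children T r e).length ≤ Fintype.card ι :=
  (nodup_children r e).length_le_card

lemma parent_eq_some_iff (hT : T.IsTree) {r e p : ι} :
    parent T r e = some p ↔ T.Adj e p ∧ T.dist r p + 1 = T.dist r e := by
  unfold parent
  split_ifs with h
  · rw [Option.some_inj]
    constructor
    · rintro rfl; exact h.choose_spec
    · rintro ⟨h1, h2⟩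
      exact hT.eq_of_adj_of_dist h.choose_spec.1 h1 h.choose_spec.2 h2
  · simp only [false_iff]
    exact fun h' => h ⟨p, h'⟩

lemma mem_children_iff (hT : T.IsTree) {r e c : ι} :
    c ∈ children T r e ↔ parent T r c = some e := by
  rw [mem_children, parent_eq_some_iff hT, T.adj_comm, eq_comm (a := T.dist r c)]

lemma parent_self (r : ι) : parent T r r = none := by
  unfold parent
  rw [dif_neg]
  rintro ⟨p, -, h⟩
  simp at h

/-- The parent is the first step of a shortest walk to the root; in a tree, neighbours differ in
depth by exactly one. -/
lemma exists_parent (hT : T.IsTree) {r e : ι} (h : e ≠ r) : ∃ p, parent T r e = some p := by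
  obtain ⟨w, hw⟩ := hT.connected.exists_walk_length_eq_dist e r
  cases w with
  | nil => exact absurd rfl h
  | cons hadj w =>
    rename_i p
    refine ⟨p, (parent_eq_some_iff hT).2 ⟨hadj, ?_⟩⟩
    have h1 := SimpleGraph.dist_le w
    rw [SimpleGraph.Walk.length_cons] at hw
    rw [SimpleGraph.dist_comm (u := r), SimpleGraph.dist_comm (u := r)]
    have h2 := hT.dist_eq_dist_add_one_of_adj r hadj
    rw [SimpleGraph.dist_comm (u := r), SimpleGraph.dist_comm (u := r)] at h2
    omega

lemma ne_of_parent_eq_some {r e p : ι} (h : parent T r e = some p) : e ≠ r := by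
  rintro rfl
  rw [parent_self] at h
  exact absurd h (by simp)

lemma dist_lt_card (hT : T.IsTree) (r e : ι) : T.dist r e < Fintype.card ι := by
  obtain ⟨w, hw, hl⟩ := hT.connected.exists_path_of_dist r e
  rw [← hl]
  exact hw.length_lt

end Trees

/-! ### The dynamic index -/

/-- If `a` occurs before the last cell, the last element replaces it and its own cell is dropped;
otherwise `a` is the last cell itself. -/
lemma swapRemove_perm {α : Type} [DecidableEq α] {l : List α} {a : α} (h : a ∈ l) :
    (swapRemove l a).Perm (l.erase a) := by
  induction l using List.reverseRecOn with
  | nil => simp at h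
  | append_singleton l b _ =>
    have e : swapRemove (l ++ [b]) a = ((l ++ [b]).set ((l ++ [b]).idxOf a) b).dropLast := by
      unfold swapRemove
      rw [List.getLast?_concat]
      simp only
      congr!
    rw [e]
    by_cases ha : a ∈ l
    · rw [List.idxOf_append_of_mem ha, List.set_append_left _ _ (List.idxOf_lt_length_of_mem ha),
        List.dropLast_concat, List.erase_append_left _ ha, List.erase_eq_eraseIdx_of_idxOf]
      · exact (List.set_perm_cons_eraseIdx (List.idxOf_lt_length_of_mem ha) b).trans
          (List.perm_append_singleton _ _).symm
      · rfl
    · obtain rfl : a = b := by simpa [ha] using h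
      rw [List.idxOf_append_of_notMem ha, List.erase_append_right _ ha]
      simp

/-- Zero or a power of two. -/
def IsZeroOrPow (n : ℕ) : Prop := n = 0 ∨ ∃ i, n = 2 ^ i

lemma isZeroOrPow_roundUp (n : ℕ) : IsZeroOrPow (roundUp n) := by
  unfold roundUp
  split_ifs
  · exact Or.inl rfl
  · exact Or.inr ⟨_, rfl⟩

lemma IsZeroOrPow.list_prod {l : List ℕ} (h : ∀ n ∈ l, IsZeroOrPow n) : IsZeroOrPow l.prod := by
  induction l with
  | nil => exact Or.inr ⟨0, rfl⟩
  | cons a l ih =>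
    simp only [List.mem_cons, forall_eq_or_imp] at h
    rw [List.prod_cons]
    rcases h.1 with h1 | ⟨i, h1⟩
    · exact Or.inl (by simp [h1])
    · rcases ih h.2 with h2 | ⟨j, h2⟩
      · exact Or.inl (by simp [h2])
      · exact Or.inr ⟨i + j, by rw [h1, h2, pow_add]⟩

lemma le_roundUp (n : ℕ) : n ≤ roundUp n := by
  unfold roundUp
  split_ifs with h
  · omega
  · exact Nat.le_pow_clog (by norm_num) n

lemma roundUp_le (n : ℕ) : roundUp n ≤ 2 * n := by
  unfold roundUp
  split_ifs with h
  · omega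
  · rcases Nat.lt_or_ge 1 n with h1 | h1
    · have := Nat.pow_pred_clog_lt_self (b := 2) (by norm_num) h1
      have h2 : 0 < Nat.clog 2 n := Nat.clog_pos (by norm_num) h1
      obtain ⟨c, hc⟩ : ∃ c, Nat.clog 2 n = c + 1 := ⟨Nat.clog 2 n - 1, by omega⟩
      rw [hc] at this ⊢
      rw [pow_succ]
      simp at this
      omega
    · interval_cases n
      · omega
      · simp

lemma roundUp_mono {a b : ℕ} (h : a ≤ b) : roundUp a ≤ roundUp b := by
  unfold roundUp
  split_ifs with h1 h2 h2
  · rfl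
  · exact Nat.zero_le _
  · omega
  · exact Nat.pow_le_pow_right (by norm_num) (Nat.clog_mono_right 2 h)

/-- The number of values that a rounded counter has had before it reached `n`. -/
def level (n : ℕ) : ℕ := if n = 0 then 0 else Nat.clog 2 n + 1

lemma level_mono {a b : ℕ} (h : a ≤ b) : level a ≤ level b := by
  unfold level
  have := Nat.clog_mono_right 2 h
  split_ifs <;> omega

/-- Distinct rounded values have distinct levels, so every change of a growing rounded counter
raises its level. This is what pays for a propagation. -/
lemma level_lt_level {a b : ℕ} (h : a ≤ b) (hne : roundUp b ≠ roundUp a) :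
    level a + 1 ≤ level b := by
  unfold level
  unfold roundUp at hne
  have := Nat.clog_mono_right 2 h
  split_ifs at hne ⊢ with h1 h2 h2
  · exact absurd rfl hne
  · omega
  · omega
  · have : Nat.clog 2 a ≠ Nat.clog 2 b := fun h => hne (by rw [h])
    omega

/-! ### Degrees, correctness of the stored data, and the potential -/

section Index

variable {V ι : Type} [DecidableEq V] {dom : V → Type} (Q : JoinQuery V ι)

/-- The product of the approximate counters at the given nodes. -/
def weightOn (L : Index ι dom) (r e : ι) (t : Tup dom) (cs : List ι) : ℕ :=
  (cs.map fun c => roundUp (L.cnt r c (Tup.proj (Q.common c e) t))).prod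

lemma wprod_val (L : Index ι dom) (r e : ι) (t : Tup dom) (cs : List ι) :
    (wprod Q L r e t cs).val = weightOn Q L r e t cs := by
  induction cs with
  | nil => rfl
  | cons c cs ih => simp [wprod, ih, weightOn, Index.wcnt]

lemma wprod_cost (L : Index ι dom) (r e : ι) (t : Tup dom) (cs : List ι) :
    (wprod Q L r e t cs).cost = 1 + 4 * cs.length := by
  induction cs with
  | nil => rfl
  | cons c cs ih => simp [wprod, ih, Index.wcnt]; ring

lemma weightOn_congr {L L' : Index ι dom} {r e : ι} {t : Tup dom} {cs : List ι}
    (h : ∀ c ∈ cs, roundUp (L.cnt r c (Tup.proj (Q.common c e) t)) =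
      roundUp (L'.cnt r c (Tup.proj (Q.common c e) t))) :
    weightOn Q L r e t cs = weightOn Q L' r e t cs := by
  unfold weightOn
  rw [List.map_congr_left h]

lemma weightOn_mono {L L' : Index ι dom} {r e : ι} {t : Tup dom} {cs : List ι}
    (h : ∀ e s, L.cnt r e s ≤ L'.cnt r e s) :
    weightOn Q L r e t cs ≤ weightOn Q L' r e t cs := by
  unfold weightOn
  induction cs with
  | nil => rfl
  | cons c cs ih =>
    simp only [List.map_cons, List.prod_cons]
    exact Nat.mul_le_mul (roundUp_mono (h _ _)) ih

variable [Fintype ι] (T : SimpleGraph ι)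

/-- The approximate degree of a tuple. -/
noncomputable def weight (L : Index ι dom) (r e : ι) (t : Tup dom) : ℕ :=
  weightOn Q L r e t (children T r e)

lemma isZeroOrPow_weight (L : Index ι dom) (r e : ι) (t : Tup dom) :
    IsZeroOrPow (weight Q T L r e t) := by
  refine IsZeroOrPow.list_prod fun n hn => ?_
  obtain ⟨c, -, rfl⟩ := List.mem_map.1 hn
  exact isZeroOrPow_roundUp _

-- Isolates the factor of the child `e`. If only the counter of `e` has changed, the old degree of a
-- parent tuple is the old rounded counter times this cofactor, so old degrees need not be stored.
open Classical in
lemma weight_eq_mul {r e p : ι} (hT : T.IsTree) (hp : parent T r e = some p) (L : Index ι dom)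
    (t : Tup dom) : weight Q T L r p t = roundUp (L.cnt r e (Tup.proj (Q.common e p) t)) *
      weightOn Q L r p t ((children T r p).filter (· ≠ e)) := by
  have he : e ∈ children T r p := (mem_children_iff hT).2 hp
  have h := List.perm_cons_erase he
  rw [(nodup_children r p).erase_eq_filter] at h
  unfold weight weightOn
  rw [(h.map _).prod_eq, List.map_cons, List.prod_cons]
  congr! 4
  funext x
  simp [bne, BEq.beq]

/-- The lists of tuples of the index are correct. -/
structure RelCorrect (D : List (ι × Tup dom)) (L : Index ι dom) : Prop where
  mem : ∀ e f s t, t ∈ L.rel e f s ↔ (e, t) ∈ D ∧ Tup.proj (Q.common e f) t = s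
  nodup : ∀ e f s, (L.rel e f s).Nodup

open Classical in
/-- The counters and buckets of the tree rooted at `r` are correct if the degree of a tuple `t` of
the relation `e` is `g e t`. -/
structure Recorded (r : ι) (L : Index ι dom) (g : ι → Tup dom → ℕ) : Prop where
  pow : ∀ e t, IsZeroOrPow (g e t)
  cnt : ∀ e p, parent T r e = some p → ∀ s, L.cnt r e s = ((L.rel e p s).map (g e)).sum
  bucket : ∀ e p, parent T r e = some p → ∀ s i,
    (L.bucket r e s i).Perm ((L.rel e p s).filter (g e · = 2 ^ i))

open Classical in
/-- The number of propagation steps paid for so far. -/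
noncomputable def potential (D : List (ι × Tup dom)) (r : ι) (L : Index ι dom) : ℕ :=
  ∑ x ∈ D.toFinset, ∑ c ∈ (children T r x.1).toFinset,
    level (L.cnt r c (Tup.proj (Q.common c x.1) x.2))

lemma potential_mono (D : List (ι × Tup dom)) {r : ι} {L L' : Index ι dom}
    (h : ∀ e s, L.cnt r e s ≤ L'.cnt r e s) : potential Q T D r L ≤ potential Q T D r L' :=
  Finset.sum_le_sum fun _ _ => Finset.sum_le_sum fun _ _ => level_mono (h _ _)

/-- Every tuple of the parent with key `s` contributes the level of this counter to the potential.
That level rises by at least one and no other level drops, so the gain covers one visit to each of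
these tuples. -/
lemma potential_add_length_le (hT : T.IsTree) {D : List (ι × Tup dom)} {r e p : ι}
    {L L' : Index ι dom} (h : ∀ e s, L.cnt r e s ≤ L'.cnt r e s) (hp : parent T r e = some p)
    {s : Tup dom} (hne : roundUp (L'.cnt r e s) ≠ roundUp (L.cnt r e s)) (hL : RelCorrect Q D L) :
    potential Q T D r L + (L.rel p e s).length ≤ potential Q T D r L' := by
  classical
  set B : Finset (ι × Tup dom) := (L.rel p e s).toFinset.image fun t => (p, t) with hB
  have hcard : B.card = (L.rel p e s).length := by
    rw [hB, Finset.card_image_of_injective _ (Prod.mk_right_injective p),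
      List.toFinset_card_of_nodup (hL.nodup _ _ _)]
  have hsub : B ⊆ D.toFinset := by
    intro x hx
    obtain ⟨t, ht, rfl⟩ := Finset.mem_image.1 hx
    exact List.mem_toFinset.2 ((hL.mem _ _ _ _).1 (List.mem_toFinset.1 ht)).1
  have hsum : ∑ x ∈ D.toFinset, (if x ∈ B then 1 else 0) = B.card := by
    rw [Finset.sum_ite_mem, Finset.inter_eq_right.2 hsub]; simp
  rw [← hcard, ← hsum, potential, potential, ← Finset.sum_add_distrib]
  refine Finset.sum_le_sum fun x hx => ?_
  split_ifs with hxB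
  · obtain ⟨t, ht, rfl⟩ := Finset.mem_image.1 hxB
    have ht' := ((hL.mem _ _ _ _).1 (List.mem_toFinset.1 ht)).2
    have he : e ∈ (children T r p).toFinset := List.mem_toFinset.2 ((mem_children_iff hT).2 hp)
    rw [← Finset.add_sum_erase _ _ he, ← Finset.add_sum_erase _ _ he]
    have h1 : level (L.cnt r e (Tup.proj (Q.common e p) t)) + 1 ≤
        level (L'.cnt r e (Tup.proj (Q.common e p) t)) := by
      refine level_lt_level (h _ _) ?_
      have : Q.common e p = Q.common p e := Finset.inter_comm _ _
      rw [this, ht']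
      exact hne
    have h2 := Finset.sum_le_sum (s := (children T r p).toFinset.erase e)
      (f := fun c => level (L.cnt r c (Tup.proj (Q.common c p) t)))
      (g := fun c => level (L'.cnt r c (Tup.proj (Q.common c p) t))) fun c _ => level_mono (h _ _)
    simp only at h2 ⊢
    omega
  · rw [add_zero]
    exact Finset.sum_le_sum fun _ _ => level_mono (h _ _)

end Index

/-! ### One update of a counter and of its buckets -/

section Index

variable {V ι : Type} {dom : V → Type}

/-- The index after the degree of the tuple `a` has been changed from `old` to `new`. -/
noncomputable def selfUpdate (L : Index ι dom) (r e : ι) (s a : Tup dom) (old new : ℕ) :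
    Index ι dom :=
  let L' := if 0 < old then (L.removeBucket r e s (Nat.log 2 old) a).val else L
  let L'' := if 0 < new then (L'.appendBucket r e s (Nat.log 2 new) a).val else L'
  (L''.setCnt r e s (L''.cnt r e s + new - old)).val

lemma selfUpdate_rel (L : Index ι dom) (r e : ι) (s a : Tup dom) (old new : ℕ) :
    (selfUpdate L r e s a old new).rel = L.rel := by
  unfold selfUpdate; split_ifs <;> rfl

lemma selfUpdate_cnt (L : Index ι dom) (r e : ι) (s a : Tup dom) (old new : ℕ) :
    (selfUpdate L r e s a old new).cnt = update3 L.cnt r e s (L.cnt r e s + new - old) := by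
  unfold selfUpdate; split_ifs <;> rfl

lemma selfUpdate_cnt_self (L : Index ι dom) (r e : ι) (s a : Tup dom) (old new : ℕ) :
    (selfUpdate L r e s a old new).cnt r e s = L.cnt r e s + new - old := by
  simp [selfUpdate_cnt, update3]

lemma selfUpdate_cnt_of_ne (L : Index ι dom) {r e r' e' : ι} {s s' : Tup dom} (a : Tup dom)
    (old new : ℕ) (h : ¬ (r' = r ∧ e' = e ∧ s' = s)) :
    (selfUpdate L r e s a old new).cnt r' e' s' = L.cnt r' e' s' := by
  simp [selfUpdate_cnt, update3, h]

lemma selfUpdate_bucket_of_ne (L : Index ι dom) {r e r' e' : ι} {s s' : Tup dom} (a : Tup dom)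
    (old new : ℕ) (h : ¬ (r' = r ∧ e' = e ∧ s' = s)) :
    (selfUpdate L r e s a old new).bucket r' e' s' = L.bucket r' e' s' := by
  unfold selfUpdate
  split_ifs <;> simp [Index.setCnt, Index.removeBucket, Index.appendBucket, update3, h]

open Classical in
lemma selfUpdate_bucket_self (L : Index ι dom) (r e : ι) (s a : Tup dom) (old new i : ℕ)
    (hold : IsZeroOrPow old) (hnew : IsZeroOrPow new) :
    (selfUpdate L r e s a old new).bucket r e s i =
      (if old = 2 ^ i then swapRemove (L.bucket r e s i) a else L.bucket r e s i) ++
        if new = 2 ^ i then [a] else [] := by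
  -- The code addresses buckets by logarithms; for zero or a power of two, positivity and the
  -- logarithm determine the value.
  have key : ∀ n, IsZeroOrPow n → (n = 2 ^ i ↔ 0 < n ∧ i = Nat.log 2 n) := by
    rintro n (rfl | ⟨j, rfl⟩)
    · simpa using (pow_pos (by norm_num : 0 < 2) i).ne
    · rw [Nat.log_pow (by norm_num)]
      simp [eq_comm]
  unfold selfUpdate
  simp only [key old hold, key new hnew]
  split_ifs <;>
    simp_all [Index.setCnt, Index.removeBucket, Index.appendBucket, update3, Function.update_apply]

variable [DecidableEq V] (Q : JoinQuery V ι)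

lemma mem_rel_iff_eq {D : List (ι × Tup dom)} {L : Index ι dom} (hL : RelCorrect Q D L) {e p : ι}
    {t : Tup dom} (ht : (e, t) ∈ D) (s : Tup dom) :
    t ∈ L.rel e p s ↔ s = Tup.proj (Q.common e p) t := by
  rw [hL.mem]
  exact ⟨fun h => h.2.symm, fun h => ⟨ht, h.symm⟩⟩

variable [Fintype ι] (T : SimpleGraph ι)

-- A tuple is listed under a single key of `e`, so a change of its degree affects one counter and
-- the old and new buckets of that key. The recorded degrees are arbitrary because they lag behind
-- the actual weights during a propagation.
open Classical in
lemma Recorded.selfUpdate {D : List (ι × Tup dom)} {r : ι} {L : Index ι dom}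
    {g : ι → Tup dom → ℕ} (hg : Recorded T r L g) (hL : RelCorrect Q D L) {e p : ι}
    (hp : parent T r e = some p) {t : Tup dom} (ht : (e, t) ∈ D) {new : ℕ}
    (hnew : IsZeroOrPow new) :
    Recorded T r (selfUpdate L r e (Tup.proj (Q.common e p) t) t (g e t) new)
      (fun e' t' => if e' = e ∧ t' = t then new else g e' t') := by
  set te := Tup.proj (Q.common e p) t with hte
  have hother : ∀ e' p' s, parent T r e' = some p' → ¬ (e' = e ∧ s = te) → ∀ t' ∈ L.rel e' p' s,
      (if e' = e ∧ t' = t then new else g e' t') = g e' t' := by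
    intro e' p' s hp' hne t' ht'
    refine if_neg ?_
    rintro ⟨rfl, rfl⟩
    obtain rfl : p' = p := by rw [hp] at hp'; exact (Option.some_inj.1 hp').symm
    exact hne ⟨rfl, (mem_rel_iff_eq Q hL ht s).1 ht'⟩
  have hmem : t ∈ L.rel e p te := (mem_rel_iff_eq Q hL ht te).2 rfl
  have hperm := List.perm_cons_erase hmem
  have herase : ∀ t' ∈ (L.rel e p te).erase t,
      (if e = e ∧ t' = t then new else g e t') = g e t' := by
    intro t' ht'
    refine if_neg fun h => ?_
    rw [(hL.nodup e p te).mem_erase_iff] at ht'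
    exact ht'.1 h.2
  refine ⟨fun e' t' => ?_, fun e' p' hp' s => ?_, fun e' p' hp' s i => ?_⟩
  · split_ifs
    · exact hnew
    · exact hg.pow _ _
  · rw [selfUpdate_rel]
    by_cases h : e' = e ∧ s = te
    · obtain ⟨rfl, rfl⟩ := h
      obtain rfl : p' = p := by rw [hp] at hp'; exact (Option.some_inj.1 hp').symm
      rw [selfUpdate_cnt_self, hg.cnt e' p' hp, (hperm.map _).sum_eq, (hperm.map _).sum_eq,
        List.map_cons, List.map_cons, List.sum_cons, List.sum_cons, List.map_congr_left herase]
      simp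
      omega
    · rw [selfUpdate_cnt_of_ne _ _ _ _ (by tauto), hg.cnt e' p' hp',
        List.map_congr_left (hother e' p' s hp' h)]
  · rw [selfUpdate_rel]
    by_cases h : e' = e ∧ s = te
    · obtain ⟨rfl, rfl⟩ := h
      obtain rfl : p' = p := by rw [hp] at hp'; exact (Option.some_inj.1 hp').symm
      rw [selfUpdate_bucket_self _ _ _ _ _ _ _ _ (hg.pow _ _) hnew]
      have h1 : (if g e' t = 2 ^ i then swapRemove (L.bucket r e' te i) t
          else L.bucket r e' te i).Perm (((L.rel e' p' te).erase t).filter (g e' · = 2 ^ i)) := by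
        have h2 := hg.bucket e' p' hp te i
        have h3 := h2.trans (hperm.filter (g e' · = 2 ^ i))
        rw [List.filter_cons] at h3
        split_ifs with h4
        · rw [if_pos (by simpa using h4)] at h3
          refine (swapRemove_perm (h3.mem_iff.2 (by simp))).trans ?_
          simpa using h3.erase t
        · rwa [if_neg (by simpa using h4)] at h3
      refine List.Perm.trans ?_ (hperm.filter _).symm
      rw [List.filter_cons]
      have h5 : ((L.rel e' p' te).erase t).filter
          (fun t' => decide ((if e' = e' ∧ t' = t then new else g e' t') = 2 ^ i)) =
          ((L.rel e' p' te).erase t).filter (g e' · = 2 ^ i) :=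
        List.filter_congr fun t' ht' => by rw [herase t' ht']
      rw [h5]
      by_cases h6 : new = 2 ^ i
      · simp only [h6, and_self, if_true, decide_true]
        exact (h1.append_right [t]).trans (List.perm_append_singleton _ _)
      · simpa [h6] using h1
    · rw [selfUpdate_bucket_of_ne _ _ _ _ (by tauto)]
      have : (L.rel e' p' s).filter
          (fun t' => decide ((if e' = e ∧ t' = t then new else g e' t') = 2 ^ i)) =
          (L.rel e' p' s).filter (g e' · = 2 ^ i) :=
        List.filter_congr fun t' ht' => by rw [hother e' p' s hp' h t' ht']
      rw [this]
      exact hg.bucket e' p' hp' s i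

open Classical in
/-- One step of the propagation of a changed counter to the tuples of the parent. -/
noncomputable def propagate (r : ι) (depth : ℕ) (p e : ι) (j : ℕ) (L : Index ι dom) (t' : Tup dom) :
    Timed (Index ι dom) := do
  spend 2
  let b ← wprod Q L r p t' ((children T r p).filter (· ≠ e))
  indexUpdate Q T r depth p t' (j * b) L

lemma indexUpdate_of_parent_eq_none {r e : ι} (h : parent T r e = none) (depth : ℕ) (t : Tup dom)
    (old : ℕ) (L : Index ι dom) : indexUpdate Q T r (depth + 1) e t old L = ⟨L, 1⟩ := by
  simp only [indexUpdate, h]; rfl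

/-- `30` bounds the fixed steps of one call, and `4 * Fintype.card ι` the product over the children.
-/
lemma indexUpdate_of_parent_eq_some {r e p : ι} (h : parent T r e = some p) (depth : ℕ)
    (t : Tup dom) (old : ℕ) (L : Index ι dom) {te : Tup dom} (hte : te = Tup.proj (Q.common e p) t)
    {L' : Index ι dom} (hL' : L' = selfUpdate L r e te t old (weight Q T L r e t)) :
    ((roundUp (L'.cnt r e te) ≠ roundUp (L.cnt r e te) ∧ p ≠ r) →
      (indexUpdate Q T r (depth + 1) e t old L).val =
        ((L.rel p e te).foldlM (propagate Q T r depth p e (roundUp (L.cnt r e te))) L').val ∧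
      (indexUpdate Q T r (depth + 1) e t old L).cost ≤ 30 + 4 * Fintype.card ι +
        ((L.rel p e te).foldlM (propagate Q T r depth p e (roundUp (L.cnt r e te))) L').cost) ∧
    (¬ (roundUp (L'.cnt r e te) ≠ roundUp (L.cnt r e te) ∧ p ≠ r) →
      (indexUpdate Q T r (depth + 1) e t old L).val = L' ∧
      (indexUpdate Q T r (depth + 1) e t old L).cost ≤ 30 + 4 * Fintype.card ι) := by
  have hlen := length_children_le (T := T) r e
  subst hte hL'
  have hl : ∀ (L : Index ι dom) (s : Tup dom) (i : ℕ), (L.removeBucket r e s i t).cost = 7 ∧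
      (L.appendBucket r e s i t).cost = 4 ∧ (L.setCnt r e s i).cost = 1 ∧
      (L.removeBucket r e s i t).val.cnt = L.cnt ∧ (L.appendBucket r e s i t).val.cnt = L.cnt ∧
      (L.removeBucket r e s i t).val.rel = L.rel ∧ (L.appendBucket r e s i t).val.rel = L.rel ∧
      (L.setCnt r e s i).val.rel = L.rel := fun L s i =>
    ⟨rfl, rfl, rfl, rfl, rfl, rfl, rfl, rfl⟩
  have hw : ∀ (L : Index ι dom) (s : Tup dom), (L.wcnt r e s).cost = 2 ∧
      (L.wcnt r e s).val = roundUp (L.cnt r e s) := fun L s => ⟨rfl, rfl⟩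
  constructor
  all_goals
    intro hc
    rw [selfUpdate] at hc ⊢
    simp only [indexUpdate, h, Timed.bind_val, Timed.bind_cost, wprod_val, wprod_cost, spend_cost]
    rw [← weight]
    split_ifs at hc ⊢
  all_goals
    simp only [Timed.bind_val, Timed.bind_cost, Timed.pure_val, Timed.pure_cost, spend_cost,
      hl, hw] at hc ⊢
    split_ifs with hc'
    all_goals first
    | exact absurd hc hc'
    | exact absurd hc' hc
    | refine ⟨rfl, ?_⟩
      first | rw [Timed.pure_cost] | unfold propagate
      omega

end Index

/-! ### Propagation towards the root and its amortised cost -/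

section Index

variable {V ι : Type} [DecidableEq V] {dom : V → Type} (Q : JoinQuery V ι)

lemma RelCorrect.of_rel_eq {D : List (ι × Tup dom)} {L L' : Index ι dom} (hL : RelCorrect Q D L)
    (h : L'.rel = L.rel) : RelCorrect Q D L' :=
  ⟨by rw [h]; exact hL.mem, by rw [h]; exact hL.nodup⟩

variable [Fintype ι] (T : SimpleGraph ι)

variable (ι) in
/-- The time of one call of `indexUpdate` without the propagation. -/
def callCost : ℕ := 30 + 4 * Fintype.card ι

variable (ι) in
/-- The time charged to one propagation step. -/
def stepCharge : ℕ := callCost ι + (3 + 4 * Fintype.card ι)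

/-- What an update of the degrees of the tuples `t` of the relation `e` with `P t` achieves, in the
tree rooted at `r`: `g` and `g'` are the recorded degrees before and after it. -/
structure UpdateSpec (D : List (ι × Tup dom)) (r e : ι) (P : Tup dom → Prop) (L L' : Index ι dom)
    (g g' : ι → Tup dom → ℕ) : Prop where
  recorded : Recorded T r L' g'
  rel_eq : L'.rel = L.rel
  cnt_root : ∀ r' ≠ r, L'.cnt r' = L.cnt r'
  bucket_root : ∀ r' ≠ r, L'.bucket r' = L.bucket r'
  cnt_far : ∀ e' s, T.dist r e < T.dist r e' → L'.cnt r e' s = L.cnt r e' s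
  cnt_mono : ∀ e' s, L.cnt r e' s ≤ L'.cnt r e' s
  near : ∀ e' t', (e', t') ∈ D → e' ≠ r → T.dist r e' < T.dist r e →
    g' e' t' = weight Q T L' r e' t'
  self : e ≠ r → ∀ t, P t → g' e t = weight Q T L' r e t
  far : ∀ e' t', T.dist r e ≤ T.dist r e' → ¬ (e' = e ∧ P t') → g' e' t' = g e' t'

variable {Q T}

/-- A degree at `e'` depends only on counters of children of `e'`, which are deeper than `e` and
therefore untouched. -/
lemma UpdateSpec.weight_eq {D : List (ι × Tup dom)} {r e : ι} {P : Tup dom → Prop}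
    {L L' : Index ι dom} {g g' : ι → Tup dom → ℕ} (h : UpdateSpec Q T D r e P L L' g g') {e' : ι}
    (he : T.dist r e ≤ T.dist r e') (t : Tup dom) : weight Q T L' r e' t = weight Q T L r e' t := by
  refine weightOn_congr Q fun c hc => ?_
  rw [h.cnt_far c _ (by have := (mem_children.1 hc).2; omega)]

/-- The hypothesis on one call of `indexUpdate`, for trees that are at most `depth` high below. -/
def UpdateCorrect (Q : JoinQuery V ι) (T : SimpleGraph ι) (D : List (ι × Tup dom)) (r : ι)
    (depth : ℕ) (e : ι) : Prop :=
  ∀ (t : Tup dom) (old : ℕ) (L : Index ι dom) (g : ι → Tup dom → ℕ), (e, t) ∈ D →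
    RelCorrect Q D L → Recorded T r L g → g e t = old → old ≤ weight Q T L r e t →
    (∀ e' t', (e', t') ∈ D → e' ≠ r → T.dist r e' < T.dist r e →
      g e' t' = weight Q T L r e' t') →
    ∃ g', UpdateSpec Q T D r e (· = t) L (indexUpdate Q T r depth e t old L).val g g' ∧
      (indexUpdate Q T r depth e t old L).cost + stepCharge ι * potential Q T D r L ≤
        callCost ι + stepCharge ι *
          potential Q T D r (indexUpdate Q T r depth e t old L).val

/-- Updating one tuple of `p` touches no counter deeper than `p`, so the degrees of the other listed
tuples do not move and `j * b` is still their recorded degree. Each tuple is charged `stepCharge`: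
one call and the computation of `b`. -/
lemma propagate_foldlM_spec {D : List (ι × Tup dom)} {r : ι} {depth : ℕ} {p e : ι}
    (IH : UpdateCorrect Q T D r depth p) (hpr : p ≠ r) (j : ℕ)
    (w : Tup dom → ℕ) (l : List (Tup dom)) (hl : l.Nodup) (hlD : ∀ t ∈ l, (p, t) ∈ D)
    (L : Index ι dom) (g : ι → Tup dom → ℕ) (hL : RelCorrect Q D L) (hg : Recorded T r L g)
    (hw : ∀ t ∈ l, g p t = w t ∧ w t ≤ weight Q T L r p t)
    (hj : ∀ L', (∀ e' s, T.dist r p < T.dist r e' → L'.cnt r e' s = L.cnt r e' s) →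
      ∀ t ∈ l, j * (wprod Q L' r p t (open Classical in (children T r p).filter (· ≠ e))).val = w t)
    (hnear : ∀ e' t', (e', t') ∈ D → e' ≠ r → T.dist r e' < T.dist r p →
      g e' t' = weight Q T L r e' t') :
    ∃ g', UpdateSpec Q T D r p (· ∈ l) L (l.foldlM (propagate Q T r depth p e j) L).val g g' ∧
      (l.foldlM (propagate Q T r depth p e j) L).cost + stepCharge ι * potential Q T D r L ≤
        stepCharge ι * l.length + stepCharge ι *
          potential Q T D r (l.foldlM (propagate Q T r depth p e j) L).val := by
  classical
  induction l generalizing L g with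
  | nil =>
    exact ⟨g, ⟨hg, rfl, fun _ _ => rfl, fun _ _ => rfl, fun _ _ _ => rfl, fun _ _ => le_rfl, hnear,
      fun _ t ht => absurd ht (by simp), fun _ _ _ _ => rfl⟩, by simp⟩
  | cons t l ih =>
    rw [List.nodup_cons] at hl
    simp only [List.mem_cons, forall_eq_or_imp] at hlD hw
    have hjt := hj L (fun _ _ _ => rfl) t (by simp)
    obtain ⟨g1, h1, hc1⟩ := IH t (w t) L g hlD.1 hL hg hw.1.1 hw.1.2 hnear
    set L1 := (indexUpdate Q T r depth p t (w t) L).val with hL1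
    have hv : (propagate Q T r depth p e j L t).val = L1 := by
      simp only [propagate, Timed.bind_val, hjt]
      rfl
    have hc : (propagate Q T r depth p e j L t).cost ≤
        3 + 4 * Fintype.card ι + (indexUpdate Q T r depth p t (w t) L).cost := by
      simp only [propagate, Timed.bind_cost, spend_cost, hjt, wprod_cost]
      have h1 := length_children_le (T := T) r p
      have h2 := List.length_filter_le (fun x => decide (x ≠ e)) (children T r p)
      omega
    obtain ⟨g2, h2, hc2⟩ := ih hl.2 hlD.2 L1 g1 (hL.of_rel_eq Q h1.rel_eq) h1.recorded
      (fun t' ht' => by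
        rw [h1.far p t' le_rfl (by rintro ⟨-, rfl⟩; exact hl.1 ht'), h1.weight_eq le_rfl]
        exact hw.2 t' ht')
      (fun L' hL' t' ht' => hj L' (fun e' s he' => by rw [hL' e' s he', h1.cnt_far e' s he'])
        t' (by simp [ht'])) h1.near
    rw [List.foldlM_cons, Timed.bind_val, Timed.bind_cost, hv]
    refine ⟨g2, ⟨h2.recorded, h2.rel_eq.trans h1.rel_eq,
      fun r' hr' => (h2.cnt_root r' hr').trans (h1.cnt_root r' hr'),
      fun r' hr' => (h2.bucket_root r' hr').trans (h1.bucket_root r' hr'),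
      fun e' s he' => (h2.cnt_far e' s he').trans (h1.cnt_far e' s he'),
      fun e' s => (h1.cnt_mono e' s).trans (h2.cnt_mono e' s), h2.near, ?_, ?_⟩, ?_⟩
    · intro _ t' ht'
      by_cases htl : t' ∈ l
      · exact h2.self hpr t' htl
      · obtain rfl : t' = t := by simpa [htl] using ht'
        rw [h2.far p t' le_rfl (fun h => htl h.2), h1.self hpr t' rfl, h2.weight_eq le_rfl]
    · intro e' t' he' hne
      rw [h2.far e' t' he' (fun h => hne ⟨h.1, by simp [h.2]⟩),
        h1.far e' t' he' (fun h => hne ⟨h.1, by simp [h.2]⟩)]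
    · rw [List.length_cons, mul_add, mul_one]
      have : stepCharge ι = callCost ι + (3 + 4 * Fintype.card ι) := rfl
      omega

/-- Once the counter and buckets of the tuple itself are updated, recorded degrees below the root
can be out of date only for parent tuples with the same key, and only if the rounded counter
changed; propagation repairs exactly these. Their number is covered by the rise of the potential.
The condition that `old` is at most the new weight keeps counters monotone and makes the truncated
subtraction harmless. -/
lemma updateCorrect (hT : T.IsTree) (D : List (ι × Tup dom)) (r : ι) (depth : ℕ) (e : ι)
    (hd : T.dist r e < depth) : UpdateCorrect Q T D r depth e := by
  classical
  induction depth generalizing e with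
  | zero => omega
  | succ depth IH =>
    intro t old L g ht hL hg hold hle hnear
    cases hp : parent T r e with
    | none =>
      obtain rfl : e = r := by
        by_contra h
        obtain ⟨p, hp'⟩ := exists_parent hT h
        rw [hp] at hp'; exact absurd hp' (by simp)
      rw [indexUpdate_of_parent_eq_none Q T hp]
      exact ⟨g, ⟨hg, rfl, fun _ _ => rfl, fun _ _ => rfl, fun _ _ _ => rfl, fun _ _ => le_rfl,
        hnear, fun h => absurd rfl h, fun _ _ _ _ => rfl⟩, by simp only [callCost]; omega⟩
    | some p =>
      have her := ne_of_parent_eq_some hp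
      have hdp := ((parent_eq_some_iff hT).1 hp).2
      set te := Tup.proj (Q.common e p) t with hte
      set L1 := selfUpdate L r e te t old (weight Q T L r e t) with hL1
      set g1 : ι → Tup dom → ℕ :=
        fun e' t' => if e' = e ∧ t' = t then weight Q T L r e t else g e' t' with hg1
      have hrec : Recorded T r L1 g1 := by
        rw [hL1, ← hold]
        exact hg.selfUpdate Q T hL hp ht (isZeroOrPow_weight Q T L r e t)
      have hrel : L1.rel = L.rel := selfUpdate_rel _ _ _ _ _ _ _
      have hcnt : ∀ r' e' s, ¬ (r' = r ∧ e' = e ∧ s = te) → L1.cnt r' e' s = L.cnt r' e' s :=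
        fun r' e' s h => selfUpdate_cnt_of_ne _ _ _ _ h
      have hmono : ∀ e' s, L.cnt r e' s ≤ L1.cnt r e' s := by
        intro e' s
        by_cases h : e' = e ∧ s = te
        · obtain ⟨rfl, rfl⟩ := h
          rw [hL1, selfUpdate_cnt_self]; omega
        · rw [hcnt r e' s (by tauto)]
      have hbucket : ∀ r' ≠ r, L1.bucket r' = L.bucket r' := fun r' hr' => by
        funext e' s
        exact selfUpdate_bucket_of_ne _ _ _ _ (by tauto)
      have hcroot : ∀ r' ≠ r, L1.cnt r' = L.cnt r' := fun r' hr' => by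
        funext e' s
        exact hcnt r' e' s (by tauto)
      have hfar : ∀ e' s, T.dist r e < T.dist r e' → L1.cnt r e' s = L.cnt r e' s :=
        fun e' s h => hcnt r e' s (by rintro ⟨-, rfl, -⟩; omega)
      have hself : ∀ t', weight Q T L1 r e t' = weight Q T L r e t' := fun t' =>
        weightOn_congr Q fun c hc => by
          rw [hfar c _ (by have := (mem_children.1 hc).2; omega)]
      -- the weights that do not depend on the counter that has been changed
      have hw1 : ∀ e' t', (e' = p → roundUp (L1.cnt r e (Tup.proj (Q.common e p) t')) =
          roundUp (L.cnt r e (Tup.proj (Q.common e p) t'))) →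
          weight Q T L1 r e' t' = weight Q T L r e' t' := by
        intro e' t' h
        refine weightOn_congr Q fun c hc => ?_
        by_cases hce : c = e
        · subst hce
          obtain rfl : e' = p := by
            have := (mem_children_iff hT).1 hc
            rw [hp] at this; exact (Option.some_inj.1 this).symm
          exact h rfl
        · rw [hcnt r c _ (by tauto)]
      have hnear1 : ∀ e' t', (e', t') ∈ D → e' ≠ r → T.dist r e' < T.dist r e →
          (e' = p → Tup.proj (Q.common e p) t' ≠ te ∨
            roundUp (L1.cnt r e te) = roundUp (L.cnt r e te)) →
          g1 e' t' = weight Q T L1 r e' t' := by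
        intro e' t' hD he' hde h
        rw [hg1]
        simp only
        rw [if_neg (by rintro ⟨rfl, -⟩; omega), hnear e' t' hD he' hde, hw1]
        intro hep
        by_cases hk : Tup.proj (Q.common e p) t' = te
        · rw [hk]
          exact (h hep).resolve_left (fun h => h hk)
        · rw [hcnt r e _ (by tauto)]
      obtain ⟨hyes, hno⟩ := indexUpdate_of_parent_eq_some Q T hp depth t old L hte hL1
      by_cases hc : roundUp (L1.cnt r e te) ≠ roundUp (L.cnt r e te) ∧ p ≠ r
      · obtain ⟨hv, hcost⟩ := hyes hc
        rw [hv]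
        have hLc : RelCorrect Q D L1 := hL.of_rel_eq Q hrel
        have hkey : ∀ t' ∈ L.rel p e te, (p, t') ∈ D ∧ Tup.proj (Q.common e p) t' = te := by
          intro t' ht'
          have := (hL.mem _ _ _ _).1 ht'
          rwa [show Q.common p e = Q.common e p from Finset.inter_comm _ _] at this
        obtain ⟨g2, h2, hc2⟩ := propagate_foldlM_spec (IH p (by omega)) hc.2
          (roundUp (L.cnt r e te)) (fun t' => weight Q T L r p t') (L.rel p e te)
          (hL.nodup _ _ _) (fun t' ht' => (hkey t' ht').1) L1 g1 hLc hrec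
          (fun t' ht' => by
            refine ⟨?_, weightOn_mono Q hmono⟩
            rw [hg1]
            simp only
            rw [if_neg (by rintro ⟨h, -⟩; rw [h] at hdp; omega),
              hnear p t' (hkey t' ht').1 hc.2 (by omega)])
          -- `j` is the rounded counter of `e` before the change and the other children are
          -- untouched, so the product is the old degree.
          (fun L' hL' t' ht' => by
            rw [wprod_val, weight_eq_mul Q T hT hp, (hkey t' ht').2]
            congr 1
            refine weightOn_congr Q fun c hcc => ?_
            rw [List.mem_filter] at hcc
            have hcne : c ≠ e := by simpa using hcc.2
            rw [hL' c _ (by have := (mem_children.1 hcc.1).2; omega), hcnt r c _ (by tauto)])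
          (fun e' t' hD he' hde => hnear1 e' t' hD he' (by omega) (by rintro rfl; omega))
        refine ⟨g2, ⟨h2.recorded, h2.rel_eq.trans hrel,
          fun r' hr' => (h2.cnt_root r' hr').trans (hcroot r' hr'),
          fun r' hr' => (h2.bucket_root r' hr').trans (hbucket r' hr'),
          fun e' s he' => (h2.cnt_far e' s (by omega)).trans (hfar e' s he'),
          fun e' s => (hmono e' s).trans (h2.cnt_mono e' s), ?_, ?_, ?_⟩, ?_⟩
        · intro e' t' hD he' hde
          rcases Nat.lt_or_ge (T.dist r e') (T.dist r p) with h | h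
          · exact h2.near e' t' hD he' h
          · by_cases hl : e' = p ∧ t' ∈ L.rel p e te
            · obtain ⟨rfl, hl⟩ := hl
              exact h2.self hc.2 t' hl
            · rw [h2.far e' t' h hl, h2.weight_eq h]
              refine hnear1 e' t' hD he' hde fun hep => Or.inl fun hk => hl ⟨hep, ?_⟩
              subst hep
              rw [hL.mem]
              exact ⟨hD, by rw [← hk]; congr 1; exact Finset.inter_comm _ _⟩
        · rintro - t' rfl
          rw [h2.far e t' (by omega) (by rintro ⟨h, -⟩; rw [h] at hdp; omega),
            h2.weight_eq (by omega), hself, hg1]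
          simp
        · intro e' t' he' hne
          rw [h2.far e' t' (by omega) (by rintro ⟨h, -⟩; rw [h] at he'; omega), hg1]
          exact if_neg hne
        -- The potential gained by the changed counter pays for the charges of the fold; only the
        -- cost of this call remains.
        · have := potential_add_length_le Q T hT hmono hp hc.1 hL
          have h5 : stepCharge ι * potential Q T D r L + stepCharge ι * (L.rel p e te).length ≤
              stepCharge ι * potential Q T D r L1 := by
            rw [← mul_add]; exact Nat.mul_le_mul_left _ this
          have : callCost ι = 30 + 4 * Fintype.card ι := rfl
          omega
      · obtain ⟨hv, hcost⟩ := hno hc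
        rw [hv]
        refine ⟨g1, ⟨hrec, hrel, hcroot, hbucket, hfar, hmono, ?_, ?_, ?_⟩, ?_⟩
        · intro e' t' hD he' hde
          refine hnear1 e' t' hD he' hde fun hep => Or.inr ?_
          by_contra h
          exact hc ⟨h, hep ▸ he'⟩
        · rintro - t' rfl
          rw [hself, hg1]
          simp
        · intro e' t' _ hne
          rw [hg1]
          exact if_neg hne
        · have := Nat.mul_le_mul_left (stepCharge ι) (potential_mono Q T D hmono (r := r))
          have : callCost ι = 30 + 4 * Fintype.card ι := rfl
          omega

end Index

/-! ### Insertions and correctness of the index along the stream -/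

section Index

variable {V ι : Type} [DecidableEq V] {dom : V → Type} (Q : JoinQuery V ι)

/-- Store the tuple `t` of the relation `e` in the lists of the nodes `fs`. -/
noncomputable def storeTuple (e : ι) (t : Tup dom) (fs : List ι) (L : Index ι dom) :
    Timed (Index ι dom) :=
  fs.foldlM (fun L f => do
    spend 1
    L.appendRel e f (Tup.proj (Q.common e f) t) t) L

open Classical in
lemma storeTuple_spec (e : ι) (t : Tup dom) (fs : List ι) (hfs : fs.Nodup) (L : Index ι dom) :
    (storeTuple Q e t fs L).cost = 4 * fs.length ∧
    (storeTuple Q e t fs L).val.cnt = L.cnt ∧ (storeTuple Q e t fs L).val.bucket = L.bucket ∧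
    ∀ e' f s, (storeTuple Q e t fs L).val.rel e' f s = L.rel e' f s ++
      if e' = e ∧ f ∈ fs ∧ s = Tup.proj (Q.common e f) t then [t] else [] := by
  induction fs generalizing L with
  | nil => simp [storeTuple]
  | cons f fs ih =>
    rw [List.nodup_cons] at hfs
    obtain ⟨h1, h2, h3, h4⟩ := ih hfs.2
      (L.appendRel e f (Tup.proj (Q.common e f) t) t).val
    have hc : (storeTuple Q e t (f :: fs) L).cost = 4 + (storeTuple Q e t fs
        (L.appendRel e f (Tup.proj (Q.common e f) t) t).val).cost := rfl
    have hv : (storeTuple Q e t (f :: fs) L).val = (storeTuple Q e t fs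
        (L.appendRel e f (Tup.proj (Q.common e f) t) t).val).val := rfl
    rw [hc, hv, h1, h2, h3]
    refine ⟨by rw [List.length_cons]; ring, rfl, rfl, fun e' f' s => ?_⟩
    rw [h4]
    change update3 L.rel e f _ _ e' f' s ++ _ = _
    unfold update3
    by_cases h : e' = e ∧ f' = f ∧ s = Tup.proj (Q.common e f) t
    · obtain ⟨rfl, rfl, rfl⟩ := h
      simp [hfs.1]
    · rw [if_neg h]
      congr 1
      refine if_congr ?_ rfl rfl
      constructor
      · rintro ⟨he, hf, hs⟩; exact ⟨he, by simp [hf], hs⟩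
      · rintro ⟨he, hf, hs⟩
        refine ⟨he, (List.mem_cons.1 hf).resolve_left ?_, hs⟩
        rintro rfl
        exact h ⟨he, rfl, hs⟩

lemma RelCorrect.storeTuple {D : List (ι × Tup dom)} {L L' : Index ι dom} {e : ι} {t : Tup dom}
    (hL : RelCorrect Q D L) (ht : (e, t) ∉ D)
    (h : ∀ e' f s, L'.rel e' f s = L.rel e' f s ++ open Classical in
      if e' = e ∧ s = Tup.proj (Q.common e f) t then [t] else []) :
    RelCorrect Q (D ++ [(e, t)]) L' := by
  classical
  constructor
  · intro e' f s t'
    rw [h, List.mem_append, hL.mem, List.mem_append, List.mem_singleton]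
    split_ifs with h1
    · obtain ⟨rfl, rfl⟩ := h1
      rw [List.mem_singleton]
      constructor
      · rintro (h | rfl)
        · exact ⟨Or.inl h.1, h.2⟩
        · exact ⟨Or.inr rfl, rfl⟩
      · rintro ⟨h | h, h2⟩
        · exact Or.inl ⟨h, h2⟩
        · exact Or.inr (Prod.ext_iff.1 h).2
    · constructor
      · rintro (h | h)
        · exact ⟨Or.inl h.1, h.2⟩
        · simp at h
      · rintro ⟨h | h, h2⟩
        · exact Or.inl ⟨h, h2⟩
        · obtain ⟨rfl, rfl⟩ := Prod.ext_iff.1 h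
          exact absurd ⟨rfl, h2.symm⟩ h1
  · intro e' f s
    rw [h]
    split_ifs with h1
    · refine (hL.nodup _ _ _).append (List.nodup_singleton _) ?_
      rw [List.disjoint_singleton]
      intro h2
      obtain ⟨rfl, -⟩ := h1
      exact ht ((hL.mem _ _ _ _).1 h2).1
    · rw [List.append_nil]; exact hL.nodup _ _ _

variable [Fintype ι] (T : SimpleGraph ι)

/-- The index is correct for the tuples inserted by `D`. -/
structure IndexCorrect (D : List (ι × Tup dom)) (L : Index ι dom) : Prop where
  rel : RelCorrect Q D L
  recorded : ∀ r, Recorded T r L (weight Q T L r)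

open Classical in
/-- The tuple `t` of the relation `e` is stored in the index, but the tree rooted at `r` has not been
updated yet. -/
def Pending (r e : ι) (t : Tup dom) (L : Index ι dom) : Prop :=
  Recorded T r L fun e' t' => if e' = e ∧ t' = t then 0 else weight Q T L r e' t'

lemma indexCorrect_empty : IndexCorrect Q T [] (Index.empty : Index ι dom) :=
  ⟨⟨by simp [Index.empty], by simp [Index.empty]⟩,
    fun _ => ⟨fun _ _ => isZeroOrPow_weight Q T _ _ _ _, by simp [Index.empty],
      by simp [Index.empty]⟩⟩

variable {Q T}

/-- Storing a new tuple changes lists but no counter, so sums and buckets stay correct when it is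
given degree `0`. -/
lemma IndexCorrect.pending {D : List (ι × Tup dom)} {L L' : Index ι dom} {e : ι} {t : Tup dom}
    (hL : IndexCorrect Q T D L) (ht : (e, t) ∉ D) (hcnt : L'.cnt = L.cnt)
    (hbucket : L'.bucket = L.bucket) (h : ∀ e' f s, L'.rel e' f s = L.rel e' f s ++ open Classical in
      if e' = e ∧ s = Tup.proj (Q.common e f) t then [t] else []) (r : ι) :
    Pending Q T r e t L' := by
  classical
  have hw : ∀ e' t', weight Q T L' r e' t' = weight Q T L r e' t' := fun e' t' =>
    weightOn_congr Q fun c _ => by rw [hcnt]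
  have hne : ∀ e' p s, ∀ t' ∈ L.rel e' p s, ¬ (e' = e ∧ t' = t) := by
    rintro e' p s t' ht' ⟨rfl, rfl⟩
    exact ht ((hL.rel.mem _ _ _ _).1 ht').1
  refine ⟨fun e' t' => ?_, fun e' p hp s => ?_, fun e' p hp s i => ?_⟩
  · split_ifs
    · exact Or.inl rfl
    · exact isZeroOrPow_weight Q T _ _ _ _
  · rw [hcnt, (hL.recorded r).cnt e' p hp, h, List.map_append, List.sum_append]
    have h1 : ((L.rel e' p s).map fun t' => if e' = e ∧ t' = t then 0 else weight Q T L' r e' t') =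
        (L.rel e' p s).map (weight Q T L r e') := List.map_congr_left fun t' ht' => by
      rw [if_neg (hne e' p s t' ht'), hw]
    rw [h1]
    split_ifs with h2
    · simp [h2.1]
    · simp
  · rw [hbucket, h, List.filter_append]
    have h1 : (L.rel e' p s).filter
        (fun t' => (if e' = e ∧ t' = t then 0 else weight Q T L' r e' t') = 2 ^ i) =
        (L.rel e' p s).filter (weight Q T L r e' · = 2 ^ i) := List.filter_congr fun t' ht' => by
      rw [if_neg (hne e' p s t' ht'), hw]
    rw [h1]
    have h3 : List.filter
        (fun t' => decide ((if e' = e ∧ t' = t then 0 else weight Q T L' r e' t') = 2 ^ i))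
        (if e' = e ∧ s = Tup.proj (Q.common e p) t then [t] else []) = [] := by
      split_ifs with h2
      · have : (0 : ℕ) ≠ 2 ^ i := (Nat.two_pow_pos i).ne
        simp [h2.1, this]
      · rfl
    rw [h3, List.append_nil]
    exact (hL.recorded r).bucket e' p hp s i

lemma Recorded.of_eq {r : ι} {L L' : Index ι dom} (h : Recorded T r L (weight Q T L r))
    (hrel : L'.rel = L.rel) (hcnt : L'.cnt r = L.cnt r) (hbucket : L'.bucket r = L.bucket r) :
    Recorded T r L' (weight Q T L' r) := by
  have hw : weight Q T L' r = weight Q T L r := by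
    funext e t
    exact weightOn_congr Q fun c _ => by rw [hcnt]
  rw [hw]
  exact ⟨h.pow, by rw [hrel, hcnt]; exact h.cnt, by rw [hrel, hbucket]; exact h.bucket⟩

lemma Pending.of_eq {r e : ι} {t : Tup dom} {L L' : Index ι dom} (h : Pending Q T r e t L)
    (hrel : L'.rel = L.rel) (hcnt : L'.cnt r = L.cnt r) (hbucket : L'.bucket r = L.bucket r) :
    Pending Q T r e t L' := by
  have hw : weight Q T L' r = weight Q T L r := by
    funext e t
    exact weightOn_congr Q fun c _ => by rw [hcnt]
  unfold Pending
  rw [hw]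
  exact ⟨h.pow, by rw [hrel, hcnt]; exact h.cnt, by rw [hrel, hbucket]; exact h.bucket⟩

lemma Recorded.congr {D : List (ι × Tup dom)} {r : ι} {L : Index ι dom} {g g' : ι → Tup dom → ℕ}
    (hD : RelCorrect Q D L) (h : Recorded T r L g) (hg' : ∀ e t, IsZeroOrPow (g' e t))
    (hgg' : ∀ e t, (e, t) ∈ D → e ≠ r → g e t = g' e t) : Recorded T r L g' := by
  classical
  refine ⟨hg', fun e p hp s => ?_, fun e p hp s i => ?_⟩
  · rw [h.cnt e p hp]
    exact congrArg _ (List.map_congr_left fun t ht =>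
      hgg' e t ((hD.mem _ _ _ _).1 ht).1 (ne_of_parent_eq_some hp))
  · refine (h.bucket e p hp s i).trans (List.Perm.of_eq (List.filter_congr fun t ht => ?_))
    rw [hgg' e t ((hD.mem _ _ _ _).1 ht).1 (ne_of_parent_eq_some hp)]

/-- All recorded degrees are current except that of the new tuple, recorded as `0`; one call with
`old = 0` therefore suffices. -/
lemma Pending.indexUpdate (hT : T.IsTree) {D : List (ι × Tup dom)} {r e : ι} {t : Tup dom}
    {L : Index ι dom} (h : Pending Q T r e t L) (hL : RelCorrect Q D L) (ht : (e, t) ∈ D) :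
    ∃ L', (indexUpdate Q T r (Fintype.card ι) e t 0 L).val = L' ∧
      Recorded T r L' (weight Q T L' r) ∧ L'.rel = L.rel ∧
      (∀ r' ≠ r, L'.cnt r' = L.cnt r') ∧ (∀ r' ≠ r, L'.bucket r' = L.bucket r') ∧
      (indexUpdate Q T r (Fintype.card ι) e t 0 L).cost + stepCharge ι * potential Q T D r L ≤
        callCost ι + stepCharge ι * potential Q T D r L' := by
  obtain ⟨g', h1, h2⟩ := updateCorrect hT D r (Fintype.card ι) e (dist_lt_card hT r e) t 0 L _ ht hL h
    (by simp) (Nat.zero_le _) fun e' t' _ _ hd => if_neg (by rintro ⟨rfl, -⟩; omega)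
  refine ⟨_, rfl, ?_, h1.rel_eq, h1.cnt_root, h1.bucket_root, h2⟩
  refine h1.recorded.congr (hL.of_rel_eq Q h1.rel_eq) (fun _ _ => isZeroOrPow_weight Q T _ _ _ _)
    fun e' t' hD he' => ?_
  rcases Nat.lt_or_ge (T.dist r e') (T.dist r e) with hd | hd
  · exact h1.near e' t' hD he' hd
  · by_cases heq : e' = e ∧ t' = t
    · obtain ⟨rfl, rfl⟩ := heq
      exact h1.self he' t' rfl
    · rw [h1.far e' t' hd heq, if_neg heq, h1.weight_eq hd]

/-- The rooted trees do not interact: an update for `r` leaves the counters and buckets of other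
roots alone. -/
lemma indexUpdate_foldlM_spec (hT : T.IsTree) {D : List (ι × Tup dom)} {e : ι} {t : Tup dom}
    (ht : (e, t) ∈ D) (rs : List ι) (hrs : rs.Nodup) (L : Index ι dom) (hL : RelCorrect Q D L)
    (h : ∀ r ∈ rs, Pending Q T r e t L) (h' : ∀ r ∉ rs, Recorded T r L (weight Q T L r)) :
    ∃ x : Timed (Index ι dom), rs.foldlM (fun L r => do
      spend 1
      indexUpdate Q T r (Fintype.card ι) e t 0 L) L = x ∧ IndexCorrect Q T D x.val ∧
      (∀ r ∉ rs, x.val.cnt r = L.cnt r) ∧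
      x.cost + stepCharge ι * (rs.map fun r => potential Q T D r L).sum ≤
        (1 + callCost ι) * rs.length +
          stepCharge ι * (rs.map fun r => potential Q T D r x.val).sum := by
  classical
  induction rs generalizing L with
  | nil => exact ⟨_, rfl, ⟨hL, fun r => h' r (by simp)⟩, fun _ _ => rfl, by simp⟩
  | cons r rs ih =>
    rw [List.nodup_cons] at hrs
    obtain ⟨L1, hv, h1, h2, h3, h4, h5⟩ := Pending.indexUpdate hT (h r (by simp)) hL ht
    obtain ⟨x, hx, h6, h7, h8⟩ := ih hrs.2 L1 (hL.of_rel_eq Q h2)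
      (fun r' hr' => by
        have hr : r' ≠ r := by rintro rfl; exact hrs.1 hr'
        exact (h r' (by simp [hr'])).of_eq h2 (h3 r' hr) (h4 r' hr))
      (fun r' hr' => by
        by_cases hr : r' = r
        · rwa [hr]
        · exact (h' r' (by simp [hr, hr'])).of_eq h2 (h3 r' hr) (h4 r' hr))
    have hval : (rs.foldlM (fun L r => do
        spend 1
        indexUpdate Q T r (Fintype.card ι) e t 0 L) (indexUpdate Q T r (Fintype.card ι) e t 0 L).val)
        = x := by rw [hv, hx]
    refine ⟨⟨x.val, 1 + (indexUpdate Q T r (Fintype.card ι) e t 0 L).cost + x.cost⟩, ?_, h6, ?_, ?_⟩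
    · rw [← hval]; rfl
    · intro r' hr'
      rw [List.mem_cons, not_or] at hr'
      rw [h7 r' hr'.2, h3 r' hr'.1]
    · have e1 : (rs.map fun r => potential Q T D r L) = rs.map fun r => potential Q T D r L1 :=
        List.map_congr_left fun r' hr' => by
          have : r' ≠ r := by rintro rfl; exact hrs.1 hr'
          simp only [potential, h3 r' this]
      have e2 : potential Q T D r x.val = potential Q T D r L1 := by
        simp only [potential, h7 r hrs.1]
      simp only [List.map_cons, List.sum_cons, List.length_cons, e1, e2, mul_add, mul_one]
      have := h8
      omega

variable (Q T) in
/-- The potential of all the rooted trees. -/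
noncomputable def totalPotential (D : List (ι × Tup dom)) (L : Index ι dom) : ℕ :=
  ((Finset.univ : Finset ι).toList.map fun r => potential Q T D r L).sum

/-- Storing costs `4` per node, and each root costs one call and one step. The new tuple only adds
terms to the potential, so these inequalities telescope along the stream. -/
lemma IndexCorrect.indexInsert (hT : T.IsTree) {D : List (ι × Tup dom)} {L : Index ι dom}
    (hL : IndexCorrect Q T D L) {e : ι} {t : Tup dom} (ht : (e, t) ∉ D) :
    IndexCorrect Q T (D ++ [(e, t)]) (indexInsert Q T L e t).val ∧
      (indexInsert Q T L e t).cost + stepCharge ι * totalPotential Q T D L ≤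
        (5 + callCost ι) * Fintype.card ι + stepCharge ι *
          totalPotential Q T (D ++ [(e, t)]) (indexInsert Q T L e t).val := by
  classical
  obtain ⟨hc, h1, h2, h3⟩ := storeTuple_spec Q e t (Finset.univ : Finset ι).toList
    (Finset.nodup_toList _) L
  simp only [Finset.mem_toList, Finset.mem_univ, true_and] at h3
  obtain ⟨x, hx, h4, -, h5⟩ := indexUpdate_foldlM_spec (Q := Q) hT (D := D ++ [(e, t)]) (e := e)
    (t := t) (by simp) (Finset.univ : Finset ι).toList (Finset.nodup_toList _)
    (storeTuple Q e t (Finset.univ : Finset ι).toList L).val (hL.rel.storeTuple Q ht h3)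
    (fun r _ => hL.pending ht h1 h2 h3 r) (fun r hr => absurd (by simp) hr)
  have hval : _root_.indexInsert Q T L e t =
      ⟨x.val, (storeTuple Q e t (Finset.univ : Finset ι).toList L).cost + x.cost⟩ := by
    rw [← hx]; rfl
  rw [hval]
  refine ⟨h4, ?_⟩
  have h6 : totalPotential Q T D L ≤ totalPotential Q T (D ++ [(e, t)])
      (storeTuple Q e t (Finset.univ : Finset ι).toList L).val := by
    refine List.sum_le_sum fun r _ => ?_
    unfold potential
    rw [h1]
    exact Finset.sum_le_sum_of_subset (by intro x; simp; tauto)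
  have h7 := Nat.mul_le_mul_left (stepCharge ι) h6
  unfold totalPotential at h7 ⊢
  simp only [Finset.length_toList, Finset.card_univ] at hc h5
  simp only [hc]
  have : (5 + callCost ι) * Fintype.card ι = (1 + callCost ι) * Fintype.card ι +
    4 * Fintype.card ι := by ring
  omega

lemma batchGenerate_cost_le (L : Index ι dom) (e : ι) (t : Tup dom) :
    (batchGenerate Q T L e t).cost ≤ 1 + 4 * Fintype.card ι := by
  have := length_children_le (T := T) e e
  simp only [batchGenerate, Timed.bind_cost, Timed.pure_cost, wprod_cost]
  omega

variable (ι) in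
/-- The time of one insertion into the index apart from the propagation. -/
def insertCost : ℕ := (5 + callCost ι) * Fintype.card ι + (1 + 4 * Fintype.card ι)

lemma indexCorrect_foldl (hT : T.IsTree) (D' : List (ι × Tup dom)) {D : List (ι × Tup dom)}
    (hD : (D ++ D').Nodup) {L : Index ι dom} (hL : IndexCorrect Q T D L) :
    IndexCorrect Q T (D ++ D') (D'.foldl (indexStep Q T) L) ∧
      indexCost Q T L D' + stepCharge ι * totalPotential Q T D L ≤ insertCost ι * D'.length +
        stepCharge ι * totalPotential Q T (D ++ D') (D'.foldl (indexStep Q T) L) := by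
  induction D' generalizing D L with
  | nil => simpa [indexCost] using hL
  | cons p D' ih =>
    have hp : (p.1, p.2) ∉ D := by
      rw [List.nodup_append] at hD
      exact fun h => hD.2.2 _ h _ (List.mem_cons_self) rfl
    obtain ⟨h1, h2⟩ := hL.indexInsert hT hp
    have hD' : (D ++ [p]) ++ D' = D ++ p :: D' := by simp
    obtain ⟨h3, h4⟩ := ih (D := D ++ [p]) (by rwa [hD']) (L := indexStep Q T L p) h1
    rw [hD'] at h3 h4
    refine ⟨h3, ?_⟩
    have h5 := batchGenerate_cost_le (Q := Q) (T := T) (indexStep Q T L p) p.1 p.2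
    simp only [indexCost, List.length_cons, List.foldl_cons, mul_add, mul_one, insertCost] at h4 ⊢
    change _ ≤ (5 + callCost ι) * Fintype.card ι +
      stepCharge ι * totalPotential Q T (D ++ [p]) (indexStep Q T L p) at h2
    omega

end Index

/-! ### Polynomial bounds on counters and batch sizes -/

section Bounds

variable {V ι : Type} [DecidableEq V] {dom : V → Type} {Q : JoinQuery V ι}

lemma RelCorrect.length_rel_le {D : List (ι × Tup dom)} {L : Index ι dom} (hL : RelCorrect Q D L)
    (e f : ι) (s : Tup dom) : (L.rel e f s).length ≤ D.length := by
  classical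
  rw [← List.length_map (f := fun t => (e, t))]
  refine ((hL.nodup e f s).map (Prod.mk_right_injective e)).subperm ?_ |>.length_le
  intro x hx
  obtain ⟨t, ht, rfl⟩ := List.mem_map.1 hx
  exact ((hL.mem _ _ _ _).1 ht).1

variable [Fintype ι] {T : SimpleGraph ι}

variable (ι) in
/-- The exponent in the bound on the counters of the nodes whose subtrees have height less
than `h`. -/
def heightExponent : ℕ → ℕ
  | 0 => 0
  | h + 1 => Fintype.card ι * (heightExponent h + 1) + 1

variable (ι) in
/-- The exponent in the bound on all counters and batch sizes. -/
def sizeExponent : ℕ := heightExponent ι (Fintype.card ι + 1)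

lemma heightExponent_mono : Monotone (heightExponent ι) := by
  refine monotone_nat_of_le_succ fun h => ?_
  induction h with
  | zero => exact Nat.zero_le _
  | succ h ih =>
    unfold heightExponent
    exact Nat.add_le_add_right (Nat.mul_le_mul_left _ (Nat.add_le_add_right ih 1)) 1

lemma weight_le_of_cnt_le {L : Index ι dom} {r e : ι} {N b : ℕ} (hN : 1 ≤ N)
    (h : ∀ c ∈ children T r e, ∀ s, L.cnt r c s ≤ (2 * N) ^ b) (t : Tup dom) :
    weight Q T L r e t ≤ (2 * N) ^ (Fintype.card ι * (b + 1)) := by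
  have h1 : weight Q T L r e t ≤ ((2 * N) ^ (b + 1)) ^ (children T r e).length := by
    refine (List.prod_le_pow_card _ _ ?_).trans_eq (by rw [List.length_map])
    intro n hn
    obtain ⟨c, hc, rfl⟩ := List.mem_map.1 hn
    refine (roundUp_le _).trans ?_
    rw [pow_succ']
    exact Nat.mul_le_mul (by omega) (h c hc _)
  refine h1.trans ?_
  rw [← pow_mul, mul_comm (b + 1)]
  exact Nat.pow_le_pow_right (by omega) (Nat.mul_le_mul_right _ (length_children_le _ _))

/-- Induction from the leaves upwards. A degree is a product of at most `Fintype.card ι` rounded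
counters, each rounding costing a factor `2 ≤ 2 * N`, and a counter sums at most `N` degrees. The
exponent depends only on the number of relations. -/
lemma IndexCorrect.cnt_le_height (hT : T.IsTree) {D : List (ι × Tup dom)} {L : Index ι dom}
    (hL : IndexCorrect Q T D L) {N : ℕ} (hN : 1 ≤ N) (hD : D.length ≤ N) (h : ℕ) {r e : ι}
    (hr : e ≠ r) (he : Fintype.card ι ≤ T.dist r e + h) (s : Tup dom) :
    L.cnt r e s ≤ (2 * N) ^ heightExponent ι h := by
  induction h generalizing e s with
  -- No node is that far from the root.
  | zero => have := dist_lt_card hT r e; omega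
  | succ h ih =>
    obtain ⟨p, hp⟩ := exists_parent hT hr
    rw [(hL.recorded r).cnt e p hp]
    have hw := weight_le_of_cnt_le (Q := Q) (T := T) (L := L) (r := r) (e := e) (b := heightExponent ι h)
      hN fun c hc s => ih (ne_of_parent_eq_some ((mem_children_iff hT).1 hc))
        (by have := (mem_children.1 hc).2; omega) s
    refine (List.sum_le_card_nsmul _ ((2 * N) ^ (Fintype.card ι * (heightExponent ι h + 1)))
      fun n hn => ?_).trans ?_
    · obtain ⟨t, -, rfl⟩ := List.mem_map.1 hn
      exact hw t
    · rw [List.length_map, smul_eq_mul, heightExponent, pow_succ']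
      refine Nat.mul_le_mul_right _ ?_
      have := hL.rel.length_rel_le e p s
      omega

lemma IndexCorrect.cnt_le (hT : T.IsTree) {D : List (ι × Tup dom)} {L : Index ι dom}
    (hL : IndexCorrect Q T D L) {N : ℕ} (hN : 1 ≤ N) (hD : D.length ≤ N) {r e : ι}
    (hr : e ≠ r) (s : Tup dom) : L.cnt r e s ≤ (2 * N) ^ sizeExponent ι :=
  (hL.cnt_le_height hT hN hD (Fintype.card ι) hr (by omega) s).trans
    (Nat.pow_le_pow_right (by omega) (heightExponent_mono (Nat.le_succ _)))

lemma IndexCorrect.weight_le (hT : T.IsTree) {D : List (ι × Tup dom)} {L : Index ι dom}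
    (hL : IndexCorrect Q T D L) {N : ℕ} (hN : 1 ≤ N) (hD : D.length ≤ N) (r e : ι) (t : Tup dom) :
    weight Q T L r e t ≤ (2 * N) ^ sizeExponent ι :=
  (weight_le_of_cnt_le hN (fun c hc s => hL.cnt_le_height hT hN hD (Fintype.card ι)
    (ne_of_parent_eq_some ((mem_children_iff hT).1 hc)) (by omega) s) t).trans
    (Nat.pow_le_pow_right (by omega) (Nat.le_succ _))

lemma clog_pow_le (N b : ℕ) : Nat.clog 2 (N ^ b) ≤ b * Nat.clog 2 N := by
  refine Nat.clog_le_of_le_pow ?_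
  rw [mul_comm, pow_mul]
  exact Nat.pow_le_pow_left (Nat.le_pow_clog (by norm_num) N) b

lemma level_le_clog (n : ℕ) : level n ≤ Nat.clog 2 n + 1 := by
  unfold level
  split_ifs <;> omega

/-- Levels of polynomially bounded counters are logarithmic in `N`, and each tree has at most `N`
tuples with boundedly many children each. Thus all propagations together cost `O(N log N)`. -/
lemma IndexCorrect.totalPotential_le (hT : T.IsTree) {D : List (ι × Tup dom)} {L : Index ι dom}
    (hL : IndexCorrect Q T D L) {N : ℕ} (hN : 1 ≤ N) (hD : D.length ≤ N) :
    totalPotential Q T D L ≤ Fintype.card ι * (N * (Fintype.card ι *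
      (sizeExponent ι * Nat.clog 2 (2 * N) + 1))) := by
  classical
  refine (List.sum_le_card_nsmul _ (N * (Fintype.card ι *
      (sizeExponent ι * Nat.clog 2 (2 * N) + 1))) fun n hn => ?_).trans (by simp)
  obtain ⟨r, -, rfl⟩ := List.mem_map.1 hn
  refine (Finset.sum_le_card_nsmul _ _ (Fintype.card ι *
      (sizeExponent ι * Nat.clog 2 (2 * N) + 1)) fun x _ => ?_).trans
    (Nat.mul_le_mul_right _ ((List.toFinset_card_le D).trans hD))
  refine (Finset.sum_le_card_nsmul _ _ (sizeExponent ι * Nat.clog 2 (2 * N) + 1)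
    fun c hc => ?_).trans (Nat.mul_le_mul_right _ (Finset.card_le_univ _))
  rw [List.mem_toFinset] at hc
  refine (level_le_clog _).trans (Nat.add_le_add_right (le_trans ?_ (clog_pow_le _ _)) 1)
  exact Nat.clog_mono_right 2
    (hL.cnt_le hT hN hD (ne_of_parent_eq_some ((mem_children_iff hT).1 hc)) _)

lemma indexCost_le (hT : T.IsTree) {D : List (ι × Tup dom)} (hD : D.Nodup) {N : ℕ} (hN : 1 ≤ N)
    (hDN : D.length ≤ N) : indexCost Q T Index.empty D ≤ insertCost ι * D.length +
      stepCharge ι * (Fintype.card ι * (N * (Fintype.card ι *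
        (sizeExponent ι * Nat.clog 2 (2 * N) + 1)))) := by
  obtain ⟨h1, h2⟩ := indexCorrect_foldl (Q := Q) hT D (D := []) hD (indexCorrect_empty Q T)
  have h3 := Nat.mul_le_mul_left (stepCharge ι) (h1.totalPotential_le hT hN hDN)
  simp only [List.nil_append] at h2 h3
  omega

lemma stepBatch_size (L : Index ι dom) (p : ι × Tup dom) :
    (stepBatch Q T L p).size = weight Q T (indexStep Q T L p) p.1 p.1 p.2 := by
  simp only [stepBatch, batchGenerate, Timed.bind_val, Timed.pure_val, wprod_val]
  rfl

lemma length_streamItems_le (hT : T.IsTree) (D' : List (ι × Tup dom)) {D : List (ι × Tup dom)}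
    (hD : (D ++ D').Nodup) {L : Index ι dom} (hL : IndexCorrect Q T D L) {N : ℕ} (hN : 1 ≤ N)
    (hDN : (D ++ D').length ≤ N) :
    (streamItems Q T L D').length ≤ D'.length * (2 * N) ^ sizeExponent ι := by
  induction D' generalizing D L with
  | nil => simp [streamItems]
  | cons p D' ih =>
    have hD' : (D ++ [p]) ++ D' = D ++ p :: D' := by simp
    have h1 : IndexCorrect Q T (D ++ [p]) (indexStep Q T L p) :=
      (indexCorrect_foldl hT [p] (D := D) ((List.Sublist.append_left (by simp) D).nodup hD) hL).1
    have h2 := ih (D := D ++ [p]) (by rwa [hD']) h1 (by rwa [hD'])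
    have h3 := h1.weight_le hT hN (by simp at hDN ⊢; omega) p.1 p.1 p.2
    rw [← stepBatch_size] at h3
    simp only [streamItems, List.length_append, List.length_cons, add_mul, one_mul, Batch.items,
      List.length_map, List.length_range]
    omega

end Bounds

/-! ### Lists of real and dummy items: products, prefixes, density -/

section Lists

variable {α β γ : Type}

/-- Quotient and remainder run through the pairs lexicographically; this is one step of the
mixed-radix decoding. -/
lemma List.range_mul_map (f : ℕ → ℕ → α) (a b : ℕ) :
    (List.range (a * b)).map (fun z => f (z / b) (z % b)) =
      (List.range a).flatMap fun x => (List.range b).map fun y => f x y := by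
  induction a with
  | zero => simp
  | succ a ih =>
    rw [add_mul, one_mul, List.range_add, List.map_append, ih, List.range_succ, List.flatMap_append]
    congr 1
    simp only [List.map_map, List.flatMap_cons, List.flatMap_nil, List.append_nil]
    refine List.map_congr_left fun y hy => ?_
    have hy : y < b := List.mem_range.1 hy
    simp only [Function.comp]
    rw [Nat.mul_comm, Nat.mul_add_div (by omega), Nat.mul_add_mod, Nat.div_eq_of_lt hy,
      Nat.mod_eq_of_lt hy, add_zero]

/-- A cut through a concatenation falls into a single block, so the density of prefixes can be
checked block by block. -/
lemma List.exists_of_prefix_flatMap (f : α → List β) {l : List α} {l' : List β}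
    (h : l' <+: l.flatMap f) :
    l' = [] ∨ ∃ l₁ a m, l₁ ++ [a] <+: l ∧ m <+: f a ∧ l' = l₁.flatMap f ++ m := by
  induction l generalizing l' with
  | nil => exact Or.inl (by simpa using h)
  | cons a l ih =>
    rw [List.flatMap_cons] at h
    rcases List.prefix_or_prefix_of_prefix h (List.prefix_append (f a) (l.flatMap f)) with h1 | ⟨m, rfl⟩
    · exact Or.inr ⟨[], a, l', by simp, h1, by simp⟩
    · rw [List.prefix_append_right_inj] at h
      rcases ih h with rfl | ⟨l₁, b, m', h1, h2, rfl⟩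
      · exact Or.inr ⟨[], a, f a, by simp, List.prefix_rfl, by simp⟩
      · exact Or.inr ⟨a :: l₁, b, m', by simpa using h1, h2, by simp⟩

lemma List.reduceOption_flatMap (l : List α) (f : α → List (Option β)) :
    (l.flatMap f).reduceOption = l.flatMap fun a => (f a).reduceOption := by
  induction l with
  | nil => rfl
  | cons a l ih => rw [List.flatMap_cons, List.flatMap_cons, List.reduceOption_append, ih]

/-- All the combinations of an item of `l` and an item of `m`; the items of `l` are the more
significant ones. -/
def itemProduct (f : β → α → γ) (l : List (Option α)) (m : List (Option β)) : List (Option γ) :=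
  l.flatMap fun y => m.map fun x => Option.map₂ f x y

lemma reduceOption_itemProduct (f : β → α → γ) (l : List (Option α)) (m : List (Option β)) :
    (itemProduct f l m).reduceOption =
      l.reduceOption.flatMap fun b => m.reduceOption.map fun a => f a b := by
  have h1 : ∀ b, (m.map fun x => Option.map₂ f x (some b)).reduceOption =
      m.reduceOption.map fun a => f a b := fun b => by
    rw [← List.reduceOption_map]
    congr 1
    exact List.map_congr_left fun x _ => by cases x <;> rfl
  have h2 : (m.map fun x => Option.map₂ f x none).reduceOption = [] := by
    rw [List.reduceOption_eq_nil_iff]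
    exact ⟨m.length, by simp⟩
  unfold itemProduct
  rw [List.reduceOption_flatMap]
  induction l with
  | nil => rfl
  | cons y l ih =>
    rw [List.flatMap_cons, ih]
    cases y with
    | none => rw [h2, List.nil_append, List.reduceOption_cons_of_none]
    | some b => rw [h1, List.reduceOption_cons_of_some, List.flatMap_cons]

lemma PrefixDense.mono {K K' : ℕ} {l : List (Option α)} (h : PrefixDense K l) (hK : K ≤ K') :
    PrefixDense K' l := fun l' hl' => (h l' hl').trans (Nat.mul_le_mul_right _ hK)

lemma PrefixDense.nil (K : ℕ) : PrefixDense K ([] : List (Option α)) := fun l' hl' => by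
  simp [List.prefix_nil.1 hl']

lemma PrefixDense.length_le {K : ℕ} {l : List (Option α)} (h : PrefixDense K l) :
    l.length ≤ K * l.reduceOption.length := h l List.prefix_rfl

lemma PrefixDense.flatMap {K : ℕ} {l : List β} {f : β → List (Option α)}
    (h : ∀ b ∈ l, PrefixDense K (f b)) : PrefixDense K (l.flatMap f) := by
  intro l' hl'
  rcases List.exists_of_prefix_flatMap f hl' with rfl | ⟨l₁, b, m, h1, h2, rfl⟩
  · simp
  · rw [List.reduceOption_append, List.length_append, List.length_append, mul_add]
    refine Nat.add_le_add ?_ (h b (h1.subset (by simp)) m h2)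
    have h3 : ∀ b ∈ l₁, PrefixDense K (f b) := fun b hb => h b (h1.subset (by simp [hb]))
    clear h1 h2 hl'
    induction l₁ with
    | nil => simp
    | cons a l₁ ih =>
      simp only [List.mem_cons, forall_eq_or_imp] at h3
      rw [List.flatMap_cons, List.reduceOption_append, List.length_append, List.length_append, mul_add]
      exact Nat.add_le_add h3.1.length_le (ih h3.2)

lemma PrefixDense.append {K : ℕ} {l m : List (Option α)} (hl : PrefixDense K l)
    (hm : PrefixDense K m) : PrefixDense K (l ++ m) := by
  have := PrefixDense.flatMap (K := K) (l := [l, m]) (f := id) (by simp [hl, hm])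
  simpa using this

/-- A prefix that reaches into the padding contains all of `l` and is at most twice as long as `l`.
-/
lemma PrefixDense.append_replicate {K n : ℕ} {l : List (Option α)} (hl : PrefixDense K l)
    (hn : n ≤ l.length) : PrefixDense (2 * K) (l ++ List.replicate n none) := by
  intro l' hl'
  rcases List.prefix_or_prefix_of_prefix hl' (List.prefix_append l _) with h | ⟨m, rfl⟩
  · exact (hl.mono (by omega)) l' h
  · rw [List.prefix_append_right_inj] at hl'
    have h1 := hl.length_le
    have h2 := hl'.length_le
    rw [List.length_replicate] at h2
    rw [List.reduceOption_append, List.length_append, List.length_append]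
    have : 2 * K * (l.reduceOption.length + m.reduceOption.length) =
      2 * (K * l.reduceOption.length) + 2 * K * m.reduceOption.length := by ring
    omega

/-- A prefix consists of the complete rows of `l₁` and part of the row of the next item `y`. If `y`
is a dummy, its row is counted as complete and the density of `l₁ ++ [y]` is used. If `y` is real,
the complete rows use the density of `l₁` and the partial row that of a prefix of `m`. -/
lemma PrefixDense.itemProduct {K K' : ℕ} {l : List (Option α)} {m : List (Option β)}
    (f : β → α → γ) (hl : PrefixDense K l) (hm : PrefixDense K' m) :
    PrefixDense (K * K') (itemProduct f l m) := by
  intro l' hl'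
  rcases List.exists_of_prefix_flatMap _ hl' with rfl | ⟨l₁, y, m', h1, h2, rfl⟩
  · simp
  · have h3 := hl _ h1
    have h4 := hm.length_le
    have h5 := h2.length_le
    rw [List.length_map] at h5
    have h6 : (l₁.flatMap fun y => m.map fun x => Option.map₂ f x y).length =
        l₁.length * m.length := by simp [List.length_flatMap]
    have h7 := reduceOption_itemProduct f l₁ m
    unfold _root_.itemProduct at h7
    rw [List.length_append, h6, List.reduceOption_append, h7, List.length_append,
      List.length_flatMap]
    simp only [List.length_map, List.map_const', List.sum_replicate, smul_eq_mul]
    rw [List.reduceOption_append, List.length_append, List.length_append, List.length_singleton,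
      List.reduceOption_singleton] at h3
    cases y with
    | none =>
      simp only [Option.toList_none, List.length_nil, add_zero] at h3
      calc l₁.length * m.length + m'.length ≤ (l₁.length + 1) * m.length := by
            rw [add_mul, one_mul]; omega
        _ ≤ (K * l₁.reduceOption.length) * (K' * m.reduceOption.length) := Nat.mul_le_mul h3 h4
        _ ≤ _ := by
            rw [mul_add]
            refine le_trans (le_of_eq ?_) (Nat.le_add_right _ _)
            ring
    | some b =>
      obtain ⟨m₁, rfl, h8⟩ : ∃ m₁, m' = m₁.map (fun x => Option.map₂ f x (some b)) ∧ m₁ <+: m := by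
        rw [List.prefix_iff_eq_take] at h2
        refine ⟨m.take m'.length, ?_, List.take_prefix _ _⟩
        rw [List.map_take, ← h2]
      have h9 : (m₁.map (fun x => Option.map₂ f x (some b))).reduceOption.length =
          m₁.reduceOption.length := by
        have : m₁.map (fun x => Option.map₂ f x (some b)) = m₁.map (Option.map (f · b)) :=
          List.map_congr_left fun x _ => by cases x <;> rfl
        rw [this, List.reduceOption_map, List.length_map]
      have h10 := hm _ h8
      -- `K = 0` would contradict the density of the nonempty prefix `l₁ ++ [some b]`.
      have hK : 1 ≤ K := by
        by_contra h
        obtain rfl : K = 0 := by omega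
        simp at h3
      have h11 := hl l₁ ((List.prefix_append _ _).trans h1)
      rw [h9, List.length_map, mul_add]
      refine Nat.add_le_add ?_ (h10.trans ?_)
      · calc l₁.length * m.length ≤ _ := Nat.mul_le_mul h11 h4
          _ = _ := by ring
      · exact Nat.mul_le_mul_right _ (Nat.le_mul_of_pos_left _ hK)

end Lists

/-! ### The items found at the positions of a batch -/

section Retrieve

lemma List.flatMap_range_getElem? {α β : Type} (l : List α) (f : α → List β) :
    ((List.range l.length).flatMap fun a => (l[a]?).elim [] f) = l.flatMap f := by
  induction l with
  | nil => rfl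
  | cons a l ih => simp [List.range_succ_eq_map, List.flatMap_map, ih]

lemma Timed.ext_val_cost {α : Type} {x y : Timed α} (h : x.val = y.val) (h' : x.cost = y.cost) :
    x = y := by
  cases x; cases y; simp_all

variable {V ι : Type} {dom : V → Type}

lemma findBucket_succ_val (L : Index ι dom) (r e : ι) (t : Tup dom) (n i z : ℕ) :
    (findBucket L r e t (n + 1) i z).val = if z < 2 ^ i * (L.bucket r e t i).length then some (i, z)
      else (findBucket L r e t n (i + 1) (z - 2 ^ i * (L.bucket r e t i).length)).val := by
  change (if _ then _ else _ : Timed _).val = _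
  split_ifs <;> rfl

/-- Each element of bucket `i` owns `2 ^ i` positions. As the scan subtracts the sizes of the
buckets it passes, consecutive positions run through the buckets in order. -/
lemma map_findBucket (L : Index ι dom) (r e : ι) (t : Tup dom) (n i : ℕ) :
    (List.range ((List.range n).map fun j => 2 ^ (i + j) * (L.bucket r e t (i + j)).length).sum).map
      (fun z => (findBucket L r e t n i z).val) =
    (List.range n).flatMap fun j =>
      (List.range (2 ^ (i + j) * (L.bucket r e t (i + j)).length)).map fun z => some (i + j, z) := by
  induction n generalizing i with
  | zero => rfl
  | succ n ih =>
    rw [List.range_succ_eq_map, List.map_cons, List.sum_cons, List.flatMap_cons, List.range_add,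
      List.map_append, List.map_map, List.map_map, List.flatMap_map]
    congr 1
    · refine List.map_congr_left fun z hz => ?_
      rw [add_zero] at hz ⊢
      rw [findBucket_succ_val, if_pos (List.mem_range.1 hz)]
    · simp only [Function.comp_def, Nat.succ_eq_one_add, ← add_assoc]
      rw [← ih (i + 1)]
      refine List.map_congr_left fun z _ => ?_
      rw [add_zero, findBucket_succ_val, if_neg (by omega), Nat.add_sub_cancel_left]

lemma findBucket_cost_le (L : Index ι dom) (r e : ι) (t : Tup dom) (n i z : ℕ) :
    (findBucket L r e t n i z).cost ≤ 5 * n + 1 := by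
  induction n generalizing i z with
  | zero => exact le_rfl
  | succ n ih =>
    simp only [findBucket, Timed.bind_cost, spend_cost]
    split_ifs
    · simp; omega
    · have := ih (i + 1) (z - 2 ^ i * (L.bucket r e t i).length)
      omega

lemma locate_cost_le (L : Index ι dom) (r e : ι) (t : Tup dom) (z : ℕ) :
    (locate L r e t z).cost ≤ 5 * Nat.log 2 (L.cnt r e t) + 14 := by
  have h := findBucket_cost_le L r e t (Nat.log 2 (L.cnt r e t) + 1) 0 z
  simp only [locate, Timed.bind_cost, spend_cost]
  split_ifs
  · simp only [Timed.pure_cost]; omega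
  · simp only [Timed.bind_cost]
    split
    · simp only [Timed.pure_cost]; omega
    · simp only [Timed.bind_cost, spend_cost, Timed.pure_cost]; omega

lemma locate_val_of_lt (L : Index ι dom) {r e : ι} {t : Tup dom} {z : ℕ} (h : z < L.cnt r e t) :
    (locate L r e t z).val =
      ((findBucket L r e t (Nat.log 2 (L.cnt r e t) + 1) 0 z).val).bind fun x =>
        ((L.bucket r e t x.1)[x.2 / 2 ^ x.1]?).map fun t' => (t', x.2 % 2 ^ x.1) := by
  simp only [locate, Timed.bind_val]
  rw [if_neg (by omega)]
  simp only [Timed.bind_val]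
  split <;> rename_i h <;> rw [h] <;> rfl

lemma locate_val_of_le (L : Index ι dom) {r e : ι} {t : Tup dom} {z : ℕ} (h : L.cnt r e t ≤ z) :
    (locate L r e t z).val = none := by
  simp only [locate, Timed.bind_val]
  rw [if_pos h]
  rfl

lemma weightOn_cons [DecidableEq V] (Q : JoinQuery V ι) (L : Index ι dom) (r e : ι) (t : Tup dom)
    (c : ι) (cs : List ι) : weightOn Q L r e t (c :: cs) =
      roundUp (L.cnt r c (Tup.proj (Q.common c e) t)) * weightOn Q L r e t cs := by
  simp [weightOn]

variable [DecidableEq V] [Fintype ι] (Q : JoinQuery V ι) (T : SimpleGraph ι) (L : Index ι dom) (r : ι)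

/-- The join result at the position `z` of the batch of the key `s` at the node `c`. -/
noncomputable def retrieveKey (depth : ℕ) (c : ι) (s : Tup dom) (z : ℕ) :
    Timed (Option (Tup dom)) := do
  match ← locate L r c s z with
  | none => pure none
  | some (t', l) => retrieve Q T L r depth c t' l

/-- One step of the decomposition of a position. -/
noncomputable def retrieveStep (depth : ℕ) (e : ι) (t : Tup dom) (c : ι)
    (acc : Option (Tup dom) × ℕ) : Timed (Option (Tup dom) × ℕ) := do
  spend 4
  let key := Tup.proj (Q.common c e) t
  let w ← L.wcnt r c key
  let y ← retrieveKey Q T L r depth c key (acc.2 % w)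
  let res : Option (Tup dom) := match acc.1, y with
    | some a, some b => some (Tup.merge a b)
    | _, _ => none
  return (res, acc.2 / w)

lemma retrieve_succ (depth : ℕ) (e : ι) (t : Tup dom) (z : ℕ) :
    retrieve Q T L r (depth + 1) e t z = (do
      spend 1
      let out ← (children T r e).foldrM (retrieveStep Q T L r depth e t) (some t, z)
      return out.1) := by
  have h : retrieveStep Q T L r depth e t = fun c (acc : Option (Tup dom) × ℕ) => (do
      spend 4
      let key := Tup.proj (Q.common c e) t
      let w ← L.wcnt r c key
      let y ← match ← locate L r c key (acc.2 % w) with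
        | none => pure none
        | some (t', l) => retrieve Q T L r depth c t' l
      let res : Option (Tup dom) := match acc.1, y with
        | some a, some b => some (Tup.merge a b)
        | _, _ => none
      return (res, acc.2 / w)) := by
    funext c acc
    simp only [retrieveStep, retrieveKey]
    refine Timed.ext_val_cost ?_ ?_ <;>
      simp only [Timed.bind_val, Timed.bind_cost, Timed.pure_val, Timed.pure_cost] <;>
      generalize (locate L r c (Tup.proj (Q.common c e) t)
        (acc.2 % (L.wcnt r c (Tup.proj (Q.common c e) t)).val)).val = o <;>
      rcases o with _ | ⟨t', l⟩ <;>
      simp only [Timed.bind_val, Timed.bind_cost, Timed.pure_val, Timed.pure_cost]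
    omega
  rw [h]
  rfl

lemma Timed.foldrM_val {α β : Type} (f : α → β → Timed β) (b : β) (l : List α) :
    (l.foldrM f b).val = l.foldr (fun a b => (f a b).val) b := by
  rw [List.foldrM, Timed.foldlM_val, List.foldl_reverse]

lemma Timed.foldrM_cost_le {α β : Type} {f : α → β → Timed β} {X : ℕ} (b : β) (l : List α)
    (h : ∀ a ∈ l, ∀ b, (f a b).cost ≤ X) : (l.foldrM f b).cost ≤ l.length * X := by
  have key : ∀ (l : List α) (b : β), (∀ a ∈ l, ∀ b, (f a b).cost ≤ X) →
      (l.foldlM (fun s a => f a s) b).cost ≤ l.length * X := by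
    intro l
    induction l with
    | nil => intro b _; simp
    | cons a l ih =>
      intro b h
      simp only [List.mem_cons, forall_eq_or_imp] at h
      have h1 := ih (f a b).val h.2
      have h2 := h.1 b
      rw [List.foldlM_cons, Timed.bind_cost, List.length_cons, add_mul, one_mul]
      omega
  rw [List.foldrM]
  simpa using key l.reverse b (by simpa using h)

/-- The items of the batch of the tuple `t` of the relation `e`. -/
noncomputable def tupleItems (depth : ℕ) (e : ι) (t : Tup dom) : List (Option (Tup dom)) :=
  (List.range (weight Q T L r e t)).map fun z => (retrieve Q T L r depth e t z).val

/-- The items of the batch of the key `s` at the node `c`. -/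
noncomputable def keyItems (depth : ℕ) (c : ι) (s : Tup dom) : List (Option (Tup dom)) :=
  (List.range (roundUp (L.cnt r c s))).map fun z => (retrieveKey Q T L r depth c s z).val

/-- The combinations of `t` and an item of the batch of the key of each of the given children. -/
noncomputable def childItems (depth : ℕ) (e : ι) (t : Tup dom) : List ι → List (Option (Tup dom))
  | [] => [some t]
  | c :: cs => itemProduct Tup.merge (keyItems Q T L r depth c (Tup.proj (Q.common c e) t))
      (childItems depth e t cs)

/-- The entry at the position `z` of `childItems`. -/
noncomputable def childItem (depth : ℕ) (e : ι) (t : Tup dom) : List ι → ℕ → Option (Tup dom)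
  | [], _ => some t
  | c :: cs, z => Option.map₂ Tup.merge (childItem depth e t cs z)
      (retrieveKey Q T L r depth c (Tup.proj (Q.common c e) t) (z / weightOn Q L r e t cs %
        roundUp (L.cnt r c (Tup.proj (Q.common c e) t)))).val

lemma foldr_retrieveStep (depth : ℕ) (e : ι) (t : Tup dom) (cs : List ι) (z : ℕ) :
    cs.foldr (fun c acc => (retrieveStep Q T L r depth e t c acc).val) (some t, z) =
      (childItem Q T L r depth e t cs z, z / weightOn Q L r e t cs) := by
  induction cs with
  | nil => simp [childItem, weightOn]
  | cons c cs ih =>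
    rw [List.foldr_cons, ih, weightOn_cons, mul_comm, ← Nat.div_div_eq_div_mul]
    simp only [retrieveStep, Timed.bind_val, Timed.pure_val, Index.wcnt, childItem]
    refine Prod.ext ?_ rfl
    generalize childItem Q T L r depth e t cs z = a
    generalize Timed.val _ = b
    cases a <;> cases b <;> rfl

/-- The digits for `cs` are read modulo the product of their radices, so more significant digits do
not matter. -/
lemma childItem_mod (depth : ℕ) (e : ι) (t : Tup dom) (cs : List ι) (z : ℕ) :
    childItem Q T L r depth e t cs (z % weightOn Q L r e t cs) =
      childItem Q T L r depth e t cs z := by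
  induction cs generalizing z with
  | nil => rfl
  | cons c cs ih =>
    simp only [childItem]
    rw [weightOn_cons, Nat.mod_mul_left_div_self, Nat.mod_mod, ← ih (z % _), Nat.mod_mul_left_mod, ih]

lemma map_childItem (depth : ℕ) (e : ι) (t : Tup dom) (cs : List ι) :
    (List.range (weightOn Q L r e t cs)).map (childItem Q T L r depth e t cs) =
      childItems Q T L r depth e t cs := by
  induction cs with
  | nil => rfl
  | cons c cs ih =>
    have := List.range_mul_map (fun a b => Option.map₂ Tup.merge (childItem Q T L r depth e t cs b)
      (retrieveKey Q T L r depth c (Tup.proj (Q.common c e) t)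
        (a % roundUp (L.cnt r c (Tup.proj (Q.common c e) t)))).val)
      (roundUp (L.cnt r c (Tup.proj (Q.common c e) t))) (weightOn Q L r e t cs)
    simp only [childItem_mod] at this
    rw [weightOn_cons]
    refine this.trans ?_
    rw [childItems, ← ih, itemProduct, keyItems, List.flatMap_map]
    refine List.flatMap_congr fun a ha => ?_
    rw [Nat.mod_eq_of_lt (List.mem_range.1 ha), List.map_map]
    rfl

lemma tupleItems_succ (depth : ℕ) (e : ι) (t : Tup dom) :
    tupleItems Q T L r (depth + 1) e t = childItems Q T L r depth e t (children T r e) := by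
  rw [← map_childItem, tupleItems]
  refine List.map_congr_left fun z _ => ?_
  rw [retrieve_succ]
  simp only [Timed.bind_val, Timed.pure_val, Timed.foldrM_val, foldr_retrieveStep]

variable {Q T L r}

/-- Positions below the counter run through the batches of the tuples, bucket after bucket. The
positions added by rounding are dummies at the very end, which is what makes density of prefixes
provable. -/
lemma keyItems_eq (depth : ℕ) (c : ι) (s : Tup dom)
    (hw : ∀ i, ∀ t ∈ L.bucket r c s i, weight Q T L r c t = 2 ^ i)
    (hcnt : ((List.range (Nat.log 2 (L.cnt r c s) + 1)).map
      fun i => 2 ^ i * (L.bucket r c s i).length).sum = L.cnt r c s) :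
    keyItems Q T L r depth c s = ((List.range (Nat.log 2 (L.cnt r c s) + 1)).flatMap fun i =>
      (L.bucket r c s i).flatMap (tupleItems Q T L r depth c)) ++
        List.replicate (roundUp (L.cnt r c s) - L.cnt r c s) none := by
  have h1 : roundUp (L.cnt r c s) = L.cnt r c s + (roundUp (L.cnt r c s) - L.cnt r c s) := by
    have := le_roundUp (L.cnt r c s); omega
  unfold keyItems
  conv_lhs => rw [h1, List.range_add, List.map_append]
  congr 1
  · have h2 : (List.range (L.cnt r c s)).map (fun z => (retrieveKey Q T L r depth c s z).val) =
        ((List.range (L.cnt r c s)).map fun z =>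
          (findBucket L r c s (Nat.log 2 (L.cnt r c s) + 1) 0 z).val).map fun o =>
            match o.bind fun x =>
              ((L.bucket r c s x.1)[x.2 / 2 ^ x.1]?).map fun t' => (t', x.2 % 2 ^ x.1) with
            | none => none
            | some (t', l) => (retrieve Q T L r depth c t' l).val := by
      rw [List.map_map]
      refine List.map_congr_left fun z hz => ?_
      simp only [Function.comp, retrieveKey, Timed.bind_val,
        locate_val_of_lt L (List.mem_range.1 hz)]
      split <;> simp_all
    have h3 := map_findBucket L r c s (Nat.log 2 (L.cnt r c s) + 1) 0
    simp only [zero_add] at h3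
    rw [hcnt] at h3
    rw [h2, h3, List.map_flatMap]
    refine List.flatMap_congr fun i _ => ?_
    rw [List.map_map, mul_comm]
    have h4 := List.range_mul_map (fun a b => match (L.bucket r c s i)[a]? with
      | none => none
      | some t' => (retrieve Q T L r depth c t' b).val) (L.bucket r c s i).length (2 ^ i)
    refine Eq.trans (List.map_congr_left fun z _ => ?_) (h4.trans ?_)
    · simp only [Function.comp, Option.bind_some]
      cases (L.bucket r c s i)[z / 2 ^ i]? <;> rfl
    · rw [← List.flatMap_range_getElem? (L.bucket r c s i)]
      refine List.flatMap_congr fun a ha => ?_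
      have ha := List.mem_range.1 ha
      rw [List.getElem?_eq_getElem ha, Option.elim_some, tupleItems, hw i _ (List.getElem_mem ha)]
  · rw [List.map_map, List.eq_replicate_iff]
    refine ⟨by simp, fun b hb => ?_⟩
    obtain ⟨z, -, rfl⟩ := List.mem_map.1 hb
    simp only [Function.comp, retrieveKey, Timed.bind_val, locate_val_of_le L (Nat.le_add_right _ z)]
    rfl

/-- Each child costs a bucket scan of logarithmic length and a recursive call. In the base `2 *
Fintype.card ι + 1`, the factor `2` absorbs the scan and the `1` the step of the call itself. -/
lemma retrieve_cost_le {M : ℕ} (hT : T.IsTree) (hM : ∀ c, c ≠ r → ∀ s, L.cnt r c s ≤ M) (depth : ℕ)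
    (e : ι) (t : Tup dom) (z : ℕ) : (retrieve Q T L r depth e t z).cost ≤
      (2 * Fintype.card ι + 1) ^ depth * (5 * Nat.log 2 M + 20) := by
  induction depth generalizing e t z with
  | zero => simp [retrieve]
  | succ depth ih =>
    set X := 5 * Nat.log 2 M + 20 with hX
    have hstep : ∀ c ∈ children T r e, ∀ acc, (retrieveStep Q T L r depth e t c acc).cost ≤
        2 * ((2 * Fintype.card ι + 1) ^ depth * X) := by
      intro c hc acc
      have h1 := locate_cost_le L r c (Tup.proj (Q.common c e) t)
        (acc.2 % roundUp (L.cnt r c (Tup.proj (Q.common c e) t)))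
      have h2 : Nat.log 2 (L.cnt r c (Tup.proj (Q.common c e) t)) ≤ Nat.log 2 M :=
        Nat.log_mono_right (hM c (ne_of_parent_eq_some ((mem_children_iff hT).1 hc)) _)
      have h3 : (retrieveKey Q T L r depth c (Tup.proj (Q.common c e) t)
          (acc.2 % roundUp (L.cnt r c (Tup.proj (Q.common c e) t)))).cost ≤
          (5 * Nat.log 2 M + 14) + (2 * Fintype.card ι + 1) ^ depth * X := by
        simp only [retrieveKey, Timed.bind_cost]
        refine Nat.add_le_add (by omega) ?_
        split
        · simp
        · exact ih _ _ _
      have h4 : X ≤ (2 * Fintype.card ι + 1) ^ depth * X :=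
        Nat.le_mul_of_pos_left _ (by positivity)
      simp only [retrieveStep, Timed.bind_cost, spend_cost, Index.wcnt, Timed.bind_val,
        Timed.pure_val, Timed.pure_cost]
      omega
    have h1 := Timed.foldrM_cost_le (some t, z) _ hstep
    have h2 := Nat.mul_le_mul_right (2 * ((2 * Fintype.card ι + 1) ^ depth * X))
      (length_children_le (T := T) r e)
    have h4 : X ≤ (2 * Fintype.card ι + 1) ^ depth * X := Nat.le_mul_of_pos_left _ (by positivity)
    have h5 : (2 * Fintype.card ι + 1) ^ (depth + 1) * X =
      Fintype.card ι * (2 * ((2 * Fintype.card ι + 1) ^ depth * X)) +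
        (2 * Fintype.card ι + 1) ^ depth * X := by ring
    rw [retrieve_succ]
    simp only [Timed.bind_cost, spend_cost, Timed.pure_cost]
    omega

end Retrieve

/-! ### The buckets of a key and the density of batches -/

section Items

/-- A nonzero weight is a power of two for exactly one exponent, which is below `n`; so the filters
are disjoint and exhaust the tuples of nonzero weight. -/
lemma List.perm_flatMap_filter_two_pow {β : Type} [DecidableEq β] {l : List β} (hl : l.Nodup)
    {w : β → ℕ} {n : ℕ} (hw : ∀ t ∈ l, IsZeroOrPow (w t)) (hn : ∀ t ∈ l, w t < 2 ^ n) :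
    ((List.range n).flatMap fun i => l.filter (w · = 2 ^ i)).Perm (l.filter (w · ≠ 0)) := by
  refine (List.perm_ext_iff_of_nodup ?_ (hl.filter _)).2 fun t => ?_
  · rw [List.nodup_flatMap]
    refine ⟨fun i _ => hl.filter _, List.nodup_range.pairwise_of_forall_ne fun i _ j _ hij => ?_⟩
    intro t h1 h2
    simp only [List.mem_filter, decide_eq_true_eq] at h1 h2
    exact hij (Nat.pow_right_injective le_rfl (h1.2.symm.trans h2.2))
  · simp only [List.mem_flatMap, List.mem_range, List.mem_filter, decide_eq_true_eq]
    constructor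
    · rintro ⟨i, -, h1, h2⟩
      exact ⟨h1, by rw [h2]; positivity⟩
    · rintro ⟨h1, h2⟩
      obtain ⟨i, hi⟩ := (hw t h1).resolve_left h2
      have := hn t h1
      rw [hi] at this
      exact ⟨i, (Nat.pow_lt_pow_iff_right (by norm_num)).1 this, h1, hi⟩

lemma List.sum_map_filter_ne_zero {β : Type} (l : List β) (w : β → ℕ) :
    ((l.filter (w · ≠ 0)).map w).sum = (l.map w).sum := by
  induction l with
  | nil => rfl
  | cons a l ih =>
    by_cases h : w a = 0
    · simp_all
    · simp_all

variable {V ι : Type} [DecidableEq V] [Fintype ι] {dom : V → Type} {Q : JoinQuery V ι}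
  {T : SimpleGraph ι}

-- A degree is a summand of the counter, so its bucket number is at most the logarithm of the
-- counter and the scan misses no tuple.
open Classical in
lemma IndexCorrect.perm_buckets {D : List (ι × Tup dom)} {L : Index ι dom}
    (hL : IndexCorrect Q T D L) {r c e : ι} (hc : parent T r c = some e) (s : Tup dom) :
    ((List.range (Nat.log 2 (L.cnt r c s) + 1)).flatMap (L.bucket r c s)).Perm
      ((L.rel c e s).filter (weight Q T L r c · ≠ 0)) := by
  refine (List.Perm.flatMap (List.Perm.refl _) fun i _ => (hL.recorded r).bucket c e hc s i).trans ?_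
  refine List.perm_flatMap_filter_two_pow (hL.rel.nodup c e s)
    (fun t _ => isZeroOrPow_weight Q T L r c t) fun t ht => ?_
  refine lt_of_le_of_lt ?_ (Nat.lt_pow_succ_log_self (by norm_num) (L.cnt r c s))
  rw [(hL.recorded r).cnt c e hc s]
  exact List.le_sum_of_mem (List.mem_map_of_mem ht)

lemma IndexCorrect.weight_of_mem_bucket {D : List (ι × Tup dom)} {L : Index ι dom}
    (hL : IndexCorrect Q T D L) {r c e : ι} (hc : parent T r c = some e) (s : Tup dom) (i : ℕ)
    (t : Tup dom) (ht : t ∈ L.bucket r c s i) : weight Q T L r c t = 2 ^ i := by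
  classical
  have := ((hL.recorded r).bucket c e hc s i).mem_iff.1 ht
  simpa using (List.mem_filter.1 this).2

lemma IndexCorrect.sum_buckets {D : List (ι × Tup dom)} {L : Index ι dom}
    (hL : IndexCorrect Q T D L) {r c e : ι} (hc : parent T r c = some e) (s : Tup dom) :
    ((List.range (Nat.log 2 (L.cnt r c s) + 1)).map
      fun i => 2 ^ i * (L.bucket r c s i).length).sum = L.cnt r c s := by
  have h1 := ((hL.perm_buckets hc s).map (weight Q T L r c)).sum_eq
  rw [List.sum_map_filter_ne_zero, ← (hL.recorded r).cnt c e hc s] at h1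
  refine Eq.trans ?_ h1
  rw [List.map_flatMap, List.flatMap_def, List.sum_flatten, List.map_map]
  refine congrArg _ (List.map_congr_left fun i _ => ?_)
  rw [Function.comp_apply, List.map_congr_left (hL.weight_of_mem_bucket hc s i), List.map_const', List.sum_replicate,
    smul_eq_mul, mul_comm]

lemma IndexCorrect.keyItems_eq {D : List (ι × Tup dom)} {L : Index ι dom}
    (hL : IndexCorrect Q T D L) {r c e : ι} (hc : parent T r c = some e) (s : Tup dom) (depth : ℕ) :
    keyItems Q T L r depth c s = ((List.range (Nat.log 2 (L.cnt r c s) + 1)).flatMap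
      (L.bucket r c s)).flatMap (tupleItems Q T L r depth c) ++
        List.replicate (roundUp (L.cnt r c s) - L.cnt r c s) none := by
  rw [_root_.keyItems_eq depth c s (hL.weight_of_mem_bucket hc s) (hL.sum_buckets hc s),
    List.flatMap_assoc]

/-- Tuples of degree zero are in no bucket, but their batches are empty and may be included. -/
lemma IndexCorrect.keyItems_perm {D : List (ι × Tup dom)} {L : Index ι dom}
    (hL : IndexCorrect Q T D L) {r c e : ι} (hc : parent T r c = some e) (s : Tup dom) (depth : ℕ) :
    (keyItems Q T L r depth c s).reduceOption.Perm
      ((L.rel c e s).flatMap fun t => (tupleItems Q T L r depth c t).reduceOption) := by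
  rw [hL.keyItems_eq hc, List.reduceOption_append, List.reduceOption_replicate_none, List.append_nil,
    List.reduceOption_flatMap]
  refine ((hL.perm_buckets hc s).flatMap_right _).trans (List.Perm.of_eq ?_)
  induction L.rel c e s with
  | nil => rfl
  | cons t l ih =>
    by_cases h : weight Q T L r c t = 0
    · have : tupleItems Q T L r depth c t = [] := by simp [tupleItems, h]
      rw [List.filter_cons_of_neg (by simpa using h), ih, List.flatMap_cons, this]
      rfl
    · rw [List.filter_cons_of_pos (by simpa using h), List.flatMap_cons, List.flatMap_cons, ih]

variable (ι) in
/-- The bound on the inverse of the density of a batch in the subtrees of height less than `h`. -/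
def densityBound : ℕ → ℕ
  | 0 => 1
  | h + 1 => (2 * densityBound h) ^ Fintype.card ι

lemma one_le_densityBound (h : ℕ) : 1 ≤ densityBound ι h := by
  induction h with
  | zero => exact le_rfl
  | succ h ih => exact Nat.one_le_pow _ _ (by omega)

/-- Rounding at most doubles a counter and its dummies come last, so each key costs a factor `2`;
combining the children multiplies the bounds. The depth is bounded by the number of relations. -/
lemma IndexCorrect.prefixDense_tupleItems (hT : T.IsTree) {D : List (ι × Tup dom)}
    {L : Index ι dom} (hL : IndexCorrect Q T D L) (r : ι) (depth : ℕ) (e : ι)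
    (he : Fintype.card ι ≤ T.dist r e + depth) (t : Tup dom) :
    PrefixDense (densityBound ι depth) (tupleItems Q T L r depth e t) := by
  induction depth generalizing e t with
  | zero => have := dist_lt_card hT r e; omega
  | succ depth ih =>
    have hkey : ∀ c ∈ children T r e, ∀ s,
        PrefixDense (2 * densityBound ι depth) (keyItems Q T L r depth c s) := by
      intro c hc s
      have hp := (mem_children_iff hT).1 hc
      have h1 := congrArg List.length (hL.keyItems_eq hp s depth)
      rw [hL.keyItems_eq hp s depth]
      refine PrefixDense.append_replicate (PrefixDense.flatMap fun t _ => ih c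
        (by have := (mem_children.1 hc).2; omega) t) ?_
      rw [List.length_append, List.length_replicate, keyItems, List.length_map,
        List.length_range] at h1
      have := roundUp_le (L.cnt r c s)
      omega
    have hchild : ∀ cs, (∀ c ∈ cs, c ∈ children T r e) → PrefixDense
        ((2 * densityBound ι depth) ^ cs.length) (childItems Q T L r depth e t cs) := by
      intro cs hcs
      induction cs with
      | nil =>
        intro l' hl'
        have := hl'.sublist
        rcases List.sublist_singleton.1 this with rfl | rfl <;> simp [List.reduceOption]
      | cons c cs ih =>
        simp only [List.mem_cons, forall_eq_or_imp] at hcs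
        rw [List.length_cons, pow_succ']
        exact (hkey c hcs.1 _).itemProduct _ (ih hcs.2)
    rw [tupleItems_succ]
    refine (hchild _ fun _ h => h).mono (Nat.pow_le_pow_right ?_ (length_children_le _ _))
    have := one_le_densityBound (ι := ι) depth
    omega

end Items

/-! ### Projections and combinations of partial tuples -/

namespace Tup

variable {V : Type} {dom : V → Type}

lemma ne_none_iff {t : Tup dom} {A : Finset V} (h : t.supp = A) {x : V} : t x ≠ none ↔ x ∈ A := by
  have : x ∈ t.supp ↔ x ∈ (A : Set V) := by rw [h]
  exact this

lemma eq_none {t : Tup dom} {A : Finset V} (h : t.supp = A) {x : V} (hx : x ∉ A) : t x = none := by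
  by_contra h'
  exact hx ((ne_none_iff h).1 h')

variable [DecidableEq V]

lemma proj_proj {s s' : Finset V} (h : s ⊆ s') (t : Tup dom) : proj s (proj s' t) = proj s t := by
  funext x
  unfold proj
  split_ifs with h1 h2
  · rfl
  · exact absurd (h h1) h2
  · rfl

lemma proj_apply {s : Finset V} {x : V} (h : x ∈ s) (t : Tup dom) : proj s t x = t x := if_pos h

lemma supp_proj {t : Tup dom} {A s : Finset V} (h : t.supp = A) (hs : s ⊆ A) :
    (proj s t).supp = s := by
  ext x
  change proj s t x ≠ none ↔ x ∈ s
  unfold proj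
  split_ifs with h1
  · exact ⟨fun _ => h1, fun _ => (ne_none_iff h).2 (hs h1)⟩
  · simp [h1]

lemma proj_merge_left {a b : Tup dom} {A s : Finset V} (ha : a.supp = A) (hs : s ⊆ A) :
    proj s (merge a b) = proj s a := by
  funext x
  unfold proj merge
  split_ifs with h1
  · obtain ⟨v, hv⟩ := Option.ne_none_iff_exists'.1 ((ne_none_iff ha).2 (hs h1))
    simp [hv]
  · rfl

/-- `merge` prefers its left argument, so agreement on common attributes is needed to recover the
right one. -/
lemma proj_merge_right {a b : Tup dom} {A B s : Finset V} (ha : a.supp = A)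
    (hab : ∀ x ∈ A, x ∈ B → a x = b x) (hs : s ⊆ B) : proj s (merge a b) = proj s b := by
  funext x
  by_cases h1 : x ∈ s
  · by_cases h2 : x ∈ A
    · have := congrFun (proj_merge_left (b := b) ha (Finset.singleton_subset_iff.2 h2)) x
      rw [proj_apply (by simp), proj_apply (by simp)] at this
      rw [proj_apply h1, proj_apply h1, this, hab x h2 (hs h1)]
    · rw [proj_apply h1, proj_apply h1, merge, eq_none ha h2, Option.none_or]
  · simp [proj, h1]

lemma supp_merge {a b : Tup dom} {A B : Finset V} (ha : a.supp = A) (hb : b.supp = B) :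
    (merge a b).supp = (A ∪ B : Finset V) := by
  ext x
  have h1 := ne_none_iff ha (x := x)
  have h2 := ne_none_iff hb (x := x)
  rw [Finset.mem_coe, Finset.mem_union, ← h1, ← h2]
  change (a x).or (b x) ≠ none ↔ _
  cases a x <;> simp

lemma merge_proj {y : Tup dom} {A B : Finset V} (hy : y.supp = (A ∪ B : Finset V)) :
    merge (proj A y) (proj B y) = y := by
  funext x
  unfold merge proj
  by_cases h1 : x ∈ A
  · rw [if_pos h1]
    obtain ⟨v, hv⟩ := Option.ne_none_iff_exists'.1
      ((ne_none_iff hy (x := x)).2 (by simp [h1]))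
    simp [hv]
  · by_cases h2 : x ∈ B
    · simp [h1, h2]
    · simp [h1, h2, eq_none hy (x := x) (by simp [h1, h2])]

lemma proj_self {t : Tup dom} {A : Finset V} (h : t.supp = A) : proj A t = t := by
  funext x
  unfold proj
  split_ifs with h1
  · rfl
  · exact (eq_none h h1).symm

end Tup

/-! ### Subtrees and the running intersection property -/

section Below

variable {ι : Type} [Fintype ι] (T : SimpleGraph ι)

/-- The node `f` lies in the subtree of `e` in the tree rooted at `r`. -/
def Below (r e f : ι) : Prop := Relation.ReflTransGen (fun a b => parent T r a = some b) f e

variable {T}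

lemma Below.head {r e f g : ι} (h : parent T r g = some f) (hf : Below T r e f) : Below T r e g :=
  Relation.ReflTransGen.head h hf

lemma Below.dist_le (hT : T.IsTree) {r e f : ι} (h : Below T r e f) : T.dist r e ≤ T.dist r f := by
  induction h with
  | refl => exact le_rfl
  | tail _ h ih => have := ((parent_eq_some_iff hT).1 h).2; omega

lemma Below.eq_of_dist_le (hT : T.IsTree) {r e f : ι} (h : Below T r e f)
    (hd : T.dist r f ≤ T.dist r e) : f = e := by
  rcases Relation.ReflTransGen.cases_head h with h | ⟨g, h1, h2⟩
  · exact h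
  · have := Below.dist_le hT h2
    have := ((parent_eq_some_iff hT).1 h1).2
    omega

/-- The ancestors of `f` form a chain, so two of them at equal depth coincide. -/
lemma Below.eq_of_mem_children (hT : T.IsTree) {r e c c' f : ι} (hc : c ∈ children T r e)
    (hc' : c' ∈ children T r e) (h : Below T r c f) (h' : Below T r c' f) : c = c' := by
  have h1 := (mem_children.1 hc).2
  have h2 := (mem_children.1 hc').2
  rcases Relation.ReflTransGen.total_of_right_unique
    (fun a b b' hb hb' => Option.some_inj.1 (hb.symm.trans hb')) h h' with h3 | h3
  · exact Below.eq_of_dist_le hT h3 (by omega)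
  · exact (Below.eq_of_dist_le hT h3 (by omega)).symm

lemma not_below_of_mem_children (hT : T.IsTree) {r e c : ι} (hc : c ∈ children T r e) :
    ¬ Below T r c e := fun h => by
  have := h.dist_le hT
  have := (mem_children.1 hc).2
  omega

lemma below_iff (hT : T.IsTree) {r e f : ι} :
    Below T r e f ↔ f = e ∨ ∃ c ∈ children T r e, Below T r c f := by
  constructor
  · intro h
    rcases Relation.ReflTransGen.cases_tail h with h | ⟨c, h1, h2⟩
    · exact Or.inl h.symm
    · exact Or.inr ⟨c, (mem_children_iff hT).2 h2, h1⟩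
  · rintro (rfl | ⟨c, h1, h2⟩)
    · exact Relation.ReflTransGen.refl
    · exact Relation.ReflTransGen.tail h2 ((mem_children_iff hT).1 h1)

lemma below_root (hT : T.IsTree) (r f : ι) : Below T r r f := by
  obtain ⟨n, hn⟩ : ∃ n, T.dist r f = n := ⟨_, rfl⟩
  induction n using Nat.strong_induction_on generalizing f with
  | _ n ih =>
    by_cases h : f = r
    · exact h ▸ Relation.ReflTransGen.refl
    · obtain ⟨p, hp⟩ := exists_parent hT h
      have := ((parent_eq_some_iff hT).1 hp).2
      exact (ih _ (by omega) p rfl).head hp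

/-- Neighbours are parent and child. A child of a node of the subtree lies in the subtree, and so
does the parent of any of its nodes other than `c`; only the edge from `c` to `e` leaves it. -/
lemma adj_below (hT : T.IsTree) {r e c f g : ι} (hc : c ∈ children T r e) (hf : Below T r c f)
    (hg : ¬ Below T r c g) (h : T.Adj f g) : f = c ∧ g = e := by
  have h1 : T.dist r f + 1 = T.dist r g ∨ T.dist r g + 1 = T.dist r f := by
    have h1 := hT.dist_ne_of_adj r h
    have h2 := h.diff_dist_adj (u := r)
    omega
  rcases h1 with h1 | h1
  · have : parent T r g = some f := (parent_eq_some_iff hT).2 ⟨h.symm, h1⟩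
    exact absurd (hf.head this) hg
  · have hp : parent T r f = some g := (parent_eq_some_iff hT).2 ⟨h, h1⟩
    rcases Relation.ReflTransGen.cases_head hf with rfl | ⟨g', h2, h3⟩
    · have := (mem_children_iff hT).1 hc
      rw [hp] at this
      exact ⟨rfl, Option.some_inj.1 this⟩
    · rw [hp] at h2
      exact absurd (Option.some_inj.1 h2 ▸ h3) hg

variable {V : Type} [DecidableEq V] {Q : JoinQuery V ι}

/-- The relations containing `x` are connected, so a walk among them from `f` to `g` has to cross
the edge between `c` and `e`. -/
lemma JoinQuery.IsJoinTree.mem_common (hT : Q.IsJoinTree T) {r e c f g : ι}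
    (hc : c ∈ children T r e) (hf : Below T r c f) (hg : ¬ Below T r c g) {x : V}
    (hxf : x ∈ Q.sch f) (hxg : x ∈ Q.sch g) : x ∈ Q.common c e := by
  obtain ⟨p⟩ := (hT.2 x).preconnected ⟨f, hxf⟩ ⟨g, hxg⟩
  have key : ∀ (u v : {e | x ∈ Q.sch e}), (T.induce {e | x ∈ Q.sch e}).Walk u v → Below T r c u.1 →
      ¬ Below T r c v.1 → x ∈ Q.common c e := by
    intro u v p
    induction p with
    | nil => exact fun h h' => absurd h h'
    | @cons u w v h p ih =>
      intro hu hv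
      by_cases hw : Below T r c w.1
      · exact ih hw hv
      · obtain ⟨h1, h2⟩ := adj_below hT.1 hc hu hw h
        have h3 : x ∈ Q.sch u.1 := u.2
        have h4 : x ∈ Q.sch w.1 := w.2
        rw [h1] at h3
        rw [h2] at h4
        exact Finset.mem_inter.2 ⟨h3, h4⟩
  exact key _ _ p hf hg

end Below

/-! ### Attributes of subtrees -/

section Attributes

variable {V ι : Type} [DecidableEq V] [Fintype ι] {Q : JoinQuery V ι} {T : SimpleGraph ι}

variable (Q T) in
open Classical in
/-- The attributes of the relations in the subtree of `e`. -/
noncomputable def belowAttrs (r e : ι) : Finset V := (Finset.univ.filter (Below T r e)).biUnion Q.sch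

lemma mem_belowAttrs {r e : ι} {x : V} :
    x ∈ belowAttrs Q T r e ↔ ∃ f, Below T r e f ∧ x ∈ Q.sch f := by
  simp [belowAttrs]

lemma sch_subset_belowAttrs {r e f : ι} (h : Below T r e f) : Q.sch f ⊆ belowAttrs Q T r e :=
  fun _ hx => mem_belowAttrs.2 ⟨f, h, hx⟩

variable (Q T) in
/-- The attributes of `e` and of the relations in the subtrees of the given children of `e`. -/
noncomputable def childAttrs (r e : ι) : List ι → Finset V
  | [] => Q.sch e
  | c :: cs => childAttrs r e cs ∪ belowAttrs Q T r c

lemma mem_childAttrs {r e : ι} {cs : List ι} {x : V} :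
    x ∈ childAttrs Q T r e cs ↔ x ∈ Q.sch e ∨ ∃ c ∈ cs, x ∈ belowAttrs Q T r c := by
  induction cs with
  | nil => simp [childAttrs]
  | cons c cs ih =>
    simp only [childAttrs, Finset.mem_union, ih, List.mem_cons, exists_eq_or_imp, or_assoc]
    exact or_congr_right or_comm

lemma childAttrs_children (hT : T.IsTree) (r e : ι) :
    childAttrs Q T r e (children T r e) = belowAttrs Q T r e := by
  ext x
  simp only [mem_childAttrs, mem_belowAttrs]
  constructor
  · rintro (h | ⟨c, hc, f, hf, hx⟩)
    · exact ⟨e, Relation.ReflTransGen.refl, h⟩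
    · exact ⟨f, (below_iff hT).2 (Or.inr ⟨c, hc, hf⟩), hx⟩
  · rintro ⟨f, hf, hx⟩
    rcases (below_iff hT).1 hf with rfl | ⟨c, hc, hf⟩
    · exact Or.inl hx
    · exact Or.inr ⟨c, hc, f, hf, hx⟩

/-- The attributes collected so far belong to `e` or to subtrees of other children, all outside the
subtree of `c`, so the crossing-edge argument applies. -/
lemma JoinQuery.IsJoinTree.mem_common_of_mem_childAttrs (hT : Q.IsJoinTree T) {r e c : ι}
    {cs : List ι} (hc : c ∈ children T r e) (hcs : ∀ c' ∈ cs, c' ∈ children T r e) (hccs : c ∉ cs)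
    {x : V} (hx : x ∈ childAttrs Q T r e cs) (hxc : x ∈ belowAttrs Q T r c) :
    x ∈ Q.common c e := by
  obtain ⟨f, hf, hxf⟩ := mem_belowAttrs.1 hxc
  rcases mem_childAttrs.1 hx with h | ⟨c', hc', h⟩
  · exact hT.mem_common hc hf (not_below_of_mem_children hT.1 hc) hxf h
  · obtain ⟨g, hg, hxg⟩ := mem_belowAttrs.1 h
    refine hT.mem_common hc hf (fun hg' => hccs ?_) hxf hxg
    rwa [Below.eq_of_mem_children hT.1 hc (hcs c' hc') hg' hg]

end Attributes

/-! ### The real items of a batch are the join results over a subtree -/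

section Semantics

variable {V ι : Type} [DecidableEq V] [Fintype ι] {dom : V → Type} {Q : JoinQuery V ι}
  {T : SimpleGraph ι}

/-- Children are attached one at a time. By the running intersection property, attributes common to
the part built so far and to the subtree of `c` lie in `Q.common c e`, where both sides agree with
the key. So any two partial results can be merged, and restriction inverts merging. This is where
the join tree property is essential. -/
lemma childItems_spec (hT : Q.IsJoinTree T) {D : List (ι × Tup dom)} {L : Index ι dom}
    (hL : IndexCorrect Q T D L) {r e : ι} {depth : ℕ} {t : Tup dom}
    (ht : t.supp = (Q.sch e : Set V))
    (IH : ∀ c ∈ children T r e, ∀ t', (c, t') ∈ D →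
      (tupleItems Q T L r depth c t').reduceOption.Nodup ∧
      ∀ y, y ∈ (tupleItems Q T L r depth c t').reduceOption ↔ Tup.proj (Q.sch c) y = t' ∧
        y.supp = (belowAttrs Q T r c : Set V) ∧
        ∀ f, Below T r c f → (f, Tup.proj (Q.sch f) y) ∈ D)
    (cs : List ι) (hcs : ∀ c ∈ cs, c ∈ children T r e) (hn : cs.Nodup) :
    (childItems Q T L r depth e t cs).reduceOption.Nodup ∧
      ∀ y, y ∈ (childItems Q T L r depth e t cs).reduceOption ↔ Tup.proj (Q.sch e) y = t ∧
        y.supp = (childAttrs Q T r e cs : Set V) ∧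
        ∀ c ∈ cs, ∀ f, Below T r c f → (f, Tup.proj (Q.sch f) y) ∈ D := by
  induction cs with
  | nil =>
    have h : (childItems Q T L r depth e t []).reduceOption = [t] := rfl
    rw [h]
    refine ⟨List.nodup_singleton t, fun y => ?_⟩
    simp only [List.mem_singleton, childAttrs, List.not_mem_nil, false_implies, implies_true, and_true]
    constructor
    · rintro rfl
      exact ⟨Tup.proj_self ht, ht⟩
    · rintro ⟨h1, h2⟩
      rw [← h1, Tup.proj_self h2]
  | cons c cs ih =>
    rw [List.nodup_cons] at hn
    simp only [List.mem_cons, forall_eq_or_imp] at hcs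
    obtain ⟨ih1, ih2⟩ := ih hcs.2 hn.2
    have hp := (mem_children_iff hT.1).1 hcs.1
    set s := Tup.proj (Q.common c e) t with hs
    set A := childAttrs Q T r e cs with hA
    set B := belowAttrs Q T r c with hB
    have heA : Q.sch e ⊆ A := fun x hx => mem_childAttrs.2 (Or.inl hx)
    have hcB : Q.sch c ⊆ B := sch_subset_belowAttrs Relation.ReflTransGen.refl
    have hcomc : Q.common c e ⊆ Q.sch c := Finset.inter_subset_left
    have hcome : Q.common c e ⊆ Q.sch e := Finset.inter_subset_right
    have hperm := hL.keyItems_perm hp s depth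
    -- Items from different tuples differ, because projection onto the attributes of `c` recovers
    -- the tuple.
    have hkeyn : (keyItems Q T L r depth c s).reduceOption.Nodup := by
      rw [hperm.nodup_iff, List.nodup_flatMap]
      have hD : ∀ t' ∈ L.rel c e s, (c, t') ∈ D := fun t' ht' => ((hL.rel.mem _ _ _ _).1 ht').1
      refine ⟨fun t' ht' => (IH c hcs.1 t' (hD t' ht')).1,
        (hL.rel.nodup c e s).pairwise_of_forall_ne fun t' ht' t'' ht'' hne y hy hy' => hne ?_⟩
      rw [(IH c hcs.1 t' (hD t' ht')).2] at hy
      rw [(IH c hcs.1 t'' (hD t'' ht'')).2] at hy'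
      rw [← hy.1, ← hy'.1]
    have hkey : ∀ b, b ∈ (keyItems Q T L r depth c s).reduceOption ↔ b.supp = (B : Set V) ∧
        (∀ f, Below T r c f → (f, Tup.proj (Q.sch f) b) ∈ D) ∧ Tup.proj (Q.common c e) b = s := by
      intro b
      rw [hperm.mem_iff, List.mem_flatMap]
      constructor
      · rintro ⟨t', ht', hb⟩
        rw [hL.rel.mem] at ht'
        rw [(IH c hcs.1 t' ht'.1).2] at hb
        refine ⟨hb.2.1, hb.2.2, ?_⟩
        rw [← ht'.2, ← hb.1, Tup.proj_proj hcomc]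
      · rintro ⟨h1, h2, h3⟩
        have h4 := h2 c Relation.ReflTransGen.refl
        refine ⟨Tup.proj (Q.sch c) b, ?_, ?_⟩
        · rw [hL.rel.mem]
          exact ⟨h4, by rw [Tup.proj_proj hcomc, h3]⟩
        · rw [(IH c hcs.1 _ h4).2]
          exact ⟨rfl, h1, h2⟩
    have hagree : ∀ a ∈ (childItems Q T L r depth e t cs).reduceOption,
        ∀ b ∈ (keyItems Q T L r depth c s).reduceOption, ∀ x ∈ A, x ∈ B → a x = b x := by
      intro a ha b hb x hxA hxB
      rw [ih2] at ha
      rw [hkey] at hb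
      have hx := hT.mem_common_of_mem_childAttrs hcs.1 hcs.2 hn.1 hxA hxB
      rw [← Tup.proj_apply (hcome hx) a, ha.1, ← Tup.proj_apply hx b, hb.2.2, hs, Tup.proj_apply hx]
    have hred : (childItems Q T L r depth e t (c :: cs)).reduceOption =
        (keyItems Q T L r depth c s).reduceOption.flatMap fun b =>
          (childItems Q T L r depth e t cs).reduceOption.map fun a => Tup.merge a b :=
      reduceOption_itemProduct _ _ _
    rw [hred]
    constructor
    · rw [List.nodup_flatMap]
      constructor
      · intro b hb
        refine List.Nodup.map_on (fun a ha a' ha' h => ?_) ih1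
        rw [ih2] at ha ha'
        rw [← Tup.proj_self ha.2.1, ← Tup.proj_self ha'.2.1,
          ← Tup.proj_merge_left (b := b) ha.2.1 (Finset.Subset.refl _), h,
          Tup.proj_merge_left ha'.2.1 (Finset.Subset.refl _)]
      · refine hkeyn.pairwise_of_forall_ne fun b hb b' hb' hne y hy hy' => hne ?_
        obtain ⟨a, ha, rfl⟩ := List.mem_map.1 hy
        obtain ⟨a', ha', h⟩ := List.mem_map.1 hy'
        rw [← Tup.proj_self ((hkey b).1 hb).1, ← Tup.proj_self ((hkey b').1 hb').1,
          ← Tup.proj_merge_right ((ih2 a).1 ha).2.1 (hagree a ha b hb) (Finset.Subset.refl _), ← h,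
          Tup.proj_merge_right ((ih2 a').1 ha').2.1 (hagree a' ha' b' hb') (Finset.Subset.refl _)]
    · intro y
      simp only [List.mem_flatMap, List.mem_map]
      constructor
      · rintro ⟨b, hb, a, ha, rfl⟩
        have hag := hagree a ha b hb
        rw [ih2] at ha
        rw [hkey] at hb
        refine ⟨?_, Tup.supp_merge ha.2.1 hb.1, ?_⟩
        · rw [Tup.proj_merge_left ha.2.1 heA, ha.1]
        · simp only [List.mem_cons, forall_eq_or_imp]
          refine ⟨fun f hf => ?_, fun c' hc' f hf => ?_⟩
          · rw [Tup.proj_merge_right ha.2.1 hag (sch_subset_belowAttrs hf)]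
            exact hb.2.1 f hf
          · rw [Tup.proj_merge_left ha.2.1 fun x hx =>
              mem_childAttrs.2 (Or.inr ⟨c', hc', sch_subset_belowAttrs hf hx⟩)]
            exact ha.2.2 c' hc' f hf
      · rintro ⟨h1, h2, h3⟩
        simp only [List.mem_cons, forall_eq_or_imp] at h3
        have h2' : y.supp = (A ∪ B : Finset V) := h2
        refine ⟨Tup.proj B y, ?_, Tup.proj A y, ?_, Tup.merge_proj h2'⟩
        · rw [hkey]
          refine ⟨Tup.supp_proj h2' Finset.subset_union_right, fun f hf => ?_, ?_⟩
          · rw [Tup.proj_proj (sch_subset_belowAttrs hf)]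
            exact h3.1 f hf
          · rw [Tup.proj_proj (hcomc.trans hcB), hs, ← h1, Tup.proj_proj hcome]
        · rw [ih2]
          refine ⟨by rw [Tup.proj_proj heA, h1], Tup.supp_proj h2' Finset.subset_union_left,
            fun c' hc' f hf => ?_⟩
          rw [Tup.proj_proj fun x hx =>
            mem_childAttrs.2 (Or.inr ⟨c', hc', sch_subset_belowAttrs hf hx⟩)]
          exact h3.2 c' hc' f hf

lemma tupleItems_spec (hT : Q.IsJoinTree T) {D : List (ι × Tup dom)} {L : Index ι dom}
    (hL : IndexCorrect Q T D L) (hD : ∀ p ∈ D, p.2.supp = (Q.sch p.1 : Set V)) (r : ι) (depth : ℕ)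
    (e : ι) (he : Fintype.card ι ≤ T.dist r e + depth) (t : Tup dom) (ht : (e, t) ∈ D) :
    (tupleItems Q T L r depth e t).reduceOption.Nodup ∧
      ∀ y, y ∈ (tupleItems Q T L r depth e t).reduceOption ↔ Tup.proj (Q.sch e) y = t ∧
        y.supp = (belowAttrs Q T r e : Set V) ∧
        ∀ f, Below T r e f → (f, Tup.proj (Q.sch f) y) ∈ D := by
  induction depth generalizing e t with
  | zero => have := dist_lt_card hT.1 r e; omega
  | succ depth ih =>
    have hsupp : t.supp = (Q.sch e : Set V) := hD (e, t) ht
    obtain ⟨h1, h2⟩ := childItems_spec hT hL hsupp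
      (fun c hc t' ht' => ih c (by have := (mem_children.1 hc).2; omega) t' ht')
      (children T r e) (fun _ h => h) (nodup_children r e)
    rw [tupleItems_succ]
    refine ⟨h1, fun y => ?_⟩
    rw [h2, childAttrs_children hT.1]
    constructor
    · rintro ⟨h3, h4, h5⟩
      refine ⟨h3, h4, fun f hf => ?_⟩
      rcases (below_iff hT.1).1 hf with rfl | ⟨c, hc, hf⟩
      · rwa [h3]
      · exact h5 c hc f hf
    · rintro ⟨h3, h4, h5⟩
      exact ⟨h3, h4, fun c hc f hf => h5 f ((below_iff hT.1).2 (Or.inr ⟨c, hc, hf⟩))⟩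

/-- From the root, every relation lies below and every attribute is covered, so partial results are
full join results. -/
lemma mem_tupleItems_root (hT : Q.IsJoinTree T) {D : List (ι × Tup dom)} {L : Index ι dom}
    (hL : IndexCorrect Q T D L) (hD : ∀ p ∈ D, p.2.supp = (Q.sch p.1 : Set V)) {e : ι} {t : Tup dom}
    (ht : (e, t) ∈ D) (y : Tup dom) :
    y ∈ (tupleItems Q T L e (Fintype.card ι) e t).reduceOption ↔
      y ∈ Q.results (database D) ∧ Tup.proj (Q.sch e) y = t := by
  have h : (belowAttrs Q T e e : Set V) = Set.univ := by
    refine Set.eq_univ_of_forall fun x => ?_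
    obtain ⟨f, hf⟩ := Q.cover x
    exact sch_subset_belowAttrs (below_root hT.1 e f) hf
  rw [(tupleItems_spec hT hL hD e (Fintype.card ι) e (by omega) t ht).2, h]
  constructor
  · rintro ⟨h1, h2, h3⟩
    exact ⟨⟨h2, fun f => h3 f (below_root hT.1 e f)⟩, h1⟩
  · rintro ⟨⟨h2, h3⟩, h1⟩
    exact ⟨h1, h2, fun f _ => h3 f⟩

end Semantics

/-! ### Enumeration of all join results and the resulting time bounds -/

section Stream

variable {V ι : Type} [DecidableEq V] {dom : V → Type} {Q : JoinQuery V ι}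

lemma JoinQuery.results_subset_append (D D' : List (ι × Tup dom)) :
    Q.results (database D) ⊆ Q.results (database (D ++ D')) :=
  fun _ hy => ⟨hy.1, fun e => List.mem_append_left _ (hy.2 e)⟩

/-- If a result does not use the inserted tuple, all its projections were already present.
Conversely, a result using it cannot be old, since the tuple was absent. -/
lemma JoinQuery.mem_results_concat {D : List (ι × Tup dom)} {p : ι × Tup dom} (hp : p ∉ D)
    (y : Tup dom) : y ∈ Q.results (database (D ++ [p])) ∧ Tup.proj (Q.sch p.1) y = p.2 ↔
      y ∈ Q.results (database (D ++ [p])) ∧ y ∉ Q.results (database D) := by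
  refine and_congr_right fun hy => ⟨fun h h' => hp ?_, fun h => ?_⟩
  · have : (p.1, Tup.proj (Q.sch p.1) y) ∈ D := h'.2 p.1
    rwa [h] at this
  · by_contra hne
    refine h ⟨hy.1, fun f => ?_⟩
    have h1 : (f, Tup.proj (Q.sch f) y) ∈ D ++ [p] := hy.2 f
    rcases List.mem_append.1 h1 with h2 | h2
    · exact h2
    · rw [List.mem_singleton] at h2
      subst h2
      exact absurd rfl hne

/-- Without relations the empty tuple would be a result. -/
lemma JoinQuery.results_database_nil [Nonempty ι] :
    Q.results (database ([] : List (ι × Tup dom))) = ∅ := by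
  refine Set.eq_empty_of_forall_notMem fun y hy => ?_
  have : (Classical.arbitrary ι, Tup.proj (Q.sch (Classical.arbitrary ι)) y) ∈
    ([] : List (ι × Tup dom)) := hy.2 _
  simp at this

variable [Fintype ι] {T : SimpleGraph ι}

lemma map_fst_items_stepBatch (L : Index ι dom) (p : ι × Tup dom) :
    (stepBatch Q T L p).items.map Prod.fst =
      tupleItems Q T (indexStep Q T L p) p.1 (Fintype.card ι) p.1 p.2 := by
  rw [Batch.items, stepBatch_size, List.map_map]
  rfl

variable (ι) in
/-- The bound on the time of one access to an item, for a stream of length `N`. -/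
def itemCost (N : ℕ) : ℕ :=
  (2 * Fintype.card ι + 1) ^ Fintype.card ι * (5 * (sizeExponent ι * Nat.clog 2 (2 * N)) + 20)

lemma items_stepBatch_cost_le (hT : T.IsTree) {D : List (ι × Tup dom)} {L : Index ι dom}
    {p : ι × Tup dom} (hL : IndexCorrect Q T D (indexStep Q T L p)) {N : ℕ} (hN : 1 ≤ N)
    (hDN : D.length ≤ N) : ∀ x ∈ (stepBatch Q T L p).items, x.2 ≤ itemCost ι N := by
  intro x hx
  obtain ⟨z, -, rfl⟩ := List.mem_map.1 hx
  refine (retrieve_cost_le (Q := Q) (L := indexStep Q T L p) (r := p.1) hT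
    (fun c hc s => hL.cnt_le hT hN hDN hc s) (Fintype.card ι) p.1 p.2 z).trans ?_
  have h : Nat.log 2 ((2 * N) ^ sizeExponent ι) ≤ sizeExponent ι * Nat.clog 2 (2 * N) :=
    (Nat.log_le_clog _ _).trans (clog_pow_le _ _)
  exact Nat.mul_le_mul_left _ (by omega)

/-- Each batch lists exactly the results created by its insertion. Later batches contain only later
results, so the concatenation has no repetitions; density is preserved by concatenation. -/
lemma streamItems_spec (hT : Q.IsJoinTree T) {N : ℕ} (hN : 1 ≤ N) (D' : List (ι × Tup dom))
    {D : List (ι × Tup dom)} (hD : Q.IsStream (D ++ D')) (hDN : (D ++ D').length ≤ N)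
    {L : Index ι dom} (hL : IndexCorrect Q T D L) :
    ((streamItems Q T L D').map Prod.fst).reduceOption.Nodup ∧
    (∀ y, y ∈ ((streamItems Q T L D').map Prod.fst).reduceOption ↔
      y ∈ Q.results (database (D ++ D')) ∧ y ∉ Q.results (database D)) ∧
    PrefixDense (densityBound ι (Fintype.card ι)) ((streamItems Q T L D').map Prod.fst) ∧
    ∀ x ∈ streamItems Q T L D', x.2 ≤ itemCost ι N := by
  induction D' generalizing D L with
  | nil => simp [streamItems, PrefixDense.nil, List.reduceOption]
  | cons p D' ih =>
    have hD' : (D ++ [p]) ++ D' = D ++ p :: D' := by simp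
    have hsub : (D ++ [p]).Sublist (D ++ p :: D') := List.Sublist.append_left (by simp) D
    have hn := hsub.nodup hD.1
    have h1 : IndexCorrect Q T (D ++ [p]) (indexStep Q T L p) :=
      (indexCorrect_foldl hT.1 [p] (D := D) hn hL).1
    obtain ⟨i1, i2, i3, i4⟩ := ih (D := D ++ [p]) (by rwa [hD']) (by rwa [hD']) h1
    have hpD : p ∉ D := by
      rw [List.nodup_append] at hn
      exact fun h => hn.2.2 _ h _ (by simp) rfl
    have hs : ∀ q ∈ D ++ [p], q.2.supp = (Q.sch q.1 : Set V) := fun q hq =>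
      hD.2 q (hsub.subset hq)
    have hp : (p.1, p.2) ∈ D ++ [p] := by simp
    have b1 := (tupleItems_spec hT h1 hs p.1 (Fintype.card ι) p.1 (by omega) p.2 hp).1
    have b2 : ∀ y, y ∈ (tupleItems Q T (indexStep Q T L p) p.1 (Fintype.card ι) p.1
        p.2).reduceOption ↔ y ∈ Q.results (database (D ++ [p])) ∧ y ∉ Q.results (database D) :=
      fun y => (mem_tupleItems_root hT h1 hs hp y).trans (JoinQuery.mem_results_concat hpD y)
    have b3 := h1.prefixDense_tupleItems hT.1 p.1 (Fintype.card ι) p.1 (by omega) p.2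
    have b4 := items_stepBatch_cost_le (p := p) hT.1 h1 hN
      (le_trans (by simp) hDN)
    rw [streamItems, List.map_append, map_fst_items_stepBatch, List.reduceOption_append]
    rw [hD'] at i2
    refine ⟨?_, fun y => ?_, b3.append i3, fun x hx => ?_⟩
    · refine b1.append i1 fun y hy hy' => ?_
      rw [b2] at hy
      rw [i2] at hy'
      exact hy'.2 hy.1
    · rw [List.mem_append, b2, i2]
      have m1 := @JoinQuery.results_subset_append V ι _ dom Q D [p] y
      have m2 := @JoinQuery.results_subset_append V ι _ dom Q (D ++ [p]) D' y
      rw [hD'] at m2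
      tauto
    · exact (List.mem_append.1 hx).elim (b4 x) (i4 x)

lemma setOf_mem_streamItems (hT : Q.IsJoinTree T) {D : List (ι × Tup dom)} (hD : Q.IsStream D) :
    ((streamItems Q T Index.empty D).map Prod.fst).reduceOption.Nodup ∧
    {y | y ∈ ((streamItems Q T Index.empty D).map Prod.fst).reduceOption} =
      Q.results (database D) := by
  have : Nonempty ι := hT.1.connected.nonempty
  obtain ⟨h1, h2, -⟩ := streamItems_spec hT (N := D.length + 1) (by omega) D (D := []) hD (by simp)
    (indexCorrect_empty Q T)
  refine ⟨h1, Set.ext fun y => ?_⟩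
  rw [Set.mem_ofPred_eq, h2, JoinQuery.results_database_nil]
  simp

lemma ncard_results (hT : Q.IsJoinTree T) {D : List (ι × Tup dom)} (hD : Q.IsStream D) :
    ((streamItems Q T Index.empty D).map Prod.fst).reduceOption.length =
      (Q.results (database D)).ncard := by
  classical
  obtain ⟨h1, h2⟩ := setOf_mem_streamItems hT hD
  rw [← h2, ← List.toFinset_card_of_nodup h1, ← Set.ncard_coe_finset]
  congr 1
  ext y
  simp

lemma ncard_results_le (hT : Q.IsJoinTree T) {D : List (ι × Tup dom)} (hD : Q.IsStream D)
    (hN : 1 ≤ D.length) :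
    (Q.results (database D)).ncard ≤ D.length * (2 * D.length) ^ sizeExponent ι := by
  rw [← ncard_results hT hD]
  refine (List.reduceOption_length_le _).trans ?_
  rw [List.length_map]
  exact length_streamItems_le hT.1 D (D := []) hD.1 (indexCorrect_empty Q T) hN (by simp)

/-- `2 ^ (clog - 1) < 2 * N` bounds `clog * log 2` by `2 * log 2 + log N ≤ 3 * log N`, and `3 / log
2 < 5`. -/
lemma clog_two_mul_le_log {N : ℕ} (hN : 2 ≤ N) : (Nat.clog 2 (2 * N) : ℝ) ≤ 5 * Real.log N := by
  have h1 := Nat.pow_pred_clog_lt_self (b := 2) (by norm_num) (show 1 < 2 * N by omega)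
  have hpos : 1 ≤ Nat.clog 2 (2 * N) := Nat.clog_pos (by norm_num) (by omega)
  have h2 : ((2 : ℝ)) ^ (Nat.clog 2 (2 * N) - 1) ≤ 2 * N := by exact_mod_cast h1.le
  have h3 := Real.log_le_log (by positivity) h2
  have hN' : (2 : ℝ) ≤ N := by exact_mod_cast hN
  rw [Real.log_pow, Real.log_mul (by norm_num) (by positivity)] at h3
  have h4 := Real.log_le_log (by norm_num) hN'
  have h5 := Real.log_two_gt_d9
  rw [Nat.cast_sub hpos, Nat.cast_one] at h3
  nlinarith [Nat.cast_nonneg (α := ℝ) (Nat.clog 2 (2 * N))]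

variable (ι) in
/-- The constant in the bound on the expected running time in terms of the number of results. -/
noncomputable def timeConstant : ℝ :=
  (24 + 2 * insertCost ι + stepCharge ι * (Fintype.card ι) ^ 2 * (5 * sizeExponent ι + 2)) +
    (40 + (2 * Fintype.card ι + 1) ^ Fintype.card ι * (25 * sizeExponent ι + 40)) *
      (2 * densityBound ι (Fintype.card ι))

lemma timeConstant_pos : 0 < timeConstant ι := by
  unfold timeConstant
  positivity

lemma expectedTime_reservoirTime_le (hT : Q.IsJoinTree T) {D : List (ι × Tup dom)}
    (hD : Q.IsStream D) {k : ℕ} (hk : 1 ≤ k) (hN : 2 ≤ D.length) :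
    expectedTime (reservoirTime Q T k D) ≤ ENNReal.ofReal (timeConstant ι *
      (D.length * Real.log D.length + k * Real.log D.length *
        Real.log (1 + (Q.results (database D)).ncard / k))) := by
  obtain ⟨-, -, h3, h4⟩ := streamItems_spec hT (N := D.length) (by omega) D (D := []) hD (by simp)
    (indexCorrect_empty Q T)
  refine (expectedTime_le Q T hk (one_le_densityBound _) D h4 h3).trans (ENNReal.ofReal_le_ofReal ?_)
  rw [ncard_results hT hD]
  have hcost : (indexCost Q T Index.empty D : ℝ) ≤ insertCost ι * D.length +
      stepCharge ι * (Fintype.card ι * (D.length * (Fintype.card ι *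
        (sizeExponent ι * Nat.clog 2 (2 * D.length) + 1)))) := by
    exact_mod_cast indexCost_le (Q := Q) hT.1 hD.1 (by omega : 1 ≤ D.length) le_rfl
  have hl := clog_two_mul_le_log hN
  set n : ℝ := (D.length : ℝ) with hn
  set ℓ : ℝ := (Nat.clog 2 (2 * D.length) : ℝ) with hℓ
  set lg := Real.log n with hlg
  have hn2 : (2 : ℝ) ≤ n := by rw [hn]; exact_mod_cast hN
  -- As `N ≥ 2`, additive constants can be absorbed into multiples of `log N`.
  have hlg1 : 1 ≤ 2 * lg := by
    have h4 := Real.log_le_log (by norm_num) hn2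
    have h5 := Real.log_two_gt_d9
    linarith
  set J := Real.log (1 + ((Q.results (database D)).ncard : ℝ) / k) with hJ
  have hJ0 : 0 ≤ J := Real.log_nonneg (by
    have : (0 : ℝ) ≤ ((Q.results (database D)).ncard : ℝ) / k := by positivity
    linarith)
  have hnlg : n ≤ n * (2 * lg) := le_mul_of_one_le_right (by linarith) hlg1
  have hB : (sizeExponent ι : ℝ) * ℓ + 1 ≤ (5 * sizeExponent ι + 2) * lg := by
    have := mul_le_mul_of_nonneg_left hl (Nat.cast_nonneg (α := ℝ) (sizeExponent ι))
    linarith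
  have e1 : 4 + 10 * n + (indexCost Q T Index.empty D : ℝ) ≤
      (24 + 2 * insertCost ι + stepCharge ι * (Fintype.card ι) ^ 2 * (5 * sizeExponent ι + 2)) *
        (n * lg) := by
    have f1 := mul_le_mul_of_nonneg_left hnlg (Nat.cast_nonneg (α := ℝ) (insertCost ι))
    have f2 : (stepCharge ι : ℝ) * (Fintype.card ι * (n * (Fintype.card ι *
        (sizeExponent ι * ℓ + 1)))) ≤ stepCharge ι * (Fintype.card ι * (n * (Fintype.card ι *
        ((5 * sizeExponent ι + 2) * lg)))) := by gcongr
    nlinarith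
  have e2 : (20 : ℝ) + itemCost ι D.length ≤
      (40 + (2 * Fintype.card ι + 1) ^ Fintype.card ι * (25 * sizeExponent ι + 40)) * lg := by
    have f1 : (itemCost ι D.length : ℝ) = (2 * Fintype.card ι + 1) ^ Fintype.card ι *
        (5 * (sizeExponent ι * ℓ) + 20) := by
      rw [itemCost]; push_cast; rfl
    have f2 : 5 * (sizeExponent ι * ℓ) + 20 ≤ (25 * sizeExponent ι + 40) * lg := by
      have := mul_le_mul_of_nonneg_left hl (Nat.cast_nonneg (α := ℝ) (sizeExponent ι))
      linarith
    have f3 := mul_le_mul_of_nonneg_left f2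
      (show (0 : ℝ) ≤ (2 * Fintype.card ι + 1) ^ Fintype.card ι by positivity)
    rw [f1]
    linarith
  have e3 := mul_le_mul_of_nonneg_right e2
    (show 0 ≤ 2 * ((k : ℝ) * densityBound ι (Fintype.card ι)) * J by positivity)
  have e4 : 0 ≤ n * lg := by nlinarith
  have e5 : 0 ≤ (k : ℝ) * lg * J := mul_nonneg (mul_nonneg (by positivity) (by linarith)) hJ0
  have c1 : (0 : ℝ) ≤ 24 + 2 * insertCost ι + stepCharge ι * (Fintype.card ι) ^ 2 *
    (5 * sizeExponent ι + 2) := by positivity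
  have c2 : (0 : ℝ) ≤ (40 + (2 * Fintype.card ι + 1) ^ Fintype.card ι *
    (25 * sizeExponent ι + 40)) * (2 * densityBound ι (Fintype.card ι)) := by positivity
  -- `timeConstant` is the sum of the constants of the two terms, so the two cross products have to
  -- be nonnegative.
  have g1 := mul_nonneg c1 e5
  have g2 := mul_nonneg c2 e4
  unfold timeConstant
  linarith

/-- The number of results is polynomial in the length of the stream, so this logarithm is `O(log N)`
for every `k`. -/
lemma log_one_add_ncard_div_le (hT : Q.IsJoinTree T) {D : List (ι × Tup dom)}
    (hD : Q.IsStream D) {k : ℕ} (hk : 1 ≤ k) (hN : 2 ≤ D.length) :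
    Real.log (1 + (Q.results (database D)).ncard / k) ≤
      (2 + 2 * sizeExponent ι) * Real.log D.length := by
  have h1 : (Q.results (database D)).ncard ≤ D.length ^ (1 + 2 * sizeExponent ι) := by
    refine (ncard_results_le hT hD (by omega)).trans ?_
    rw [pow_add, pow_one, pow_mul]
    exact Nat.mul_le_mul_left _ (Nat.pow_le_pow_left (by nlinarith) _)
  have h2 : 1 + D.length ^ (1 + 2 * sizeExponent ι) ≤ D.length ^ (2 + 2 * sizeExponent ι) := by
    have : 1 ≤ D.length ^ (1 + 2 * sizeExponent ι) := Nat.one_le_pow _ _ (by omega)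
    have h3 : D.length ^ (2 + 2 * sizeExponent ι) =
      D.length * D.length ^ (1 + 2 * sizeExponent ι) := by ring
    nlinarith
  have h3 : (1 : ℝ) + (Q.results (database D)).ncard / k ≤
      (D.length : ℝ) ^ (2 + 2 * sizeExponent ι) := by
    have h4 : ((Q.results (database D)).ncard : ℝ) / k ≤ (Q.results (database D)).ncard :=
      div_le_self (by positivity) (by exact_mod_cast hk)
    have h5 : ((1 + (Q.results (database D)).ncard : ℕ) : ℝ) ≤
      ((D.length ^ (2 + 2 * sizeExponent ι) : ℕ) : ℝ) := by exact_mod_cast (by omega)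
    push_cast at h5
    linarith
  refine (Real.log_le_log (by positivity) h3).trans (le_of_eq ?_)
  rw [Real.log_pow]
  push_cast
  ring

end Stream

theorem mainTheorem1 {V ι : Type} [DecidableEq V] [Fintype ι] (Q : JoinQuery V ι)
    (hQ : Q.IsAcyclic) :
    ∃ C : ℝ, 0 < C ∧ ∀ T : SimpleGraph ι, Q.IsJoinTree T →
      ∀ (dom : V → Type) (k : ℕ) (D : List (ι × Tup dom)), 1 ≤ k → Q.IsStream D →
        (∀ i ≤ D.length, IsUniformSample tapeMeasure
          (reservoirSample Q T k (D.take i)) k (Q.results (database (D.take i)))) ∧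
        Measurable (reservoirTime Q T k D) ∧
        (2 ≤ D.length →
          expectedTime (reservoirTime Q T k D) ≤ ENNReal.ofReal (C *
            (D.length * Real.log D.length + k * Real.log D.length *
              Real.log (1 + (Q.results (database D)).ncard / k)))) ∧
        (2 ≤ D.length → k ≤ D.length → ∀ κ : ℝ, 1 ≤ κ →
          k * Real.log D.length ≤ κ * D.length →
          expectedTime (reservoirTime Q T k D) ≤ ENNReal.ofReal (C * κ *
            (D.length * Real.log D.length + k * Real.log D.length *
              Real.log (D.length / k)))) := by
  have hC : 0 < timeConstant ι := timeConstant_pos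
  -- Only the last bound needs the extra factor: `1` from the index term and `2 + 2 * sizeExponent
  -- ι` from the logarithm of the number of results.
  refine ⟨timeConstant ι * (3 + 2 * sizeExponent ι), by positivity,
    fun T hT dom k D hk hD => ⟨fun i _ => ?_, measurable_reservoirTime Q T hk D, fun hN => ?_,
      fun hN hkN κ hκ hkκ => ?_⟩⟩
  · have hi : Q.IsStream (D.take i) :=
      ⟨(List.take_sublist _ _).nodup hD.1, fun p hp => hD.2 p (List.mem_of_mem_take hp)⟩
    obtain ⟨h1, h2⟩ := setOf_mem_streamItems hT hi
    rw [← h2, funext (reservoirSample_eq Q T hk (D.take i))]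
    exact isUniformSample_sampleRun hk 0 0 _ h1
  · refine (expectedTime_reservoirTime_le hT hD hk hN).trans (ENNReal.ofReal_le_ofReal ?_)
    have hlg : 0 ≤ Real.log D.length := Real.log_natCast_nonneg _
    have hJ : 0 ≤ Real.log (1 + ((Q.results (database D)).ncard : ℝ) / k) := Real.log_nonneg (by
      have : (0 : ℝ) ≤ ((Q.results (database D)).ncard : ℝ) / k := by positivity
      linarith)
    refine mul_le_mul_of_nonneg_right ?_ (by positivity)
    exact le_mul_of_one_le_right hC.le (by
      have : (0 : ℝ) ≤ sizeExponent ι := Nat.cast_nonneg _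
      linarith)
  · refine (expectedTime_reservoirTime_le hT hD hk hN).trans (ENNReal.ofReal_le_ofReal ?_)
    have hlg : 0 ≤ Real.log D.length := Real.log_natCast_nonneg _
    have hJ := log_one_add_ncard_div_le hT hD hk hN
    have hb : (0 : ℝ) ≤ sizeExponent ι := Nat.cast_nonneg _
    have hk0 : (1 : ℝ) ≤ k := by exact_mod_cast hk
    have hNk : 0 ≤ Real.log ((D.length : ℝ) / k) :=
      Real.log_nonneg ((one_le_div (by linarith)).2 (by exact_mod_cast hkN))
    simp only [mul_assoc (timeConstant ι)]
    refine mul_le_mul_of_nonneg_left ?_ hC.le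
    set n : ℝ := (D.length : ℝ) with hn
    set lg := Real.log n with hlg'
    have hn0 : 0 ≤ n := Nat.cast_nonneg _
    -- Since `k * log N ≤ κ * N`, the sampling term is itself at most a multiple of `κ * N * log N`;
    -- the term with `log (N / k)` is afterwards added merely as a nonnegative quantity.
    have h1 : k * lg * Real.log (1 + ((Q.results (database D)).ncard : ℝ) / k) ≤
        κ * n * ((2 + 2 * sizeExponent ι) * lg) :=
      (mul_le_mul_of_nonneg_left hJ (by positivity)).trans
        (mul_le_mul_of_nonneg_right hkκ (by positivity))
    have h2 : n * lg ≤ κ * (n * lg) := le_mul_of_one_le_left (by positivity) hκ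
    have h3 : 0 ≤ (3 + 2 * (sizeExponent ι : ℝ)) * (κ * (k * lg * Real.log (n / k))) := by
      have : 0 ≤ κ := by linarith
      positivity
    calc n * lg + k * lg * Real.log (1 + ((Q.results (database D)).ncard : ℝ) / k)
        ≤ κ * (n * lg) + κ * n * ((2 + 2 * sizeExponent ι) * lg) := add_le_add h2 h1
      _ = (3 + 2 * sizeExponent ι) * (κ * (n * lg)) := by ring
      _ ≤ (3 + 2 * sizeExponent ι) * (κ * (n * lg)) +
          (3 + 2 * (sizeExponent ι : ℝ)) * (κ * (k * lg * Real.log (n / k))) :=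
        le_add_of_nonneg_right h3
      _ = _ := by ring
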